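/- **Setting.** Let $0<\beta<1/2$. For $w\in L^1(0,1)$ put $$ {}^lI^\beta w(x)=\frac1{\Gamma(\beta)}\int_0^x\frac{w(s)}{(x-s)^{1-\beta}}ds,\qquad {}^rI^\beta w(x)=\frac1{\Gamma(\beta)}\int_x^1\frac{w(s)}{(s-x)^{1-\beta}}ds,$$ and, for $0\le\theta\le1$, $I^\beta_\theta w=\theta\,{}^lI^\beta w+(1-\theta)\,{}^rI^\beta w$. Let $D$ be the weak derivative on $(0,1)$. For $\mu>0$ let $H^{\mu}_0(0,1)$ be the completion of $C_0^\infty(0,1)$ for the norm $\big(\|w\|^2_{L^2(\mathbb R)}+\||\omega|^{\mu}\hat w(\omega)\|^2_{L^2(\mathbb R)}\big)^{1/2}$ (with the unitary Fourier transform in the angular frequency $\omega$; for $\mu=1$ this is $(\|w\|_{L^2}^2+\|Dw\|_{L^2}^2)^{1/2}$), and let $H^{-1}(0,1)$ be the dual of $H^1_0(0,1)$ with the dual norm. Let $K$ be measurable on $(0,1)$ with $0<K_m\le K\le K_M<\infty$ a.e. For $u\in H_0^{1-\beta}(0,1)$, $v\in H_0^1(0,1)$ put $$A(u,v)=(K\,D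 I^\beta_\theta u,\,Dv)_{L^2(0,1)} .$$ A weak solution for $f\in H^{-1}(0,1)$ is a $u\in H^{1-\beta}_0(0,1)$ with $A(u,v)=\langle f,v\rangle$ for all $v\in H^1_0(0,1)$. Let $w_l\in H^1(0,1)$ be the solution of $(K Dw_l,Dv)_{L^2(0,1)}=0$ for all $v\in H^1_0(0,1)$ with $w_l(0)=1$, $w_l(1)=0$, and let $u_l\in H^{1-\beta}_0(0,1)$ denote the solution of $$I^\beta_\theta u_l(x)-(1-\theta)\,({}^rI^\beta u_l)(0)\,(1-x)-\theta\,({}^lI^\beta u_l)(1)\,x=w_l(x)-(1-x)\quad\text{for a.e. }x\in(0,1).$$ **Theorem.** For every $0<\beta<1/2$ there is $\varepsilon_0=\varepsilon_0(\beta)>0$ such that for all $0<K_m\le K_M$ there are constants $\kappa>0$ and $M$ depending only on $\beta,K_m,K_M$, and constants $C(m,\Lambda)$ depending only on $\beta,K_m,K_M,m,\Lambda$, with the following property. Let $0\le\theta\le1$ and let $K$ satisfy $K_m\le K\le K_M$ a.e. and $$\Big\|\Big(\int_0^1\frac{ds}{K(s)}\Big)^{-1}\frac1K-1\Big\|_{L^2(0,1)}<\varepsilon_0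 .$$ Then: 1. $u_l$ exists and is unique, and $1+\theta\,({}^lI^\beta u_l)(1)-(1-\theta)\,({}^rI^\beta u_l)(0)\neq0$. 2. For every $f\in H^{-1}(0,1)$ there is exactly one weak solution $u\in H^{1-\beta}_0(0,1)$. 3. $I^\beta_\theta w\in H^1(0,1)$ for all $w\in H_0^{1-\beta}(0,1)$, and $A$ is bounded and weakly coercive on $H_0^{1-\beta}(0,1)\times H_0^1(0,1)$: $|A(w,v)|\le M\|w\|_{H^{1-\beta}}\|v\|_{H^1}$ for all $w,v$, and $$\inf_{0\ne w\in H^{1-\beta}_0}\ \sup_{0\ne v\in H^1_0}\frac{A(w,v)}{\|w\|_{H^{1-\beta}}\|v\|_{H^1}}\ge\kappa,\qquad \sup_{w\in H_0^{1-\beta}}A(w,v)>0\quad\text{for all }0\ne v\in H^1_0(0,1).$$ Moreover the weak solution for $f\in H^{-1}(0,1)$ satisfies $\|u\|_{H^{1-\beta}}\le\frac1\kappa\|f\|_{H^{-1}}$. 4. If, in addition, $m\ge0$ is an integer, $K\in C^{m+1}[0,1]$ with $\|K\|_{C^{m+1}[0,1]}\le\Lambda$, and $f\in H^m(0,1)$,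 then the weak solution $u$ satisfies $I^\beta_\theta u\in H^{m+2}(0,1)$ and $$\|I^\beta_\theta u\|_{H^{m+2}(0,1)}\le C(m,\Lambda)\big(\|K\|_{C^{m+1}[0,1]}+\|f\|_{H^m(0,1)}\big).$$ -/

import Mathlib

open MeasureTheory Set
open scoped ENNReal ContDiff FourierTransform

namespace FracDiff

/-- Lebesgue measure on the interval `(0,1)`. -/
noncomputable def vol01 : Measure ℝ := volume.restrict (Ioo (0 : ℝ) 1)

/-- `φ ∈ C₀^∞(0,1)`, extended by zero to the real line. -/
def IsTestFunction (φ : ℝ → ℝ) : Prop :=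
  ContDiff ℝ ∞ φ ∧ tsupport φ ⊆ Ioo (0 : ℝ) 1

/-! ### Function spaces -/

/-- The space `H₀^μ(0,1)`: the completion of `C₀^∞(0,1)` for the norm
`‖w‖² = ‖w‖²_{L²(ℝ)} + ‖ |ω|^μ ŵ ‖²_{L²(ℝ)}`, where `ω = 2πξ` is the angular frequency.
The completion is realised as the closure of the graph `{(φ, |ω|^μ φ̂) : φ ∈ C₀^∞(0,1)}` in the
Hilbert space `L²(ℝ) × L²(ℝ; ℂ)`, whose norm restricts to the norm above. -/
noncomputable def H0 (μ : ℝ) :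
    Submodule ℝ (WithLp 2 (Lp ℝ 2 (volume : Measure ℝ) × Lp ℂ 2 (volume : Measure ℝ))) :=
  (Submodule.span ℝ {z | ∃ φ : ℝ → ℝ, IsTestFunction φ ∧
    (z.fst : ℝ → ℝ) =ᵐ[volume] φ ∧
    (z.snd : ℝ → ℂ) =ᵐ[volume]
      fun ξ => (((2 * Real.pi * |ξ|) ^ μ : ℝ) : ℂ) * 𝓕 (fun x => (φ x : ℂ)) ξ}).topologicalClosure

/-- The function underlying an element of `H₀^μ(0,1)` (defined almost everywhere). -/
noncomputable def H0fn {μ : ℝ} (u : H0 μ) : ℝ → ℝ := u.1.fst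

/-- The space `H₀¹(0,1)`: the completion of `C₀^∞(0,1)` for the norm
`‖v‖² = ‖v‖²_{L²(0,1)} + ‖Dv‖²_{L²(0,1)}`, realised as the closure of the graph
`{(φ, φ') : φ ∈ C₀^∞(0,1)}` in `L²(0,1) × L²(0,1)`. -/
noncomputable def H01 : Submodule ℝ (WithLp 2 (Lp ℝ 2 vol01 × Lp ℝ 2 vol01)) :=
  (Submodule.span ℝ {z | ∃ φ : ℝ → ℝ, IsTestFunction φ ∧
    (z.fst : ℝ → ℝ) =ᵐ[vol01] φ ∧
    (z.snd : ℝ → ℝ) =ᵐ[vol01] deriv φ}).topologicalClosure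

/-- The function underlying an element of `H₀¹(0,1)`. -/
noncomputable def H01fn (v : H01) : ℝ → ℝ := v.1.fst

/-- The weak derivative `Dv` of an element of `H₀¹(0,1)`. -/
noncomputable def H01D (v : H01) : ℝ → ℝ := v.1.snd

/-- `H⁻¹(0,1)`, the dual of `H₀¹(0,1)`, with the dual norm. -/
abbrev Hneg1 : Type := StrongDual ℝ H01

/-- `h` is a `k`-th weak derivative of `g` on `(0,1)`. -/
def HasWeakDeriv (k : ℕ) (g h : ℝ → ℝ) : Prop :=
  ∀ φ : ℝ → ℝ, IsTestFunction φ →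
    ∫ x, g x * iteratedDeriv k φ x ∂vol01 = (-1) ^ k * ∫ x, h x * φ x ∂vol01

/-- `g ∈ Hᵐ(0,1)`: `g` and its weak derivatives up to order `m` are in `L²(0,1)`. -/
def MemH (m : ℕ) (g : ℝ → ℝ) : Prop :=
  MemLp g 2 vol01 ∧ ∀ k ≤ m, ∃ h : ℝ → ℝ, MemLp h 2 vol01 ∧ HasWeakDeriv k g h

open Classical in
/-- The `k`-th weak derivative `Dᵏ g ∈ L²(0,1)` (unique almost everywhere on `(0,1)` for
`g ∈ Hᵏ(0,1)`; the value is `0` if there is none). -/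
noncomputable def weakDeriv (k : ℕ) (g : ℝ → ℝ) : ℝ → ℝ :=
  if H : ∃ h : ℝ → ℝ, MemLp h 2 vol01 ∧ HasWeakDeriv k g h then H.choose else 0

/-- The norm `‖g‖_{Hᵐ(0,1)}`. -/
noncomputable def hNorm (m : ℕ) (g : ℝ → ℝ) : ℝ :=
  Real.sqrt (∑ k ∈ Finset.range (m + 1), ∫ x, (weakDeriv k g x) ^ 2 ∂vol01)

/-- The norm `‖K‖_{Cⁿ[0,1]}`. -/
noncomputable def cNorm (n : ℕ) (K : ℝ → ℝ) : ℝ :=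
  ∑ k ∈ Finset.range (n + 1),
    sSup ((fun x => |iteratedDerivWithin k K (Icc (0 : ℝ) 1) x|) '' Icc (0 : ℝ) 1)

/-! ### Fractional integrals -/

/-- The left fractional integral of order `σ` with base point `0`, evaluated at `x`. -/
noncomputable def leftInt (σ : ℝ) (w : ℝ → ℝ) (x : ℝ) : ℝ :=
  1 / Real.Gamma σ * ∫ s in Ioo 0 x, w s / (x - s) ^ (1 - σ)

/-- The right fractional integral of order `σ` with base point `1`, evaluated at `x`. -/
noncomputable def rightInt (σ : ℝ) (w : ℝ → ℝ) (x : ℝ) : ℝ :=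
  1 / Real.Gamma σ * ∫ s in Ioo x 1, w s / (s - x) ^ (1 - σ)

/-- The two-sided fractional integral `I^β_θ`. -/
noncomputable def twoSidedInt (β θ : ℝ) (w : ℝ → ℝ) (x : ℝ) : ℝ :=
  θ * leftInt β w x + (1 - θ) * rightInt β w x

/-! ### The diffusion problem -/

/-- `K` is a diffusivity coefficient with bounds `0 < Km ≤ K ≤ KM` on `(0,1)`. -/
structure IsDiffusivity (Km KM : ℝ) (K : ℝ → ℝ) : Prop where
  pos : 0 < Km
  meas : AEMeasurable K vol01
  bounds : ∀ᵐ x ∂vol01, Km ≤ K x ∧ K x ≤ KM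

/-- The Petrov-Galerkin bilinear form `A(u,v) = (K D I^β_θ u, Dv)_{L²(0,1)}` on
`H₀^{1-β}(0,1) × H₀¹(0,1)`. -/
noncomputable def A (β θ : ℝ) (K : ℝ → ℝ) (u : H0 (1 - β)) (v : H01) : ℝ :=
  ∫ x, K x * weakDeriv 1 (twoSidedInt β θ (H0fn u)) x * H01D v x ∂vol01

/-- `u` is a weak solution of the Petrov-Galerkin formulation with right-hand side
`v ↦ F v = ⟨f, v⟩`. -/
def IsWeakSolution (β θ : ℝ) (K : ℝ → ℝ) (F : H01 → ℝ) (u : H0 (1 - β)) : Prop :=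
  ∀ v : H01, A β θ K u v = F v

/-- `w ∈ H¹(0,1)`, taken with its continuous representative on `[0,1]`, is the weak solution of
`(K Dw, Dv) = 0` for all `v ∈ H₀¹(0,1)`, `w(0) = 1`, `w(1) = 0`. -/
structure IsWl (K w : ℝ → ℝ) : Prop where
  cont : ContinuousOn w (Icc 0 1)
  mem : MemH 1 w
  left : w 0 = 1
  right : w 1 = 0
  weak : ∀ v : H01, ∫ x, K x * weakDeriv 1 w x * H01D v x ∂vol01 = 0

/-- `u ∈ H₀^{1-β}(0,1)` is the function `u_l`, i.e. it solves
`I^β_θ u - (1-θ) (ʳI^β u)(0) (1-x) - θ (ˡI^β u)(1) x = w_l - (1-x)`. -/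
def IsUl (β θ : ℝ) (K : ℝ → ℝ) (u : H0 (1 - β)) : Prop :=
  ∃ w : ℝ → ℝ, IsWl K w ∧ ∀ᵐ x ∂vol01,
    twoSidedInt β θ (H0fn u) x - (1 - θ) * rightInt β (H0fn u) 0 * (1 - x) - θ * leftInt β (H0fn u) 1 * x
      = w x - (1 - x)

/-- The solvability condition `1 + θ (ˡI^β u_l)(1) - (1-θ) (ʳI^β u_l)(0) ≠ 0`, where `u_l` is the
(existing and unique) function specified by `IsUl`. -/
def SolvabilityCondition (β θ : ℝ) (K : ℝ → ℝ) : Prop :=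
  ∃ u : H0 (1 - β), IsUl β θ K u ∧ (∀ u' : H0 (1 - β), IsUl β θ K u' → u' = u) ∧
    1 + θ * leftInt β (H0fn u) 1 - (1 - θ) * rightInt β (H0fn u) 0 ≠ 0

/-- The `L²(0,1)` distance of `(∫₀¹ 1/K)⁻¹ / K` from the constant `1`. -/
noncomputable def perturbation (K : ℝ → ℝ) : ℝ≥0∞ :=
  eLpNorm (fun x => (∫ s, 1 / K s ∂vol01)⁻¹ * (1 / K x) - 1) 2 vol01

/-- Boundedness of `A` on `H₀^{1-β}(0,1) × H₀¹(0,1)` with constant `M`. It includes that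
`D I^β_θ w`, which occurs in `A`, exists in `L²(0,1)`. -/
def BoundedForm (β θ : ℝ) (K : ℝ → ℝ) (M : ℝ) : Prop :=
  (∀ w : H0 (1 - β), MemH 1 (twoSidedInt β θ (H0fn w))) ∧
  ∀ (w : H0 (1 - β)) (v : H01), |A β θ K w v| ≤ M * ‖w‖ * ‖v‖

/-- Weak coercivity of `A` with constant `κ`; the infima and suprema are taken in the extended
real numbers. -/
def WeaklyCoercive (β θ : ℝ) (K : ℝ → ℝ) (κ : ℝ) : Prop :=
  ((κ : EReal) ≤ ⨅ w : {w : H0 (1 - β) // w ≠ 0}, ⨆ v : {v : H01 // v ≠ 0},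
      ((A β θ K w.1 v.1 / (‖w.1‖ * ‖v.1‖) : ℝ) : EReal)) ∧
  ∀ v : H01, v ≠ 0 → (0 : EReal) < ⨆ w : H0 (1 - β), ((A β θ K w v : ℝ) : EReal)

end FracDiff

open FracDiff

namespace FracDiff

/-! Write $T=DI^\beta_\theta$ and let $L$, $R$ be the derivatives of the left and right fractional
integrals, so that $T=\theta L+(1-\theta)R$ maps $H_0^{1-\beta}$ into $L^2(0,1)$. On the line $L$
and $R$ are the Fourier multipliers $(i\omega)(\pm i\omega)^{-\beta}$. For a test function the
product $Lu\cdot Ru$ vanishes off $(0,1)$, since $Lu=0$ to the left and $Ru=0$ to the right of the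
interval. Parseval therefore gives $(Lu,Ru)=\cos(\pi\beta)|u|^2$ on $(0,1)$ itself, with $|u|$ the
seminorm of order $1-\beta$. Hence $(Tu,Lu)\ge\cos^2(\pi\beta)|u|^2$, and $T$ is injective with
closed range, uniformly in $\theta$ (`twoSidedDeriv_bounded_below`).

The range of $T$ has codimension exactly one. If $w$ is orthogonal to it, the adjoint fractional
integral of $w$ is constant; if $w$ also has mean zero, its Riesz energy vanishes, and since
$|t|^{\beta-1}$ is a positive superposition of Gaussians, $w=0$
(`eq_zero_of_orthogonal_of_mean_zero`). Thus the codimension is at most one. It is not zero, because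
by Lax-Milgram surjectivity of $T$ would put $(1-x)^{-\beta}$, which is orthogonal to the range of
$L$, into that range (`exists_notMem_range_twoSidedDeriv`). So the range is $p^\perp$ with $\int
p=1$, and compactness in $\theta$ bounds $\|p\|$ by a constant $C_0(\beta)$
(`exists_range_twoSidedDeriv_eq`).

The derivatives $Dv$, $v\in H_0^1$, are the functions of mean zero. The equation $A(u,v)=(g,Dv)$ for
all $v$ therefore means $KTu=g+c$ with a free constant $c$, that is $K^{-1}(g+c)\perp p$. This
determines $c$ as soon as $(p,K^{-1})\ne0$. With $\varepsilon_0=1/(2C_0)$ the normalised profile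
$q=K^{-1}/\int K^{-1}$ satisfies $(p,q)\ge1-C_0\|q-1\|\ge1/2$ (`IsMulPair.half_mean_le_inner`),
which yields the inf-sup bound and solvability. The number $1+\theta\,({}^lI^\beta
u_l)(1)-(1-\theta)\,({}^rI^\beta u_l)(0)$ is $(p,q)$. Regularity comes from dividing
$KTu=c-\int_0^xf$ by $K$. -/

instance : IsProbabilityMeasure vol01 := ⟨by simp [vol01]⟩

theorem integral_vol01_eq (f : ℝ → ℝ) : ∫ x, f x ∂vol01 = ∫ x in (0 : ℝ)..1, f x := by
  rw [intervalIntegral.integral_of_le zero_le_one, vol01, integral_Ioc_eq_integral_Ioo]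

theorem ae_vol01_iff {p : ℝ → Prop} :
    (∀ᵐ x ∂vol01, p x) ↔ ∀ᵐ x, x ∈ Ioo (0 : ℝ) 1 → p x := by
  rw [vol01, ae_restrict_iff' measurableSet_Ioo]

theorem ae_mem_Ioo : ∀ᵐ x ∂vol01, x ∈ Ioo (0 : ℝ) 1 := ae_restrict_mem measurableSet_Ioo

theorem integrable_vol01_iff {f : ℝ → ℝ} :
    Integrable f vol01 ↔ IntervalIntegrable f volume 0 1 := by
  rw [intervalIntegrable_iff_integrableOn_Ioo_of_le zero_le_one]
  rfl

theorem memLp_of_continuousOn {f : ℝ → ℝ} (hf : ContinuousOn f (Icc 0 1)) (p : ℝ≥0∞) :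
    MemLp f p vol01 := by
  obtain ⟨C, hC⟩ := isCompact_Icc.exists_bound_of_continuousOn hf
  refine MemLp.of_bound
    ((hf.mono Ioo_subset_Icc_self).aestronglyMeasurable measurableSet_Ioo) C ?_
  filter_upwards [ae_mem_Ioo] with x hx using hC x (Ioo_subset_Icc_self hx)

/-! ### Test functions on the unit interval. -/

namespace IsTestFunction

variable {φ ψ : ℝ → ℝ}

theorem continuous (h : IsTestFunction φ) : Continuous φ := h.1.continuous

theorem hasCompactSupport (h : IsTestFunction φ) : HasCompactSupport φ :=
  HasCompactSupport.of_support_subset_isCompact (isCompact_Icc (a := (0 : ℝ)) (b := 1))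
    ((subset_tsupport φ).trans (h.2.trans Ioo_subset_Icc_self))

theorem eq_zero (h : IsTestFunction φ) {x : ℝ} (hx : x ∉ Ioo (0 : ℝ) 1) : φ x = 0 :=
  image_eq_zero_of_notMem_tsupport fun hx' => hx (h.2 hx')

theorem zero : IsTestFunction 0 := ⟨contDiff_const, by simp [tsupport]⟩

theorem add (h : IsTestFunction φ) (h' : IsTestFunction ψ) : IsTestFunction (φ + ψ) :=
  ⟨h.1.add h'.1, (tsupport_add φ ψ).trans (union_subset h.2 h'.2)⟩

theorem const_smul (h : IsTestFunction φ) (c : ℝ) : IsTestFunction (c • φ) :=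
  ⟨contDiff_const.smul h.1, (closure_mono (Function.support_const_smul_subset c φ)).trans h.2⟩

theorem deriv (h : IsTestFunction φ) : IsTestFunction (deriv φ) :=
  ⟨(contDiff_infty_iff_deriv.1 h.1).2, tsupport_deriv_subset.trans h.2⟩

theorem iteratedDeriv (h : IsTestFunction φ) (k : ℕ) : IsTestFunction (iteratedDeriv k φ) := by
  induction k with
  | zero => simpa using h
  | succ k ih => rw [iteratedDeriv_succ]; exact ih.deriv

theorem differentiable (h : IsTestFunction φ) : Differentiable ℝ φ :=
  h.1.differentiable (by simp)

theorem hasDerivAt (h : IsTestFunction φ) (x : ℝ) : HasDerivAt φ (_root_.deriv φ x) x :=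
  (h.differentiable x).hasDerivAt

theorem integrable (h : IsTestFunction φ) : Integrable φ :=
  h.continuous.integrable_of_hasCompactSupport h.hasCompactSupport

theorem memLp (h : IsTestFunction φ) (p : ℝ≥0∞) : MemLp φ p :=
  h.continuous.memLp_of_hasCompactSupport h.hasCompactSupport

theorem memLp_vol01 (h : IsTestFunction φ) (p : ℝ≥0∞) : MemLp φ p vol01 :=
  (h.memLp p).restrict _

theorem integral_vol01 (h : IsTestFunction φ) : ∫ x, φ x ∂vol01 = ∫ x, φ x := by
  rw [vol01]
  exact setIntegral_eq_integral_of_forall_compl_eq_zero fun x hx => h.eq_zero hx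

theorem bounded (h : IsTestFunction φ) : ∃ C, ∀ x, |φ x| ≤ C :=
  h.continuous.bounded_above_of_compact_support h.hasCompactSupport

theorem integral_deriv (h : IsTestFunction φ) : ∫ x, _root_.deriv φ x ∂vol01 = 0 := by
  rw [integral_vol01_eq, intervalIntegral.integral_deriv_eq_sub
    (fun x _ => h.differentiable x) (h.deriv.continuous.intervalIntegrable _ _)]
  simp [h.eq_zero]

theorem integral_eq_sub (h : IsTestFunction φ) (a b : ℝ) :
    ∫ x in a..b, _root_.deriv φ x = φ b - φ a :=
  intervalIntegral.integral_deriv_eq_sub (fun x _ => h.differentiable x)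
    (h.deriv.continuous.intervalIntegrable _ _)

/-- The primitive from $0$ vanishes to the left of the support of $\psi$, where nothing has been
integrated yet, and to the right, where the total integral has been collected. So it is again
compactly supported. -/
theorem exists_primitive (h : IsTestFunction ψ) (h0 : ∫ x, ψ x ∂vol01 = 0) :
    ∃ φ, IsTestFunction φ ∧ _root_.deriv φ = ψ := by
  set φ : ℝ → ℝ := fun x => ∫ t in (0 : ℝ)..x, ψ t
  have hd : ∀ x, HasDerivAt φ (ψ x) x := fun x =>
    intervalIntegral.integral_hasDerivAt_right (h.continuous.intervalIntegrable _ _)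
      (h.continuous.stronglyMeasurableAtFilter _ _) h.continuous.continuousAt
  have hd' : _root_.deriv φ = ψ := funext fun x => (hd x).deriv
  refine ⟨φ, ⟨contDiff_infty_iff_deriv.2 ⟨fun x => (hd x).differentiableAt, hd' ▸ h.1⟩, ?_⟩, hd'⟩
  rcases (tsupport ψ).eq_empty_or_nonempty with he | hne
  · have : ψ = 0 := tsupport_eq_empty_iff.1 he
    have : φ = 0 := by ext x; simp [φ, this]
    simp [this, tsupport]
  have hc : IsCompact (tsupport ψ) := h.hasCompactSupport
  obtain ⟨a, ha, ha'⟩ := hc.exists_isLeast hne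
  obtain ⟨b, hb, hb'⟩ := hc.exists_isGreatest hne
  have hz : ∀ x, x ∉ Icc a b → ψ x = 0 := fun x hx =>
    image_eq_zero_of_notMem_tsupport fun hx' => hx ⟨ha' hx', hb' hx'⟩
  have key : ∀ x, x ∉ Icc a b → φ x = 0 := by
    intro x hx
    rcases lt_or_ge x a with hxa | hxa
    · refine intervalIntegral.integral_zero_ae (Filter.Eventually.of_forall fun t ht => hz t ?_)
      intro ht'
      have h1 := (h.2 ha).1
      rcases le_total 0 x with h0 | h0
      · rw [uIoc_of_le h0] at ht
        linarith [ht.2, ht'.1]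
      · rw [uIoc_of_ge h0] at ht
        linarith [ht.2, ht'.1]
    · have hxb : b < x := by by_contra hc; exact hx ⟨hxa, not_lt.1 hc⟩
      have h2 : ∫ t in x..1, ψ t = 0 := by
        refine intervalIntegral.integral_zero_ae (Filter.Eventually.of_forall fun t ht => hz t ?_)
        intro ht'
        have h1 := (h.2 hb).2
        rcases le_total x 1 with h0 | h0
        · rw [uIoc_of_le h0] at ht
          linarith [ht.1, ht'.2]
        · rw [uIoc_of_ge h0] at ht
          linarith [ht.1, ht'.2]
      have h3 := intervalIntegral.integral_add_adjacent_intervals (μ := volume)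
        (h.continuous.intervalIntegrable 0 x) (h.continuous.intervalIntegrable x 1)
      rw [h2, ← integral_vol01_eq, h0, add_zero] at h3
      exact h3
  have : tsupport φ ⊆ Icc a b := closure_minimal
    (fun x hx => by by_contra hc; exact hx (key x hc)) isClosed_Icc
  exact this.trans fun x hx => ⟨(h.2 ha).1.trans_le hx.1, hx.2.trans_lt (h.2 hb).2⟩

theorem exists_integral_eq_one : ∃ φ, IsTestFunction φ ∧ ∫ x, φ x ∂vol01 = 1 := by
  let b : ContDiffBump (1 / 2 : ℝ) := ⟨1 / 8, 1 / 4, by norm_num, by norm_num⟩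
  have h : IsTestFunction (b.normed volume) := by
    refine ⟨b.contDiff_normed, ?_⟩
    rw [b.tsupport_normed_eq, Real.closedBall_eq_Icc]
    intro x hx
    have h1 : b.rOut = 1 / 4 := rfl
    rw [h1] at hx
    constructor <;> linarith [hx.1, hx.2]
  exact ⟨_, h, by rw [h.integral_vol01, b.integral_normed]⟩

end IsTestFunction

/-! ### Weak derivatives and primitives. -/

theorem ae_eq_zero_of_forall_test {g : ℝ → ℝ} (hg : Integrable g vol01)
    (h : ∀ φ, IsTestFunction φ → ∫ x, g x * φ x ∂vol01 = 0) : g =ᵐ[vol01] 0 := by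
  refine ae_vol01_iff.2 (isOpen_Ioo.ae_eq_zero_of_integral_contDiff_smul_eq_zero
    (IntegrableOn.locallyIntegrableOn hg) fun φ h1 _ h3 => ?_)
  rw [← h φ ⟨h1, h3⟩, vol01, setIntegral_eq_integral_of_forall_compl_eq_zero fun x hx => by
    rw [IsTestFunction.eq_zero ⟨h1, h3⟩ hx, mul_zero]]
  simp [mul_comm]

theorem integrable_mul_test {g φ : ℝ → ℝ} (hg : Integrable g vol01) (h : IsTestFunction φ) :
    Integrable (fun x => g x * φ x) vol01 := by
  obtain ⟨C, hC⟩ := h.bounded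
  exact hg.mul_bdd h.continuous.aestronglyMeasurable (Filter.Eventually.of_forall hC)

/-- The du Bois-Reymond lemma. -/
theorem ae_eq_const_of_forall_deriv {g : ℝ → ℝ} (hg : Integrable g vol01)
    (h : ∀ φ, IsTestFunction φ → ∫ x, g x * deriv φ x ∂vol01 = 0) :
    ∃ c : ℝ, g =ᵐ[vol01] fun _ => c := by
  obtain ⟨η, hη, hη1⟩ := IsTestFunction.exists_integral_eq_one
  set c := ∫ x, g x * η x ∂vol01 with hc
  refine ⟨c, ?_⟩
  have := ae_eq_zero_of_forall_test (g := fun x => g x - c) (hg.sub (integrable_const c)) ?_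
  · filter_upwards [this] with x hx using sub_eq_zero.1 hx
  intro ψ hψ
  set m := ∫ x, ψ x ∂vol01 with hm
  -- Removing the mean of $\psi$ by the unit-mass bump $\eta$ leaves the derivative of a test
  -- function, on which $g$ vanishes. This is also why the constant is the pairing of $g$ with
  -- $\eta$.
  have h1 : IsTestFunction (ψ + (-m) • η) := hψ.add (hη.const_smul _)
  have hi : Integrable ψ vol01 := (hψ.memLp_vol01 1).integrable le_rfl
  have hi' : Integrable η vol01 := (hη.memLp_vol01 1).integrable le_rfl
  obtain ⟨φ, hφ, hφ'⟩ := h1.exists_primitive (by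
    simp only [Pi.add_apply, Pi.smul_apply, smul_eq_mul]
    rw [integral_add hi (hi'.const_mul _), integral_const_mul, hη1, ← hm]; ring)
  have h2 := h φ hφ
  rw [hφ'] at h2
  have h3 : ∀ x, g x * (ψ + (-m) • η) x = g x * ψ x - m * (g x * η x) := fun x => by
    simp; ring
  simp_rw [h3] at h2
  rw [integral_sub (integrable_mul_test hg hψ) ((integrable_mul_test hg hη).const_mul _),
    integral_const_mul, ← hc] at h2
  simp_rw [sub_mul]
  rw [integral_sub (integrable_mul_test hg hψ) (hi.const_mul _), integral_const_mul, ← hm]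
  linarith

theorem HasWeakDeriv.ae_unique {k : ℕ} {g h₁ h₂ : ℝ → ℝ} (i₁ : Integrable h₁ vol01)
    (i₂ : Integrable h₂ vol01) (H₁ : HasWeakDeriv k g h₁) (H₂ : HasWeakDeriv k g h₂) :
    h₁ =ᵐ[vol01] h₂ := by
  have := ae_eq_zero_of_forall_test (i₁.sub i₂) fun φ hφ => by
    have h1 := (H₁ φ hφ).symm.trans (H₂ φ hφ)
    have h2 := mul_left_cancel₀ (pow_ne_zero k (by norm_num : (-1 : ℝ) ≠ 0)) h1
    simp only [Pi.sub_apply, sub_mul]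
    rw [integral_sub (integrable_mul_test i₁ hφ) (integrable_mul_test i₂ hφ), h2, sub_self]
  filter_upwards [this] with x hx using sub_eq_zero.1 hx

theorem HasWeakDeriv.congr {k : ℕ} {g g' h h' : ℝ → ℝ} (H : HasWeakDeriv k g h)
    (hg : g =ᵐ[vol01] g') (hh : h =ᵐ[vol01] h') : HasWeakDeriv k g' h' := by
  intro φ hφ
  have h1 : (fun x => g x * iteratedDeriv k φ x) =ᵐ[vol01] fun x => g' x * iteratedDeriv k φ x :=
    hg.mono fun x hx => by simp only [hx]
  have h2 : (fun x => h x * φ x) =ᵐ[vol01] fun x => h' x * φ x :=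
    hh.mono fun x hx => by simp only [hx]
  rw [← integral_congr_ae h1, H φ hφ, integral_congr_ae h2]

theorem hasWeakDeriv_zero {g : ℝ → ℝ} : HasWeakDeriv 0 g g := by
  intro φ _
  simp

theorem hasWeakDeriv_one_iff {g h : ℝ → ℝ} : HasWeakDeriv 1 g h ↔
    ∀ φ, IsTestFunction φ → ∫ x, g x * deriv φ x ∂vol01 = - ∫ x, h x * φ x ∂vol01 := by
  simp [HasWeakDeriv, iteratedDeriv_one]

theorem HasWeakDeriv.weakDeriv_ae_eq {k : ℕ} {g h : ℝ → ℝ} (hh : MemLp h 2 vol01)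
    (H : HasWeakDeriv k g h) : weakDeriv k g =ᵐ[vol01] h := by
  have hex : ∃ h : ℝ → ℝ, MemLp h 2 vol01 ∧ HasWeakDeriv k g h := ⟨h, hh, H⟩
  rw [weakDeriv, dif_pos hex]
  exact HasWeakDeriv.ae_unique (hex.choose_spec.1.integrable one_le_two)
    (hh.integrable one_le_two) hex.choose_spec.2 H

/-- The primitive on `[0,1]` of a function on `(0,1)`, with base point `0`. -/
noncomputable def prim (h : ℝ → ℝ) (x : ℝ) : ℝ := ∫ t in (0 : ℝ)..x, h t

theorem absolutelyContinuous_prim {h : ℝ → ℝ} (hh : Integrable h vol01) :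
    AbsolutelyContinuousOnInterval (prim h) 0 1 :=
  (integrable_vol01_iff.1 hh).absolutelyContinuousOnInterval_intervalIntegral (by simp)

theorem continuousOn_prim {h : ℝ → ℝ} (hh : Integrable h vol01) :
    ContinuousOn (prim h) (Icc 0 1) := by
  have := (absolutelyContinuous_prim hh).continuousOn
  rwa [uIcc_of_le zero_le_one] at this

theorem deriv_prim_ae {h : ℝ → ℝ} (hh : Integrable h vol01) :
    ∀ᵐ x ∂vol01, HasDerivAt (prim h) (h x) x := by
  have := (integrable_vol01_iff.1 hh).ae_hasDerivAt_integral
  rw [ae_vol01_iff]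
  filter_upwards [this] with x hx h1
  have h2 : x ∈ uIcc (0 : ℝ) 1 := by rw [uIcc_of_le zero_le_one]; exact Ioo_subset_Icc_self h1
  exact hx h2 0 (by simp)

theorem prim_zero (h : ℝ → ℝ) : prim h 0 = 0 := by simp [prim]

theorem prim_one (h : ℝ → ℝ) : prim h 1 = ∫ x, h x ∂vol01 := (integral_vol01_eq h).symm

/-- Integration by parts for absolutely continuous functions on `[0,1]`. -/
theorem integral_mul_deriv_of_ac {f g f' g' : ℝ → ℝ}
    (hf : AbsolutelyContinuousOnInterval f 0 1) (hg : AbsolutelyContinuousOnInterval g 0 1)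
    (hf' : ∀ᵐ x ∂vol01, HasDerivAt f (f' x) x) (hg' : ∀ᵐ x ∂vol01, HasDerivAt g (g' x) x) :
    ∫ x, f x * g' x ∂vol01 = f 1 * g 1 - f 0 * g 0 - ∫ x, f' x * g x ∂vol01 := by
  have := hf.integral_mul_deriv_eq_deriv_mul hg
  rw [← integral_vol01_eq, ← integral_vol01_eq] at this
  rw [integral_congr_ae (hg'.mono fun x hx => by simp only [hx.deriv] :
    (fun x => f x * deriv g x) =ᵐ[vol01] fun x => f x * g' x),
    integral_congr_ae (hf'.mono fun x hx => by simp only [hx.deriv] :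
    (fun x => deriv f x * g x) =ᵐ[vol01] fun x => f' x * g x)] at this
  exact this

theorem IsTestFunction.absolutelyContinuous {φ : ℝ → ℝ} (h : IsTestFunction φ) :
    AbsolutelyContinuousOnInterval φ 0 1 :=
  (h.1.of_le (by exact_mod_cast le_top)).contDiffOn.absolutelyContinuousOnInterval

theorem hasWeakDeriv_of_ac {f f' : ℝ → ℝ} (hf : AbsolutelyContinuousOnInterval f 0 1)
    (hf' : ∀ᵐ x ∂vol01, HasDerivAt f (f' x) x) : HasWeakDeriv 1 f f' := by
  rw [hasWeakDeriv_one_iff]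
  intro φ hφ
  rw [integral_mul_deriv_of_ac hf hφ.absolutelyContinuous hf'
    (Filter.Eventually.of_forall hφ.hasDerivAt)]
  simp [hφ.eq_zero]

theorem hasWeakDeriv_prim_add {h : ℝ → ℝ} (hh : Integrable h vol01) (c : ℝ) :
    HasWeakDeriv 1 (fun x => c + prim h x) h := by
  refine hasWeakDeriv_of_ac ?_ ((deriv_prim_ae hh).mono fun x hx => by simpa using hx.const_add c)
  exact (contDiff_const (c := c)).contDiffOn.absolutelyContinuousOnInterval.add
    (absolutelyContinuous_prim hh)

/-- The difference of $g$ and the primitive of $h$ has weak derivative zero, so the du Bois-Reymond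
lemma applies. It provides the absolutely continuous representative used for boundary values and
product rules. -/
theorem HasWeakDeriv.ae_eq_prim {g h : ℝ → ℝ} (hg : Integrable g vol01) (hh : Integrable h vol01)
    (H : HasWeakDeriv 1 g h) : ∃ c : ℝ, g =ᵐ[vol01] fun x => c + prim h x := by
  have hp : Integrable (prim h) vol01 :=
    (memLp_of_continuousOn (continuousOn_prim hh) 1).integrable le_rfl
  obtain ⟨c, hc⟩ := ae_eq_const_of_forall_deriv (hg.sub hp) fun φ hφ => by
    have h1 := hasWeakDeriv_one_iff.1 H φ hφ
    have h2 := hasWeakDeriv_one_iff.1 (hasWeakDeriv_prim_add hh 0) φ hφ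
    simp only [zero_add] at h2
    simp only [Pi.sub_apply, sub_mul]
    rw [integral_sub (integrable_mul_test hg hφ.deriv) (integrable_mul_test hp hφ.deriv), h1, h2,
      sub_self]
  exact ⟨c, hc.mono fun x hx => by simp only [Pi.sub_apply] at hx; linarith⟩

end FracDiff

/-! ### The Hilbert spaces $L^2(0,1)$ and $H_0^1(0,1)$. -/

namespace FracDiff

/-- The Hilbert space `L²(0,1)`. -/
abbrev L2I : Type := Lp ℝ 2 vol01

theorem L2I_inner_eq (f g : L2I) : inner ℝ f g = ∫ x, f x * g x ∂vol01 := by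
  rw [L2.inner_def]
  simp [mul_comm]

theorem inner_toLp_left {f : ℝ → ℝ} (hf : MemLp f 2 vol01) (g : L2I) :
    inner ℝ (hf.toLp f) g = ∫ x, f x * g x ∂vol01 := by
  rw [L2I_inner_eq]
  exact integral_congr_ae (hf.coeFn_toLp.mono fun x hx => by simp only [hx])

theorem inner_toLp_toLp {f g : ℝ → ℝ} (hf : MemLp f 2 vol01) (hg : MemLp g 2 vol01) :
    inner ℝ (hf.toLp f) (hg.toLp g) = ∫ x, f x * g x ∂vol01 := by
  rw [inner_toLp_left]
  exact integral_congr_ae (hg.coeFn_toLp.mono fun x hx => by simp only [hx])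

/-- The constant function `1` as an element of `L²(0,1)`. -/
noncomputable def oneL2 : L2I := (memLp_const (1 : ℝ)).toLp fun _ => (1 : ℝ)

theorem coeFn_oneL2 : oneL2 =ᵐ[vol01] fun _ => (1 : ℝ) := (memLp_const (1 : ℝ)).coeFn_toLp

theorem inner_oneL2 (g : L2I) : inner ℝ oneL2 g = ∫ x, g x ∂vol01 := by
  rw [oneL2, inner_toLp_left]; simp

theorem inner_oneL2_oneL2 : inner ℝ oneL2 oneL2 = (1 : ℝ) := by
  rw [inner_oneL2, integral_congr_ae coeFn_oneL2]; simp

theorem norm_oneL2 : ‖oneL2‖ = 1 := by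
  have h := real_inner_self_eq_norm_sq oneL2
  rw [inner_oneL2_oneL2] at h
  nlinarith [norm_nonneg oneL2]

/-- The space of test functions on `(0,1)`. -/
def testSubmodule : Submodule ℝ (ℝ → ℝ) where
  carrier := {φ | IsTestFunction φ}
  add_mem' h h' := h.add h'
  zero_mem' := IsTestFunction.zero
  smul_mem' c _ h := h.const_smul c

theorem deriv_add_test {φ ψ : ℝ → ℝ} (h : IsTestFunction φ) (h' : IsTestFunction ψ) :
    deriv (φ + ψ) = deriv φ + deriv ψ :=
  funext fun x => ((h.hasDerivAt x).add (h'.hasDerivAt x)).deriv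

theorem deriv_smul_test {φ : ℝ → ℝ} (h : IsTestFunction φ) (c : ℝ) :
    deriv (c • φ) = c • deriv φ :=
  funext fun x => ((h.hasDerivAt x).const_smul c).deriv

/-- The class of a test function in `L²(0,1)`. -/
noncomputable def testL2 : testSubmodule →ₗ[ℝ] L2I where
  toFun φ := (φ.2.memLp_vol01 2).toLp φ.1
  map_add' φ ψ := (MemLp.toLp_add (φ.2.memLp_vol01 2) (ψ.2.memLp_vol01 2))
  map_smul' c φ := (MemLp.toLp_const_smul c (φ.2.memLp_vol01 2))

/-- The derivative as a linear map of the space of test functions. -/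
noncomputable def testDeriv : testSubmodule →ₗ[ℝ] testSubmodule where
  toFun φ := ⟨deriv φ.1, φ.2.deriv⟩
  map_add' φ ψ := Subtype.ext (deriv_add_test φ.2 ψ.2)
  map_smul' c φ := Subtype.ext (deriv_smul_test φ.2 c)

theorem coeFn_testL2 (φ : testSubmodule) : testL2 φ =ᵐ[vol01] φ.1 :=
  (φ.2.memLp_vol01 2).coeFn_toLp

/-- The graph embedding of the test functions defining `H₀¹(0,1)`. -/
noncomputable def testGraph : testSubmodule →ₗ[ℝ] WithLp 2 (L2I × L2I) :=
  (WithLp.linearEquiv 2 ℝ (L2I × L2I)).symm.toLinearMap ∘ₗ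
    (LinearMap.prod testL2 (testL2 ∘ₗ testDeriv))

theorem H01_eq : H01 = (LinearMap.range testGraph).topologicalClosure := by
  unfold H01
  congr 1
  refine le_antisymm (Submodule.span_le.2 ?_) ?_
  · rintro z ⟨φ, hφ, h1, h2⟩
    refine ⟨⟨φ, hφ⟩, ?_⟩
    refine WithLp.ofLp_injective 2 (Prod.ext ?_ ?_)
    · exact Lp.ext ((coeFn_testL2 ⟨φ, hφ⟩).trans h1.symm)
    · exact Lp.ext ((coeFn_testL2 (testDeriv ⟨φ, hφ⟩)).trans h2.symm)
  · rintro _ ⟨φ, rfl⟩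
    exact Submodule.subset_span ⟨φ.1, φ.2, coeFn_testL2 φ, coeFn_testL2 (testDeriv φ)⟩

/-- The inclusion of the test functions in `H₀¹(0,1)`. -/
noncomputable def testH01 : testSubmodule →ₗ[ℝ] H01 :=
  LinearMap.codRestrict H01 testGraph fun φ => by
    rw [H01_eq]
    exact Submodule.le_topologicalClosure _ ⟨φ, rfl⟩

/-- Serves both $H_0^1$ and $H_0^\mu$: a relation continuous in the element needs to be checked on
test functions only. -/
theorem denseRange_codRestrict_closure {E F : Type*} [AddCommGroup E] [Module ℝ E]
    [NormedAddCommGroup F] [NormedSpace ℝ F] (f : E →ₗ[ℝ] F) (S : Submodule ℝ F)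
    (hS : S = (LinearMap.range f).topologicalClosure) (hf : ∀ x, f x ∈ S) :
    DenseRange (LinearMap.codRestrict S f hf) := by
  intro y
  rw [Metric.mem_closure_iff]
  intro ε hε
  have hy : (y : F) ∈ closure (LinearMap.range f : Set F) := by
    have h : (y : F) ∈ (LinearMap.range f).topologicalClosure := hS.le y.2
    exact h
  obtain ⟨_, ⟨x, rfl⟩, hx⟩ := Metric.mem_closure_iff.1 hy ε hε
  exact ⟨_, ⟨x, rfl⟩, hx⟩

theorem denseRange_testH01 : DenseRange testH01 :=
  denseRange_codRestrict_closure _ _ H01_eq _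

/-- The embedding `H₀¹(0,1) → L²(0,1)`. -/
noncomputable def H01V : H01 →L[ℝ] L2I := (WithLp.fstL 2 ℝ L2I L2I).comp H01.subtypeL

/-- The weak derivative `H₀¹(0,1) → L²(0,1)`. -/
noncomputable def H01DL : H01 →L[ℝ] L2I := (WithLp.sndL 2 ℝ L2I L2I).comp H01.subtypeL

theorem H01V_testH01 (φ : testSubmodule) : H01V (testH01 φ) = testL2 φ := rfl

theorem H01DL_testH01 (φ : testSubmodule) : H01DL (testH01 φ) = testL2 (testDeriv φ) := rfl

theorem H01D_eq (v : H01) : H01D v = H01DL v := rfl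

theorem H01_norm_sq (v : H01) : ‖v‖ ^ 2 = ‖H01V v‖ ^ 2 + ‖H01DL v‖ ^ 2 :=
  WithLp.prod_norm_sq_eq_of_L2 v.1

theorem norm_H01DL_le (v : H01) : ‖H01DL v‖ ≤ ‖v‖ := by
  have := H01_norm_sq v
  refine abs_le_of_sq_le_sq' (by nlinarith [norm_nonneg (H01V v)]) (norm_nonneg _) |>.2

theorem norm_H01V_le (v : H01) : ‖H01V v‖ ≤ ‖v‖ := by
  have := H01_norm_sq v
  refine abs_le_of_sq_le_sq' (by nlinarith [norm_nonneg (H01DL v)]) (norm_nonneg _) |>.2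

/-- Derivatives of test functions have mean zero, and this is a closed condition. Constants are thus
invisible when tested with $Dv$, which is the source of the free constant in the weak problem. -/
theorem inner_oneL2_H01DL (v : H01) : inner ℝ oneL2 (H01DL v) = 0 := by
  refine denseRange_testH01.induction_on v
    (isClosed_eq (by fun_prop) continuous_const) fun φ => ?_
  rw [H01DL_testH01, inner_oneL2, integral_congr_ae (coeFn_testL2 _)]
  exact φ.2.integral_deriv

theorem inner_H01V_of_hasWeakDeriv {F f : ℝ → ℝ} (hF : MemLp F 2 vol01) (hf : MemLp f 2 vol01)
    (H : HasWeakDeriv 1 F f) (v : H01) :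
    inner ℝ (hf.toLp f) (H01V v) = - inner ℝ (hF.toLp F) (H01DL v) := by
  refine denseRange_testH01.induction_on v
    (isClosed_eq (by fun_prop) (by fun_prop)) fun φ => ?_
  rw [H01V_testH01, H01DL_testH01]
  change inner ℝ _ ((φ.2.memLp_vol01 2).toLp φ.1) =
    - inner ℝ _ ((φ.2.deriv.memLp_vol01 2).toLp (deriv φ.1))
  rw [inner_toLp_toLp, inner_toLp_toLp, hasWeakDeriv_one_iff.1 H φ.1 φ.2, neg_neg]

theorem IsTestFunction.abs_le_integral_deriv {φ : ℝ → ℝ} (h : IsTestFunction φ) (x : ℝ) :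
    |φ x| ≤ ∫ t, |_root_.deriv φ t| ∂vol01 := by
  by_cases hx : x ∈ Ioo (0 : ℝ) 1
  · have h1 : φ x = ∫ t in (0 : ℝ)..x, _root_.deriv φ t := by
      rw [h.integral_eq_sub, h.eq_zero (x := 0) (by simp), sub_zero]
    rw [h1, integral_vol01_eq]
    refine (intervalIntegral.abs_integral_le_integral_abs hx.1.le).trans ?_
    exact intervalIntegral.integral_mono_interval le_rfl hx.1.le hx.2.le
      (Filter.Eventually.of_forall fun _ => abs_nonneg _)
      (h.deriv.continuous.abs.intervalIntegrable _ _)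
  · rw [h.eq_zero hx, abs_zero]
    exact integral_nonneg fun _ => abs_nonneg _

theorem integral_abs_le_norm_toLp {f : ℝ → ℝ} (hf : MemLp f 2 vol01) :
    ∫ x, |f x| ∂vol01 ≤ ‖hf.toLp f‖ := by
  have h1 : ∫ x, |f x| ∂vol01 = (eLpNorm f 1 vol01).toReal := by
    rw [eLpNorm_one_eq_lintegral_enorm, ← integral_norm_eq_lintegral_enorm hf.1]
    rfl
  rw [h1, Lp.norm_toLp]
  exact ENNReal.toReal_mono hf.2.ne (eLpNorm_le_eLpNorm_of_exponent_le one_le_two hf.1)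

theorem integral_abs_le_norm (f : L2I) : ∫ x, |f x| ∂vol01 ≤ ‖f‖ := by
  have := integral_abs_le_norm_toLp (Lp.memLp f)
  rwa [Lp.toLp_coeFn] at this

theorem norm_le_of_ae_bound {f : L2I} {C : ℝ} (hC : 0 ≤ C) (h : ∀ᵐ x ∂vol01, |f x| ≤ C) :
    ‖f‖ ≤ C := by
  have := Lp.norm_le_of_ae_bound (f := f) hC h
  have h1 : measureUnivNNReal vol01 = 1 := by simp [measureUnivNNReal]
  simpa [h1] using this

/-- A test function starts from zero, so its supremum is at most the $L^1$ norm of its derivative.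
The interval has mass one, so the $L^1$ norm is at most the $L^2$ norm and the $L^2$ norm at most
the supremum. -/
theorem norm_H01V_le_H01DL (v : H01) : ‖H01V v‖ ≤ ‖H01DL v‖ := by
  refine denseRange_testH01.induction_on v
    (isClosed_le (by fun_prop) (by fun_prop)) fun φ => ?_
  refine norm_le_of_ae_bound (norm_nonneg _) ?_
  filter_upwards [coeFn_testL2 φ] with x hx
  rw [H01V_testH01, hx]
  exact (φ.2.abs_le_integral_deriv x).trans
    (integral_abs_le_norm_toLp (φ.2.deriv.memLp_vol01 2))

/-- The Poincaré inequality. -/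
theorem norm_H01_le (v : H01) : ‖v‖ ≤ 2 * ‖H01DL v‖ := by
  have h1 := H01_norm_sq v
  have h2 := norm_H01V_le_H01DL v
  refine abs_le_of_sq_le_sq' ?_ (by positivity) |>.2
  nlinarith [norm_nonneg (H01V v), norm_nonneg (H01DL v)]

theorem isClosed_range_of_bounded_below {E F : Type*} [NormedAddCommGroup E] [NormedSpace ℝ E]
    [CompleteSpace E] [NormedAddCommGroup F] [NormedSpace ℝ F] (T : E →L[ℝ] F) {c : ℝ}
    (hc : 0 < c) (h : ∀ x, c * ‖x‖ ≤ ‖T x‖) : IsClosed (LinearMap.range T.toLinearMap : Set F) := by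
  have hT : AntilipschitzWith (Real.toNNReal c⁻¹) T :=
    T.antilipschitz_of_bound fun x => by
      rw [Real.coe_toNNReal _ (by positivity), inv_mul_eq_div, le_div_iff₀ hc, mul_comm]
      exact h x
  exact hT.isClosed_range T.uniformContinuous

instance : CompleteSpace H01 := by
  unfold H01
  infer_instance

/-- Every element of `L²(0,1)` of mean zero is the weak derivative of an element of `H₀¹(0,1)`. -/
theorem exists_H01DL_eq {h : L2I} (h0 : inner ℝ oneL2 h = (0 : ℝ)) : ∃ v : H01, H01DL v = h := by
  set S := LinearMap.range H01DL.toLinearMap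
  -- The Poincaré inequality makes the derivative bounded below, hence its range closed, and $h$ can
  -- be split orthogonally.
  have hS : IsClosed (S : Set L2I) := isClosed_range_of_bounded_below H01DL
    (by norm_num : (0 : ℝ) < 1 / 2) fun v => by linarith [norm_H01_le v]
  have : CompleteSpace S := hS.completeSpace_coe
  obtain ⟨y, ⟨v, hv⟩, z, hz, hyz⟩ := S.exists_add_mem_mem_orthogonal h
  -- The remainder $z$ is orthogonal to all derivatives, hence constant; its mean is zero because
  -- $h$ and $y$ have mean zero. So $z=0$.
  have hz' : ∀ v, inner ℝ z (H01DL v) = 0 := fun v => by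
    rw [real_inner_comm]; exact (Submodule.mem_orthogonal _ _).1 hz _ ⟨v, rfl⟩
  obtain ⟨c, hc⟩ := ae_eq_const_of_forall_deriv ((Lp.memLp z).integrable one_le_two)
    fun φ hφ => by
      have h1 := hz' (testH01 ⟨φ, hφ⟩)
      rw [H01DL_testH01, L2I_inner_eq] at h1
      rw [← h1]
      exact integral_congr_ae ((coeFn_testL2 (testDeriv ⟨φ, hφ⟩)).mono fun x hx =>
        congrArg (z x * ·) hx.symm)
  have h1 : inner ℝ oneL2 z = (0 : ℝ) := by
    have h2 : inner ℝ oneL2 y = (0 : ℝ) := hv ▸ inner_oneL2_H01DL v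
    rw [hyz, inner_add_right, h2, zero_add] at h0
    exact h0
  rw [inner_oneL2, integral_congr_ae hc] at h1
  simp only [integral_const, probReal_univ, one_smul] at h1
  have h3 : z = 0 := by
    refine Lp.ext (hc.trans ?_)
    rw [h1]
    exact (Lp.coeFn_zero _ _ _).symm
  exact ⟨v, by rw [hyz, h3, add_zero]; exact hv⟩

end FracDiff

namespace FracDiff

/-! ### The Gamma integral with complex parameter. -/

section GammaIntegral

open Complex ProbabilityTheory

/-- The measure `y ^ (β - 1) dy` on the half-line `(0,∞)`. -/
noncomputable def powMeasure (β : ℝ) : Measure ℝ :=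
  (volume.restrict (Ioi 0)).withDensity fun y => ENNReal.ofReal (y ^ (β - 1))

theorem integral_powMeasure (β : ℝ) (f : ℝ → ℂ) :
    ∫ y, f y ∂powMeasure β = ∫ y in Ioi (0 : ℝ), ((y ^ (β - 1) : ℝ) : ℂ) * f y := by
  rw [powMeasure, integral_withDensity_eq_integral_toReal_smul (by fun_prop)
    (Filter.Eventually.of_forall fun _ => ENNReal.ofReal_lt_top)]
  refine setIntegral_congr_fun measurableSet_Ioi fun y hy => ?_
  rw [ENNReal.toReal_ofReal (Real.rpow_nonneg (le_of_lt hy) _), real_smul]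

theorem integrable_powMeasure_exp {β t : ℝ} (hβ : 0 < β) (ht : t < 0) :
    Integrable (fun y => Real.exp (t * id y)) (powMeasure β) := by
  rw [powMeasure, integrable_withDensity_iff_integrable_smul' (by fun_prop)
    (Filter.Eventually.of_forall fun _ => ENNReal.ofReal_lt_top)]
  have h2 : IntegrableOn (fun y : ℝ => y ^ (β - 1) * Real.exp (t * y)) (Ioi 0) := by
    have := integrableOn_rpow_mul_exp_neg_mul_rpow (s := β - 1) (p := 1) (b := -t)
      (by linarith) one_pos (by linarith)
    simpa using this
  refine h2.congr_fun (fun y hy => ?_) measurableSet_Ioi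
  simp only
  rw [ENNReal.toReal_ofReal (Real.rpow_nonneg (le_of_lt hy) _), smul_eq_mul]
  simp

/-- The left side is the moment generating function of `powMeasure β` at $-z$. Both sides are
analytic in the connected right half-plane and agree on the positive reals by the real Gamma
integral. -/
theorem integral_rpow_mul_cexp_neg {β : ℝ} (hβ : 0 < β) {z : ℂ} (hz : 0 < z.re) :
    ∫ y in Ioi (0 : ℝ), ((y ^ (β - 1) : ℝ) : ℂ) * cexp (-(z * y)) =
      Real.Gamma β * z ^ (-β : ℂ) := by
  have hF : AnalyticOnNhd ℂ (fun z => complexMGF id (powMeasure β) (-z)) {z | 0 < z.re} := by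
    have h1 : AnalyticOnNhd ℂ (complexMGF id (powMeasure β)) {z | z.re < 0} := by
      refine analyticOnNhd_complexMGF.mono fun z hz => ?_
      exact interior_maximal (fun t ht => integrable_powMeasure_exp hβ ht) isOpen_Iio hz
    exact h1.comp analyticOnNhd_id.neg fun z hz => by simpa using hz
  have hG : AnalyticOnNhd ℂ (fun z : ℂ => (Real.Gamma β : ℂ) * z ^ (-β : ℂ)) {z | 0 < z.re} :=
    fun z hz => analyticAt_const.mul (analyticAt_id.cpow analyticAt_const (Or.inl hz))
  have hpre : IsPreconnected {z : ℂ | 0 < z.re} := (convex_halfSpace_re_gt 0).isPreconnected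
  have hreal : ∀ t : ℝ, 0 < t → complexMGF id (powMeasure β) (-(t : ℂ)) =
      (Real.Gamma β : ℂ) * (t : ℂ) ^ (-β : ℂ) := by
    intro t ht
    rw [complexMGF, integral_powMeasure]
    have h1 := Real.integral_rpow_mul_exp_neg_mul_Ioi hβ ht
    have h2 : ((∫ y in Ioi (0 : ℝ), y ^ (β - 1) * Real.exp (-(t * y)) : ℝ) : ℂ) =
        (((1 / t) ^ β * Real.Gamma β : ℝ) : ℂ) := by rw [h1]
    rw [← integral_complex_ofReal] at h2
    have h3 : ((1 / t) ^ β : ℝ) = t ^ (-β) := by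
      rw [one_div, Real.inv_rpow ht.le, Real.rpow_neg ht.le]
    rw [h3, mul_comm (t ^ (-β)), ofReal_mul, ofReal_cpow ht.le] at h2
    push_cast at h2 ⊢
    rw [← h2]
    simp
  have h := hF.eqOn_of_preconnected_of_frequently_eq hG hpre (z₀ := 1) (by simp) ?_ hz
  · simp only [complexMGF, integral_powMeasure] at h
    rw [← h]
    simp
  -- The identity theorem needs agreement at points accumulating at $1$; the reals $1+1/(n+1)$
  -- serve.
  · rw [Filter.frequently_iff_seq_forall]
    refine ⟨fun n => ((1 + 1 / ((n : ℝ) + 1) : ℝ) : ℂ), ?_, fun n => ?_⟩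
    · refine tendsto_nhdsWithin_iff.2 ⟨?_, Filter.Eventually.of_forall fun n => ?_⟩
      · have h1 : Filter.Tendsto (fun n : ℕ => 1 + 1 / ((n : ℝ) + 1)) Filter.atTop (nhds (1 + 0)) :=
          tendsto_const_nhds.add tendsto_one_div_add_atTop_nhds_zero_nat
        rw [add_zero] at h1
        have h2 := (continuous_ofReal.tendsto (1 : ℝ)).comp h1
        rw [ofReal_one] at h2
        exact h2
      · have : (0 : ℝ) < 1 / ((n : ℝ) + 1) := by positivity
        intro h
        have h' : (1 + 1 / ((n : ℝ) + 1) : ℝ) = 1 := ofReal_injective (mem_singleton_iff.1 h)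
        linarith
    · exact hreal _ (by positivity)

end GammaIntegral

/-! ### Parseval's identity for functions in $L^1\cap L^2$. -/

section Plancherel

open Filter

/-- Tested against a smooth compactly supported $g$, both inverse transforms give $\int \mathcal
F^{-1}g\cdot G$: the $L^2$ one through tempered distributions, the integral one through Fubini. -/
theorem fourierInv_toLp_ae_eq {G : ℝ → ℂ} (h1 : Integrable G) (h2 : MemLp G 2) :
    (𝓕⁻ (h2.toLp G) : Lp ℂ 2 (volume : Measure ℝ)) =ᵐ[volume] 𝓕⁻ G := by
  have hcont : Continuous (𝓕⁻ G) := by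
    rw [Real.fourierInv_eq_fourier_comp_neg]
    exact VectorFourier.fourierIntegral_continuous Real.continuous_fourierChar
      (by fun_prop) h1.comp_neg
  refine ae_eq_of_integral_contDiff_smul_eq
    ((Lp.memLp _).locallyIntegrable one_le_two) hcont.locallyIntegrable fun g hg hgs => ?_
  have hgs' : HasCompactSupport fun x => (g x : ℂ) := hgs.comp_left (g := Complex.ofReal) rfl
  let gS := hgs'.toSchwartzMap (Complex.ofRealCLM.contDiff.comp hg)
  have hS : ∀ x, gS x = (g x : ℂ) := fun x => rfl
  have e1 := Lp.toTemperedDistribution_apply (𝓕⁻ (h2.toLp G) : Lp ℂ 2 (volume : Measure ℝ)) gS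
  rw [← Lp.fourierInv_toTemperedDistribution_eq, TemperedDistribution.fourierInv_apply,
    Lp.toTemperedDistribution_apply] at e1
  have e2 : ∫ x, g x • (𝓕⁻ (h2.toLp G) : Lp ℂ 2 (volume : Measure ℝ)) x
      = ∫ x, gS x • (𝓕⁻ (h2.toLp G) : Lp ℂ 2 (volume : Measure ℝ)) x :=
    integral_congr_ae (Eventually.of_forall fun x => by simp [hS])
  rw [e2, ← e1]
  have e3 : ∫ x, (𝓕⁻ gS) x • (h2.toLp G) x = ∫ x, (𝓕⁻ gS) x • G x :=
    integral_congr_ae (h2.coeFn_toLp.mono fun x hx => by simp only [hx])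
  rw [e3]
  have e4 : ∫ x, g x • 𝓕⁻ G x = ∫ x, gS x • 𝓕⁻ G x :=
    integral_congr_ae (Eventually.of_forall fun x => by simp [hS])
  have e5 := VectorFourier.integral_fourierIntegral_smul_eq_flip (μ := volume) (ν := volume)
    (L := (innerₗ ℝ : ℝ →ₗ[ℝ] ℝ →ₗ[ℝ] ℝ)) (f := gS) (g := fun x => G (-x))
    Real.continuous_fourierChar (by exact continuous_inner) gS.integrable h1.comp_neg
  have e6 : ∫ x, (𝓕⁻ gS) x • G x = ∫ x, 𝓕 (gS : ℝ → ℂ) x • G (-x) := by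
    rw [← integral_neg_eq_self]
    refine integral_congr_ae (Eventually.of_forall fun x => ?_)
    simp only [SchwartzMap.fourierInv_coe, Real.fourierInv_eq_fourier_neg, neg_neg]
  rw [e4, e6, Real.fourierInv_eq_fourier_comp_neg]
  refine e5.trans (integral_congr_ae (Eventually.of_forall fun x => ?_))
  simp only [flip_innerₗ]
  rfl

/-- Parseval's identity for inverse Fourier transforms of functions in `L¹ ∩ L²`. -/
theorem integral_conj_mul_fourierInv {F G : ℝ → ℂ} (hF1 : Integrable F) (hF2 : MemLp F 2)
    (hG1 : Integrable G) (hG2 : MemLp G 2) :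
    ∫ x, inner ℂ (𝓕⁻ F x) (𝓕⁻ G x) = ∫ ξ, inner ℂ (F ξ) (G ξ) := by
  have h := Lp.inner_fourier_eq (𝓕⁻ (hF2.toLp F) : Lp ℂ 2 (volume : Measure ℝ))
    (𝓕⁻ (hG2.toLp G) : Lp ℂ 2 (volume : Measure ℝ))
  rw [FourierTransform.fourier_fourierInv_eq, FourierTransform.fourier_fourierInv_eq,
    L2.inner_def, L2.inner_def] at h
  have e1 : ∀ᵐ x, inner ℂ ((𝓕⁻ (hF2.toLp F) : Lp ℂ 2 (volume : Measure ℝ)) x)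
      ((𝓕⁻ (hG2.toLp G) : Lp ℂ 2 (volume : Measure ℝ)) x) = inner ℂ (𝓕⁻ F x) (𝓕⁻ G x) := by
    filter_upwards [fourierInv_toLp_ae_eq hF1 hF2, fourierInv_toLp_ae_eq hG1 hG2] with x h1 h2
    rw [h1, h2]
  have e2 : ∀ᵐ x, inner ℂ ((hF2.toLp F) x) ((hG2.toLp G) x) = inner ℂ (F x) (G x) := by
    filter_upwards [hF2.coeFn_toLp, hG2.coeFn_toLp] with x h1 h2
    rw [h1, h2]
  rw [← integral_congr_ae e1, ← integral_congr_ae e2, h]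

theorem memLp_fourierInv {F : ℝ → ℂ} (hF1 : Integrable F) (hF2 : MemLp F 2) :
    MemLp (𝓕⁻ F) 2 :=
  (memLp_congr_ae (fourierInv_toLp_ae_eq hF1 hF2)).1 (Lp.memLp _)

end Plancherel

end FracDiff

/-! ### Fractional integrals on the line as Fourier multipliers. -/

namespace FracDiff

open Filter

/-- The one-sided fractional integral on the line, to the left for `σ = 1` and to the right for
`σ = -1`. -/
noncomputable def lineInt (β σ : ℝ) (ψ : ℝ → ℝ) (x : ℝ) : ℝ :=
  1 / Real.Gamma β * ∫ y in Ioi (0 : ℝ), y ^ (β - 1) * ψ (x - σ * y)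

/-- The Fourier symbol of `lineInt β σ`. -/
noncomputable def lineSymbol (β σ ξ : ℝ) : ℂ := ((σ * (2 * Real.pi * ξ) : ℝ) * Complex.I) ^ (-β : ℂ)

/-- The Fourier transform of a real function. -/
noncomputable def realFourier (φ : ℝ → ℝ) : ℝ → ℂ := 𝓕 fun x => (φ x : ℂ)

/-- For $|\xi|\le1$ the weight is integrable because $\gamma<1$, and $f$ is bounded there. For
$|\xi|>1$ the weight is at most one and $f$ is integrable. -/
theorem integrable_rpow_abs_mul {γ : ℝ} (h1 : γ < 1) {f : ℝ → ℝ} (hf : Integrable f)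
    (hγ : 0 ≤ γ) {C : ℝ} (hC : ∀ x, |f x| ≤ C) :
    Integrable fun ξ => (2 * Real.pi * |ξ|) ^ (-γ) * f ξ := by
  have hm : Measurable fun ξ : ℝ => (2 * Real.pi * |ξ|) ^ (-γ) := by fun_prop
  have hi : Integrable fun ξ : ℝ => (Ioc (0 : ℝ) 1).indicator
      (fun y => (2 * Real.pi * y) ^ (-γ)) ‖ξ‖ := by
    rw [integrable_fun_norm_addHaar volume (f := (Ioc (0 : ℝ) 1).indicator
      (fun y => (2 * Real.pi * y) ^ (-γ)))]
    simp only [Module.finrank_self, tsub_self, pow_zero, one_smul]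
    refine Integrable.integrableOn ((integrable_indicator_iff measurableSet_Ioc).2 ?_)
    have h2 : IntegrableOn (fun y : ℝ => (2 * Real.pi) ^ (-γ) * y ^ (-γ)) (Ioc 0 1) := by
      have := intervalIntegral.intervalIntegrable_rpow' (r := -γ) (by linarith) (a := 0) (b := 1)
      rw [intervalIntegrable_iff_integrableOn_Ioc_of_le zero_le_one] at this
      exact this.const_mul _
    refine h2.congr_fun (fun y hy => ?_) measurableSet_Ioc
    simp only
    rw [Real.mul_rpow (by positivity) hy.1.le]
  refine ((hi.mul_const C).add hf.norm).mono' (hm.aestronglyMeasurable.mul hf.1) ?_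
  filter_upwards [Measure.ae_ne volume 0] with ξ hξ
  have hpos : 0 < |ξ| := abs_pos.2 hξ
  have h0 : 0 ≤ (2 * Real.pi * |ξ|) ^ (-γ) := by positivity
  rw [norm_mul, Real.norm_of_nonneg h0]
  by_cases h : |ξ| ≤ 1
  · simp only [Pi.add_apply]
    rw [indicator_of_mem (show ‖ξ‖ ∈ Ioc (0 : ℝ) 1 from ⟨hpos, h⟩)]
    have := mul_le_mul_of_nonneg_left (hC ξ) h0
    have h3 := norm_nonneg (f ξ)
    simp only [Real.norm_eq_abs] at *
    linarith
  · simp only [Pi.add_apply]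
    rw [indicator_of_notMem (fun hx : ‖ξ‖ ∈ Ioc (0 : ℝ) 1 => h hx.2), zero_mul, zero_add]
    refine mul_le_of_le_one_left (norm_nonneg _) (Real.rpow_le_one_of_one_le_of_nonpos ?_
      (by linarith))
    nlinarith [Real.pi_gt_three, not_le.1 h]

namespace IsTestFunction

variable {φ ψ : ℝ → ℝ}

/-- A test function as a complex-valued Schwartz function. -/
noncomputable def toSchwartz (h : IsTestFunction φ) : SchwartzMap ℝ ℂ :=
  (show HasCompactSupport fun x => (φ x : ℂ) from
    h.hasCompactSupport.comp_left (g := Complex.ofReal) rfl).toSchwartzMap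
    (Complex.ofRealCLM.contDiff.comp h.1)

theorem realFourier_eq (h : IsTestFunction φ) : realFourier φ = 𝓕 h.toSchwartz := by
  rw [SchwartzMap.fourier_coe]
  rfl

theorem integrable_realFourier (h : IsTestFunction φ) : Integrable (realFourier φ) := by
  rw [h.realFourier_eq]; exact (𝓕 h.toSchwartz).integrable

theorem memLp_realFourier (h : IsTestFunction φ) (p : ℝ≥0∞) : MemLp (realFourier φ) p := by
  rw [h.realFourier_eq]; exact (𝓕 h.toSchwartz).memLp p

theorem continuous_realFourier (h : IsTestFunction φ) : Continuous (realFourier φ) := by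
  rw [h.realFourier_eq]; exact (𝓕 h.toSchwartz).continuous

theorem norm_realFourier_le (h : IsTestFunction φ) (ξ : ℝ) :
    ‖realFourier φ ξ‖ ≤ ∫ x, |φ x| ∂vol01 := by
  have h1 := VectorFourier.norm_fourierIntegral_le_integral_norm Real.fourierChar volume
    (innerₗ ℝ) (fun x => (φ x : ℂ)) ξ
  refine h1.trans (le_of_eq ?_)
  rw [vol01, setIntegral_eq_integral_of_forall_compl_eq_zero fun x hx => by
    rw [h.eq_zero hx, abs_zero]]
  simp

theorem inversion (h : IsTestFunction φ) (x : ℝ) :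
    (φ x : ℂ) = ∫ ξ, Complex.exp ((2 * Real.pi * ξ * x : ℝ) * Complex.I) * realFourier φ ξ := by
  have h1 : 𝓕⁻ (𝓕 h.toSchwartz) = h.toSchwartz := FourierTransform.fourierInv_fourier_eq _
  have h2 := congrFun (congrArg (fun f : SchwartzMap ℝ ℂ => (f : ℝ → ℂ)) h1) x
  simp only [SchwartzMap.fourierInv_coe] at h2
  rw [← h.realFourier_eq, Real.fourierInv_eq'] at h2
  refine Eq.trans h2.symm ?_
  refine integral_congr_ae (Eventually.of_forall fun ξ => ?_)
  simp only [smul_eq_mul, RCLike.inner_apply, conj_trivial]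
  congr 3
  push_cast
  ring

theorem realFourier_deriv (h : IsTestFunction φ) (ξ : ℝ) :
    realFourier (_root_.deriv φ) ξ = (2 * Real.pi * ξ : ℝ) * Complex.I * realFourier φ ξ := by
  have h1 : (fun x => ((_root_.deriv φ x : ℝ) : ℂ)) = _root_.deriv fun x => (φ x : ℂ) :=
    funext fun x => ((h.hasDerivAt x).ofReal_comp.deriv).symm
  have h2 : Integrable fun x => (φ x : ℂ) := h.integrable.ofReal
  have h3 : Integrable (_root_.deriv fun x => (φ x : ℂ)) := by
    rw [← h1]; exact h.deriv.integrable.ofReal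
  have h4 := Real.fourier_deriv h2 (fun x => (h.hasDerivAt x).ofReal_comp.differentiableAt) h3
  rw [realFourier, h1, h4]
  simp only [smul_eq_mul, realFourier]
  push_cast
  ring

theorem integrableOn_rpow_mul (h : IsTestFunction φ) {β : ℝ} (hβ : 0 < β) {σ : ℝ}
    (hσ : σ = 1 ∨ σ = -1) (x : ℝ) :
    IntegrableOn (fun y => y ^ (β - 1) * φ (x - σ * y)) (Ioi 0) := by
  have h1 : IntegrableOn (fun y => y ^ (β - 1) * φ (x - σ * y)) (Ioc 0 (|x| + 1)) := by
    have := intervalIntegral.intervalIntegrable_rpow' (r := β - 1) (by linarith) (a := 0)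
      (b := |x| + 1)
    rw [intervalIntegrable_iff_integrableOn_Ioc_of_le (by positivity)] at this
    obtain ⟨C, hC⟩ := h.bounded
    exact this.mul_bdd (c := C) (h.continuous.comp (by fun_prop)).aestronglyMeasurable
      (Eventually.of_forall fun y => hC _)
  refine IntegrableOn.of_forall_sdiff_eq_zero h1 measurableSet_Ioi fun y hy => ?_
  have hy1 : |x| + 1 < y := by
    by_contra hc
    exact hy.2 ⟨hy.1, not_lt.1 hc⟩
  rw [h.eq_zero, mul_zero]
  rintro ⟨h2, h3⟩
  have := abs_le.1 (le_refl |x|)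
  rcases hσ with rfl | rfl <;> linarith [this.1, this.2]

end IsTestFunction

/-- The modulus of the base is at least that of its imaginary part and the exponent is negative. The
bound does not depend on $\varepsilon$ and so dominates the limit $\varepsilon\to0$. -/
theorem norm_lineSymbol_le {β σ ε ξ : ℝ} (hβ : 0 < β) (hσ : σ = 1 ∨ σ = -1) (hξ : ξ ≠ 0) :
    ‖((ε : ℂ) + (σ * (2 * Real.pi * ξ) : ℝ) * Complex.I) ^ (-β : ℂ)‖ ≤
      (2 * Real.pi * |ξ|) ^ (-β) := by
  have h1 := Complex.norm_cpow_real ((ε : ℂ) + (σ * (2 * Real.pi * ξ) : ℝ) * Complex.I) (-β)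
  rw [Complex.ofReal_neg] at h1
  rw [h1]
  have hpos : 0 < |ξ| := abs_pos.2 hξ
  refine Real.rpow_le_rpow_of_nonpos (by positivity) ?_ (by linarith)
  refine le_trans (le_of_eq ?_) (Complex.abs_im_le_norm _)
  have : |σ| = 1 := by rcases hσ with rfl | rfl <;> simp
  simp [abs_mul, this, abs_of_pos Real.pi_pos]

theorem norm_lineSymbol {β σ ξ : ℝ} (hσ : σ = 1 ∨ σ = -1) :
    ‖lineSymbol β σ ξ‖ = (2 * Real.pi * |ξ|) ^ (-β) := by
  have h1 := Complex.norm_cpow_real ((σ * (2 * Real.pi * ξ) : ℝ) * Complex.I) (-β)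
  rw [Complex.ofReal_neg] at h1
  rw [lineSymbol, h1]
  have : |σ| = 1 := by rcases hσ with rfl | rfl <;> simp
  simp [this, abs_of_pos Real.pi_pos]

theorem measurable_lineSymbol (β σ : ℝ) : Measurable (lineSymbol β σ) := by
  unfold lineSymbol
  fun_prop

theorem integrable_lineSymbol_mul {β σ : ℝ} (hβ : 0 < β) (hβ1 : β < 1) (hσ : σ = 1 ∨ σ = -1)
    {ψ : ℝ → ℝ} (h : IsTestFunction ψ) :
    Integrable fun ξ => lineSymbol β σ ξ * realFourier ψ ξ := by
  have := integrable_rpow_abs_mul hβ1 h.integrable_realFourier.norm hβ.le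
    (C := ∫ x, |ψ x| ∂vol01) fun x => by rw [abs_norm]; exact h.norm_realFourier_le x
  refine this.mono' ((measurable_lineSymbol β σ).aestronglyMeasurable.mul
    h.continuous_realFourier.aestronglyMeasurable) (Eventually.of_forall fun ξ => ?_)
  rw [norm_mul, norm_lineSymbol hσ]

/-- The squared symbol is $|\omega|^{-2\beta}$, integrable at the origin because $\beta<1/2$. -/
theorem memLp_lineSymbol_mul {β σ : ℝ} (hβ : 0 < β) (hβ1 : β < 1 / 2) (hσ : σ = 1 ∨ σ = -1)
    {ψ : ℝ → ℝ} (h : IsTestFunction ψ) :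
    MemLp (fun ξ => lineSymbol β σ ξ * realFourier ψ ξ) 2 := by
  have hm : AEStronglyMeasurable (fun ξ => lineSymbol β σ ξ * realFourier ψ ξ) volume :=
    (measurable_lineSymbol β σ).aestronglyMeasurable.mul
      h.continuous_realFourier.aestronglyMeasurable
  rw [memLp_two_iff_integrable_sq_norm hm]
  have h2 := (memLp_two_iff_integrable_sq_norm h.continuous_realFourier.aestronglyMeasurable).1
    (h.memLp_realFourier 2)
  have := integrable_rpow_abs_mul (γ := 2 * β) (by linarith) h2 (by linarith)
    (C := (∫ x, |ψ x| ∂vol01) ^ 2) fun x => by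
      rw [abs_of_nonneg (by positivity)]
      exact pow_le_pow_left₀ (norm_nonneg _) (h.norm_realFourier_le x) 2
  refine this.congr (Eventually.of_forall fun ξ => ?_)
  simp only [norm_mul, norm_lineSymbol hσ, mul_pow]
  rw [← Real.rpow_natCast ((2 * Real.pi * |ξ|) ^ (-β)), ← Real.rpow_mul (by positivity)]
  congr 2
  push_cast
  ring

end FracDiff

namespace FracDiff

open Filter

/-- The factor $e^{-\varepsilon y}$ makes the double integral in $y$ and $\xi$ absolutely
convergent, so Fourier inversion of $\psi$ may be inserted and the order exchanged. The inner
integral is `integral_rpow_mul_cexp_neg` at $\varepsilon+i\sigma\omega$. -/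
theorem lineInt_regularized {β σ ε : ℝ} (hβ : 0 < β) (hε : 0 < ε)
    {ψ : ℝ → ℝ} (h : IsTestFunction ψ) (x : ℝ) :
    ∫ y in Ioi (0 : ℝ), ((y ^ (β - 1) * Real.exp (-(ε * y)) : ℝ) : ℂ) * (ψ (x - σ * y) : ℂ) =
      ∫ ξ, Real.Gamma β * (((ε : ℂ) + (σ * (2 * Real.pi * ξ) : ℝ) * Complex.I) ^ (-β : ℂ) *
        (Complex.exp ((2 * Real.pi * ξ * x : ℝ) * Complex.I) * realFourier ψ ξ)) := by
  set a : ℝ → ℂ := fun y => ((y ^ (β - 1) * Real.exp (-(ε * y)) : ℝ) : ℂ)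
  have ha : IntegrableOn a (Ioi 0) := by
    have := integrableOn_rpow_mul_exp_neg_mul_rpow (s := β - 1) (p := 1) (b := ε)
      (by linarith) one_pos hε
    simp only [Real.rpow_one, neg_mul] at this
    exact this.ofReal
  have hF : Integrable (Function.uncurry fun y ξ : ℝ => a y *
      (Complex.exp ((2 * Real.pi * ξ * (x - σ * y) : ℝ) * Complex.I) * realFourier ψ ξ))
      ((volume.restrict (Ioi 0)).prod volume) := by
    have h1 := Integrable.mul_prod (μ := volume.restrict (Ioi 0)) (ν := volume) ha
      h.integrable_realFourier
    have h2 := h1.bdd_mul (c := 1) (f := fun z : ℝ × ℝ =>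
      Complex.exp ((2 * Real.pi * z.2 * (x - σ * z.1) : ℝ) * Complex.I))
      (by fun_prop) (Eventually.of_forall fun z => by rw [Complex.norm_exp_ofReal_mul_I])
    refine h2.congr (Eventually.of_forall fun z => ?_)
    simp only [Function.uncurry]
    ring
  calc _ = ∫ y in Ioi (0 : ℝ), ∫ ξ, a y *
      (Complex.exp ((2 * Real.pi * ξ * (x - σ * y) : ℝ) * Complex.I) * realFourier ψ ξ) := by
        refine integral_congr_ae (Eventually.of_forall fun y => ?_)
        simp only
        rw [h.inversion, integral_const_mul]
    _ = ∫ ξ, ∫ y in Ioi (0 : ℝ), a y *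
      (Complex.exp ((2 * Real.pi * ξ * (x - σ * y) : ℝ) * Complex.I) * realFourier ψ ξ) :=
        integral_integral_swap hF
    _ = _ := by
        refine integral_congr_ae (Eventually.of_forall fun ξ => ?_)
        simp only
        set z : ℂ := (ε : ℂ) + (σ * (2 * Real.pi * ξ) : ℝ) * Complex.I
        have hz : 0 < z.re := by simpa [z] using hε
        rw [← mul_assoc, ← integral_rpow_mul_cexp_neg hβ hz, ← integral_mul_const]
        refine integral_congr_ae (Eventually.of_forall fun y => ?_)
        simp only [a, z]
        push_cast
        have : ∀ p q r s t f : ℂ, q * r = s * t → p * q * (r * f) = p * s * (t * f) := by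
          intro p q r s t f h; linear_combination p * f * h
        refine this _ _ _ _ _ _ ?_
        rw [← Complex.exp_add, ← Complex.exp_add]
        congr 1
        ring

/-- Dominated convergence in `lineInt_regularized` along $\varepsilon=1/(n+1)$ on both sides. The
limit symbol exists for $\xi\ne0$ because $i\sigma\omega$ avoids the branch cut. -/
theorem lineInt_eq_fourierInv {β σ : ℝ} (hβ : 0 < β) (hβ1 : β < 1) (hσ : σ = 1 ∨ σ = -1)
    {ψ : ℝ → ℝ} (h : IsTestFunction ψ) (x : ℝ) :
    (lineInt β σ ψ x : ℂ) = 𝓕⁻ (fun ξ => lineSymbol β σ ξ * realFourier ψ ξ) x := by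
  have hε : Tendsto (fun n : ℕ => 1 / ((n : ℝ) + 1)) atTop (nhds 0) :=
    tendsto_one_div_add_atTop_nhds_zero_nat
  have hpos : ∀ n : ℕ, 0 < 1 / ((n : ℝ) + 1) := fun n => by positivity
  have hL : Tendsto (fun n : ℕ => ∫ y in Ioi (0 : ℝ),
      ((y ^ (β - 1) * Real.exp (-(1 / ((n : ℝ) + 1) * y)) : ℝ) : ℂ) * (ψ (x - σ * y) : ℂ)) atTop
      (nhds (∫ y in Ioi (0 : ℝ), ((y ^ (β - 1) : ℝ) : ℂ) * (ψ (x - σ * y) : ℂ))) := by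
    have hi := h.integrableOn_rpow_mul hβ hσ x
    have hψ := h.continuous
    refine tendsto_integral_of_dominated_convergence
      (fun y => ‖y ^ (β - 1) * ψ (x - σ * y)‖) (fun n => ?_) hi.norm (fun n => ?_) ?_
    · exact Measurable.aestronglyMeasurable (by fun_prop)
    · filter_upwards [ae_restrict_mem measurableSet_Ioi] with y hy
      rw [← Complex.ofReal_mul, Complex.norm_real, mul_right_comm, norm_mul _ (Real.exp _)]
      refine mul_le_of_le_one_right (norm_nonneg _) ?_
      rw [Real.norm_of_nonneg (Real.exp_nonneg _), Real.exp_le_one_iff]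
      have := mul_pos (hpos n) (mem_Ioi.1 hy)
      linarith
    · refine Eventually.of_forall fun y => ?_
      have h1 : Tendsto (fun n : ℕ => y ^ (β - 1) * Real.exp (-(1 / ((n : ℝ) + 1) * y))) atTop
          (nhds (y ^ (β - 1) * Real.exp (-(0 * y)))) :=
        ((Real.continuous_exp.tendsto _).comp (hε.mul_const y).neg).const_mul _
      simp only [zero_mul, neg_zero, Real.exp_zero, mul_one] at h1
      exact ((Complex.continuous_ofReal.tendsto _).comp h1).mul_const _
  have hR : Tendsto (fun n : ℕ => ∫ ξ, Real.Gamma β *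
      ((((1 / ((n : ℝ) + 1) : ℝ) : ℂ) + (σ * (2 * Real.pi * ξ) : ℝ) * Complex.I) ^ (-β : ℂ) *
        (Complex.exp ((2 * Real.pi * ξ * x : ℝ) * Complex.I) * realFourier ψ ξ))) atTop
      (nhds (∫ ξ, Real.Gamma β * (lineSymbol β σ ξ *
        (Complex.exp ((2 * Real.pi * ξ * x : ℝ) * Complex.I) * realFourier ψ ξ)))) := by
    have hi := integrable_rpow_abs_mul hβ1 h.integrable_realFourier.norm hβ.le
      (C := ∫ x, |ψ x| ∂vol01) fun x => by rw [abs_norm]; exact h.norm_realFourier_le x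
    have hψ := h.continuous_realFourier
    refine tendsto_integral_of_dominated_convergence
      (fun ξ => ‖(Real.Gamma β : ℂ)‖ * ((2 * Real.pi * |ξ|) ^ (-β) * ‖realFourier ψ ξ‖))
      (fun n => ?_) (hi.const_mul _) (fun n => ?_) ?_
    · exact Measurable.aestronglyMeasurable (by fun_prop)
    · filter_upwards [Measure.ae_ne volume 0] with ξ hξ
      rw [norm_mul, norm_mul, norm_mul, Complex.norm_exp_ofReal_mul_I, one_mul]
      gcongr
      exact norm_lineSymbol_le hβ hσ hξ
    · filter_upwards [Measure.ae_ne volume 0] with ξ hξ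
      have h1 : Tendsto (fun n : ℕ => (((1 / ((n : ℝ) + 1) : ℝ) : ℂ) +
          (σ * (2 * Real.pi * ξ) : ℝ) * Complex.I) ^ (-β : ℂ)) atTop
          (nhds (lineSymbol β σ ξ)) := by
        have h2 : ((σ * (2 * Real.pi * ξ) : ℝ) * Complex.I) ∈ Complex.slitPlane := by
          refine Or.inr ?_
          have : σ ≠ 0 := by rcases hσ with rfl | rfl <;> norm_num
          simp [this, Real.pi_ne_zero, hξ]
        refine (continuousAt_cpow_const h2 |>.tendsto).comp ?_
        have h3 := ((Complex.continuous_ofReal.tendsto _).comp hε).add_const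
          ((σ * (2 * Real.pi * ξ) : ℝ) * Complex.I)
        rwa [Complex.ofReal_zero, zero_add] at h3
      exact (h1.mul_const _).const_mul _
  have hu := tendsto_nhds_unique hL (hR.congr fun n => (lineInt_regularized hβ (hpos n) h x).symm)
  have hΓ : (Real.Gamma β : ℂ) ≠ 0 := Complex.ofReal_ne_zero.2 (Real.Gamma_pos_of_pos hβ).ne'
  rw [integral_const_mul] at hu
  rw [lineInt, Complex.ofReal_mul, ← integral_complex_ofReal]
  simp only [Complex.ofReal_mul]
  rw [hu, ← mul_assoc, Complex.ofReal_div, Complex.ofReal_one, one_div_mul_cancel hΓ, one_mul,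
    Real.fourierInv_eq']
  refine integral_congr_ae (Eventually.of_forall fun ξ => ?_)
  simp only [smul_eq_mul, RCLike.inner_apply, conj_trivial]
  have : ((2 * Real.pi * ξ * x : ℝ) : ℂ) = ((2 * Real.pi * (x * ξ) : ℝ) : ℂ) := by
    push_cast; ring
  rw [this]
  ring

theorem memLp_lineInt {β σ : ℝ} (hβ : 0 < β) (hβ1 : β < 1 / 2) (hσ : σ = 1 ∨ σ = -1)
    {ψ : ℝ → ℝ} (h : IsTestFunction ψ) : MemLp (lineInt β σ ψ) 2 := by
  have h1 := memLp_fourierInv (integrable_lineSymbol_mul hβ (by linarith) hσ h)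
    (memLp_lineSymbol_mul hβ hβ1 hσ h)
  have h2 := h1.re
  refine (memLp_congr_ae (Eventually.of_forall fun x => ?_)).1 h2
  simp only [← lineInt_eq_fourierInv hβ (by linarith) hσ h]
  simp

/-- Parseval for the two multipliers. Only the real part of the product of symbols remains, because
the left side is real. -/
theorem integral_lineInt_mul {β σ τ : ℝ} (hβ : 0 < β) (hβ1 : β < 1 / 2) (hσ : σ = 1 ∨ σ = -1)
    (hτ : τ = 1 ∨ τ = -1) {ψ : ℝ → ℝ} (h : IsTestFunction ψ) :
    ∫ x, lineInt β σ ψ x * lineInt β τ ψ x =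
      ∫ ξ, (starRingEnd ℂ (lineSymbol β σ ξ) * lineSymbol β τ ξ).re * ‖realFourier ψ ξ‖ ^ 2 := by
  have h1 := integral_conj_mul_fourierInv (integrable_lineSymbol_mul hβ (by linarith) hσ h)
    (memLp_lineSymbol_mul hβ hβ1 hσ h) (integrable_lineSymbol_mul hβ (by linarith) hτ h)
    (memLp_lineSymbol_mul hβ hβ1 hτ h)
  have hi : Integrable fun ξ => inner ℂ (lineSymbol β σ ξ * realFourier ψ ξ)
      (lineSymbol β τ ξ * realFourier ψ ξ) :=
    (memLp_lineSymbol_mul hβ hβ1 hτ h).integrable_mul (memLp_lineSymbol_mul hβ hβ1 hσ h).star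
  have h2 := congrArg Complex.re h1
  have h3 : ∀ f : ℝ → ℂ, Integrable f → (∫ x, f x).re = ∫ x, (f x).re := fun f hf =>
    (integral_re hf).symm
  rw [h3 _ hi] at h2
  simp only [← lineInt_eq_fourierInv hβ (by linarith) hσ h,
    ← lineInt_eq_fourierInv hβ (by linarith) hτ h] at h2
  simp only [RCLike.inner_apply, Complex.conj_ofReal, ← Complex.ofReal_mul] at h2
  rw [integral_complex_ofReal, Complex.ofReal_re] at h2
  rw [integral_congr_ae (Eventually.of_forall fun x => mul_comm _ _), h2]
  refine integral_congr_ae (Eventually.of_forall fun ξ => ?_)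
  simp only [map_mul]
  rw [show lineSymbol β τ ξ * realFourier ψ ξ * ((starRingEnd ℂ) (lineSymbol β σ ξ) *
    (starRingEnd ℂ) (realFourier ψ ξ)) = (starRingEnd ℂ (lineSymbol β σ ξ) * lineSymbol β τ ξ) *
    (realFourier ψ ξ * (starRingEnd ℂ) (realFourier ψ ξ)) by ring, Complex.mul_conj,
    Complex.normSq_eq_norm_sq, Complex.re_mul_ofReal]

theorem conj_lineSymbol_mul_self {β σ ξ : ℝ} (hσ : σ = 1 ∨ σ = -1) :
    (starRingEnd ℂ (lineSymbol β σ ξ) * lineSymbol β σ ξ).re = (2 * Real.pi * |ξ|) ^ (-(2 * β)) := by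
  rw [mul_comm, Complex.mul_conj, Complex.ofReal_re, Complex.normSq_eq_norm_sq, norm_lineSymbol hσ,
    ← Real.rpow_natCast ((2 * Real.pi * |ξ|) ^ (-β)), ← Real.rpow_mul (by positivity)]
  congr 1
  push_cast
  ring

/-- The product is $(it)^{-2\beta}$: the argument $\pi/2$ of $i$ becomes $-\pi\beta$. -/
theorem re_cpow_neg_mul_self {t : ℝ} (ht : 0 < t) (β : ℝ) :
    (((t : ℂ) * Complex.I) ^ (-β : ℂ) * ((t : ℂ) * Complex.I) ^ (-β : ℂ)).re =
      Real.cos (Real.pi * β) * t ^ (-(2 * β)) := by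
  have h0 : (t : ℂ) * Complex.I ≠ 0 :=
    mul_ne_zero (Complex.ofReal_ne_zero.2 ht.ne') Complex.I_ne_zero
  rw [← Complex.cpow_add _ _ h0, Complex.cpow_def_of_ne_zero h0,
    Complex.log_ofReal_mul ht Complex.I_ne_zero, Complex.log_I]
  have : ((Real.log t : ℂ) + Real.pi / 2 * Complex.I) * (-(β : ℂ) + -(β : ℂ)) =
      ((Real.log t * (-(2 * β)) : ℝ) : ℂ) + ((-(Real.pi * β) : ℝ) : ℂ) * Complex.I := by
    push_cast; ring
  rw [this, Complex.exp_add, ← Complex.ofReal_exp, Complex.re_ofReal_mul,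
    Complex.exp_ofReal_mul_I_re, Real.cos_neg, Real.rpow_def_of_pos ht]
  ring

theorem conj_lineSymbol (β σ ξ : ℝ) (h : σ * (2 * Real.pi * ξ) ≠ 0) :
    starRingEnd ℂ (lineSymbol β σ ξ) = lineSymbol β (-σ) ξ := by
  have harg : ((σ * (2 * Real.pi * ξ) : ℝ) * Complex.I).arg ≠ Real.pi := by
    intro hc
    rw [Complex.arg_eq_pi_iff] at hc
    exact h (by simpa using hc.2)
  have := Complex.conj_cpow _ (-β : ℂ) harg
  simp only [map_neg, Complex.conj_ofReal] at this
  rw [lineSymbol, ← this, map_mul, Complex.conj_ofReal, Complex.conj_I, lineSymbol, neg_mul σ,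
    Complex.ofReal_neg, mul_neg, neg_mul]

/-- Conjugation turns one symbol into the other, so the product is the square of a single symbol;
both signs of $\xi$ lead to the same real part. This is the origin of the factor $\cos(\pi\beta)$ on
which coercivity rests. -/
theorem conj_lineSymbol_mul_neg {β ξ : ℝ} (hξ : ξ ≠ 0) :
    (starRingEnd ℂ (lineSymbol β 1 ξ) * lineSymbol β (-1) ξ).re =
      Real.cos (Real.pi * β) * (2 * Real.pi * |ξ|) ^ (-(2 * β)) := by
  rw [conj_lineSymbol _ _ _ (by simp [hξ, Real.pi_ne_zero])]
  rcases lt_or_gt_of_ne hξ with h | h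
  · have h1 : lineSymbol β (-1) ξ = (((2 * Real.pi * |ξ| : ℝ) : ℂ) * Complex.I) ^ (-β : ℂ) := by
      rw [lineSymbol, abs_of_neg h]; congr 3; ring
    rw [h1, re_cpow_neg_mul_self (by positivity)]
  · have h1 : lineSymbol β (-1) ξ =
        starRingEnd ℂ ((((2 * Real.pi * |ξ| : ℝ) : ℂ) * Complex.I) ^ (-β : ℂ)) := by
      rw [← conj_lineSymbol _ _ _ (by simp [hξ, Real.pi_ne_zero]), lineSymbol, abs_of_pos h]
      simp
    rw [h1, ← map_mul, Complex.conj_re, re_cpow_neg_mul_self (by positivity)]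

end FracDiff

namespace FracDiff

open Filter

/-! ### Fractional integrals of test functions. -/

section PointwiseFormulas

variable {β : ℝ} {φ ψ : ℝ → ℝ}

theorem rpow_sub_one_eq {y : ℝ} (hy : 0 ≤ y) (a : ℝ) : y ^ (β - 1) * a = a / y ^ (1 - β) := by
  rw [show β - 1 = -(1 - β) by ring, Real.rpow_neg hy, div_eq_mul_inv, mul_comm]

theorem IsTestFunction.leftInt_eq (h : IsTestFunction φ) (x : ℝ) :
    leftInt β φ x = lineInt β 1 φ x := by
  rw [leftInt, lineInt]
  congr 1
  rw [← integral_indicator measurableSet_Ioo, ← integral_indicator measurableSet_Ioi,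
    ← integral_sub_left_eq_self _ volume x]
  refine integral_congr_ae (Eventually.of_forall fun y => ?_)
  simp only [indicator_apply, mem_Ioo, mem_Ioi, one_mul]
  by_cases hy : 0 < y
  · rw [if_pos hy, rpow_sub_one_eq hy.le, sub_sub_cancel]
    by_cases hx : 0 < x - y
    · rw [if_pos ⟨hx, by linarith⟩]
    · rw [if_neg fun h => hx h.1, h.eq_zero fun h => hx h.1, zero_div]
  · rw [if_neg hy, if_neg fun h => hy (by linarith [h.2])]

theorem IsTestFunction.rightInt_eq (h : IsTestFunction φ) (x : ℝ) :
    rightInt β φ x = lineInt β (-1) φ x := by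
  rw [rightInt, lineInt]
  congr 1
  rw [← integral_indicator measurableSet_Ioo, ← integral_indicator measurableSet_Ioi,
    ← integral_add_left_eq_self _ x]
  refine integral_congr_ae (Eventually.of_forall fun y => ?_)
  simp only [indicator_apply, mem_Ioo, mem_Ioi, neg_mul, one_mul, sub_neg_eq_add]
  by_cases hy : 0 < y
  · rw [if_pos hy, rpow_sub_one_eq hy.le, add_sub_cancel_left]
    by_cases hx : x + y < 1
    · rw [if_pos ⟨by linarith, hx⟩]
    · rw [if_neg fun h => hx h.2, h.eq_zero fun h => hx h.2, zero_div]
  · rw [if_neg hy, if_neg fun h => hy (by linarith [h.1])]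

theorem IsTestFunction.lineInt_one_eq_zero (h : IsTestFunction φ) {x : ℝ} (hx : x ≤ 0) :
    lineInt β 1 φ x = 0 := by
  rw [← h.leftInt_eq, leftInt, Ioo_eq_empty (by simpa using hx)]
  simp

theorem IsTestFunction.lineInt_neg_one_eq_zero (h : IsTestFunction φ) {x : ℝ} (hx : 1 ≤ x) :
    lineInt β (-1) φ x = 0 := by
  rw [← h.rightInt_eq, rightInt, Ioo_eq_empty (by simpa using hx)]
  simp

theorem lineInt_add (hβ : 0 < β) {σ : ℝ} (hσ : σ = 1 ∨ σ = -1) (h : IsTestFunction φ)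
    (h' : IsTestFunction ψ) : lineInt β σ (φ + ψ) = lineInt β σ φ + lineInt β σ ψ := by
  ext x
  simp only [lineInt, Pi.add_apply, mul_add]
  rw [integral_add (h.integrableOn_rpow_mul hβ hσ x) (h'.integrableOn_rpow_mul hβ hσ x), mul_add]

theorem lineInt_smul (σ c : ℝ) : lineInt β σ (c • φ) = c • lineInt β σ φ := by
  ext x
  simp only [lineInt, Pi.smul_apply, smul_eq_mul]
  rw [← mul_assoc, mul_comm c, mul_assoc, ← integral_const_mul c]
  congr 2
  ext y
  ring

/-- The fundamental theorem of calculus for fractional integrals of test functions. -/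
theorem IsTestFunction.lineInt_sub_eq (h : IsTestFunction φ) (hβ : 0 < β) {σ : ℝ}
    (hσ : σ = 1 ∨ σ = -1) {x : ℝ} (hx0 : 0 ≤ x) (hx1 : x ≤ 1) :
    lineInt β σ φ x - lineInt β σ φ 0 = ∫ t in (0 : ℝ)..x, lineInt β σ (_root_.deriv φ) t := by
  obtain ⟨C, hC⟩ := h.deriv.bounded
  have hC0 : 0 ≤ C := (abs_nonneg _).trans (hC 0)
  have hd := h.deriv.continuous
  -- For $t\in(0,x]$ and $y>1$ the point $t-\sigma y$ lies outside $(0,1)$, so the integrand is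
  -- dominated by $Cy^{\beta-1}$ on $y\le1$.
  have hF : Integrable (Function.uncurry fun t y : ℝ => y ^ (β - 1) * _root_.deriv φ (t - σ * y))
      ((volume.restrict (Ioc 0 x)).prod (volume.restrict (Ioi 0))) := by
    have h1 : Integrable ((Ioc (0 : ℝ) 1).indicator fun y => y ^ (β - 1))
        (volume.restrict (Ioi 0)) := by
      refine Integrable.integrableOn ((integrable_indicator_iff measurableSet_Ioc).2 ?_)
      have := intervalIntegral.intervalIntegrable_rpow' (r := β - 1) (by linarith) (a := 0) (b := 1)
      rwa [intervalIntegrable_iff_integrableOn_Ioc_of_le zero_le_one] at this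
    have h2 := Integrable.mul_prod (integrable_const C : Integrable (fun _ : ℝ => C)
      (volume.restrict (Ioc 0 x))) h1
    refine h2.mono' (Measurable.aestronglyMeasurable (by fun_prop)) ?_
    have h3 : ∀ᵐ z : ℝ × ℝ ∂((volume.restrict (Ioc 0 x)).prod (volume.restrict (Ioi 0))),
        z ∈ Ioc 0 x ×ˢ Ioi 0 := by
      rw [Measure.prod_restrict]
      exact ae_restrict_mem (measurableSet_Ioc.prod measurableSet_Ioi)
    filter_upwards [h3] with z hz
    obtain ⟨⟨hz1, hz2⟩, hz3⟩ := hz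
    have hz3 : 0 < z.2 := hz3
    simp only [Function.uncurry, norm_mul]
    by_cases hz4 : z.2 ≤ 1
    · rw [indicator_of_mem (show z.2 ∈ Ioc (0 : ℝ) 1 from ⟨hz3, hz4⟩),
        Real.norm_of_nonneg (Real.rpow_nonneg hz3.le _), mul_comm]
      exact mul_le_mul_of_nonneg_right (hC _) (Real.rpow_nonneg hz3.le _)
    · rw [indicator_of_notMem fun hx => hz4 hx.2, h.deriv.eq_zero, norm_zero, mul_zero, mul_zero]
      rintro ⟨h4, h5⟩
      rcases hσ with rfl | rfl <;> linarith
  simp only [lineInt]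
  rw [intervalIntegral.integral_const_mul, intervalIntegral.integral_of_le hx0,
    integral_integral_swap hF, ← mul_sub, ← integral_sub (h.integrableOn_rpow_mul hβ hσ x)
    (h.integrableOn_rpow_mul hβ hσ 0)]
  congr 1
  refine integral_congr_ae (Eventually.of_forall fun y => ?_)
  simp only
  rw [integral_const_mul, ← intervalIntegral.integral_of_le hx0, ← mul_sub,
    intervalIntegral.integral_comp_sub_right (_root_.deriv φ), h.integral_eq_sub]

end PointwiseFormulas

/-! ### The fractional seminorm and its Poincaré inequality. -/

section Estimates

variable {φ ψ : ℝ → ℝ} {μ : ℝ}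

theorem realFourier_add (h : IsTestFunction φ) (h' : IsTestFunction ψ) :
    realFourier (φ + ψ) = realFourier φ + realFourier ψ := by
  have h1 : (h.add h').toSchwartz = h.toSchwartz + h'.toSchwartz := by
    ext x
    exact Complex.ofReal_add _ _
  rw [(h.add h').realFourier_eq, h.realFourier_eq, h'.realFourier_eq, h1,
    FourierTransform.fourier_add]
  rfl

theorem realFourier_smul (h : IsTestFunction φ) (c : ℝ) :
    realFourier (c • φ) = c • realFourier φ := by
  have h1 : (h.const_smul c).toSchwartz = (c : ℂ) • h.toSchwartz := by
    ext x
    exact Complex.ofReal_mul _ _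
  rw [(h.const_smul c).realFourier_eq, h.realFourier_eq, h1, FourierTransform.fourier_smul]
  ext ξ
  simp

/-- The weighted Fourier transform `|ω|^μ φ̂`. -/
noncomputable def weightedFourier (μ : ℝ) (φ : ℝ → ℝ) (ξ : ℝ) : ℂ :=
  (((2 * Real.pi * |ξ|) ^ μ : ℝ) : ℂ) * realFourier φ ξ

theorem norm_weightedFourier (ξ : ℝ) :
    ‖weightedFourier μ φ ξ‖ = (2 * Real.pi * |ξ|) ^ μ * ‖realFourier φ ξ‖ := by
  rw [weightedFourier, norm_mul, Complex.norm_real, Real.norm_of_nonneg (by positivity)]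

theorem IsTestFunction.memLp_weightedFourier (h : IsTestFunction φ) (h0 : 0 ≤ μ) (h1 : μ ≤ 1) :
    MemLp (weightedFourier μ φ) 2 := by
  have hc := h.continuous_realFourier
  refine ((h.memLp_realFourier 2).norm.add (h.deriv.memLp_realFourier 2).norm).mono'
    (Measurable.aestronglyMeasurable (by unfold weightedFourier; fun_prop))
    (Eventually.of_forall fun ξ => ?_)
  rw [norm_weightedFourier, Pi.add_apply, h.realFourier_deriv]
  have h2 : (2 * Real.pi * |ξ|) ^ μ ≤ 1 + 2 * Real.pi * |ξ| := by
    rcases le_total (2 * Real.pi * |ξ|) 1 with h3 | h3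
    · exact (Real.rpow_le_one (by positivity) h3 h0).trans (by linarith [show 0 ≤ 2 * Real.pi * |ξ| by positivity])
    · exact (Real.rpow_le_rpow_of_exponent_le h3 h1).trans (by rw [Real.rpow_one]; linarith)
  have h3 : ‖((2 * Real.pi * ξ : ℝ) : ℂ) * Complex.I * realFourier φ ξ‖ =
      2 * Real.pi * |ξ| * ‖realFourier φ ξ‖ := by
    rw [norm_mul, norm_mul, Complex.norm_I, mul_one, Complex.norm_real, norm_mul, norm_mul,
      Real.norm_of_nonneg Real.pi_nonneg]
    simp
  rw [h3]
  nlinarith [norm_nonneg (realFourier φ ξ)]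

theorem IsTestFunction.integral_norm_realFourier_sq (h : IsTestFunction φ) :
    ∫ ξ, ‖realFourier φ ξ‖ ^ 2 = ∫ x, φ x ^ 2 := by
  have h1 := SchwartzMap.integral_norm_sq_fourier h.toSchwartz
  rw [h.realFourier_eq, h1]
  refine integral_congr_ae (Eventually.of_forall fun x => ?_)
  change ‖(φ x : ℂ)‖ ^ 2 = _
  rw [Complex.norm_real, Real.norm_eq_abs, sq_abs]

theorem IsTestFunction.integrable_norm_realFourier_sq (h : IsTestFunction φ) :
    Integrable fun ξ => ‖realFourier φ ξ‖ ^ 2 :=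
  (memLp_two_iff_integrable_sq_norm h.continuous_realFourier.aestronglyMeasurable).1
    (h.memLp_realFourier 2)

theorem IsTestFunction.integrable_norm_weightedFourier_sq (h : IsTestFunction φ) (h0 : 0 ≤ μ)
    (h1 : μ ≤ 1) : Integrable fun ξ => ‖weightedFourier μ φ ξ‖ ^ 2 :=
  (memLp_two_iff_integrable_sq_norm (h.memLp_weightedFourier h0 h1).1).1
    (h.memLp_weightedFourier h0 h1)

theorem IsTestFunction.integral_abs_sq_le (h : IsTestFunction φ) :
    (∫ x, |φ x| ∂vol01) ^ 2 ≤ ∫ x, φ x ^ 2 := by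
  have h1 := integral_abs_le_norm_toLp (h.memLp_vol01 2)
  have h2 : ‖(h.memLp_vol01 2).toLp φ‖ ^ 2 = ∫ x, φ x ^ 2 := by
    rw [← real_inner_self_eq_norm_sq, inner_toLp_toLp, vol01,
      setIntegral_eq_integral_of_forall_compl_eq_zero fun x hx => by rw [h.eq_zero hx, mul_zero]]
    simp only [sq]
  rw [← h2]
  exact pow_le_pow_left₀ (integral_nonneg fun _ => abs_nonneg _) h1 2

/-- The Poincaré inequality for the fractional seminorm. -/
theorem IsTestFunction.integral_sq_le (h : IsTestFunction φ) (h0 : 0 ≤ μ) (h1 : μ ≤ 1) :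
    ∫ x, φ x ^ 2 ≤ 2 * ∫ ξ, ‖weightedFourier μ φ ξ‖ ^ 2 := by
  set N := ∫ x, φ x ^ 2
  -- On $|\xi|\le1/4$ the transform is bounded by the $L^1$ norm, hence by the $L^2$ norm; this
  -- interval has length $1/2$, so it contributes at most $N/2$, which is absorbed. Outside it
  -- $2\pi|\xi|\ge1$ and the weight only helps.
  have hpt : ∀ ξ, ‖realFourier φ ξ‖ ^ 2 ≤
      (Icc (-(1 / 4) : ℝ) (1 / 4)).indicator (fun _ => N) ξ + ‖weightedFourier μ φ ξ‖ ^ 2 := by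
    intro ξ
    by_cases hξ : ξ ∈ Icc (-(1 / 4) : ℝ) (1 / 4)
    · rw [indicator_of_mem hξ]
      have h2 := pow_le_pow_left₀ (norm_nonneg _) (h.norm_realFourier_le ξ) 2
      have h3 := h.integral_abs_sq_le
      have h4 : 0 ≤ ‖weightedFourier μ φ ξ‖ ^ 2 := by positivity
      linarith
    · rw [indicator_of_notMem hξ, zero_add, norm_weightedFourier]
      refine pow_le_pow_left₀ (norm_nonneg _) (le_mul_of_one_le_left (norm_nonneg _)
        (Real.one_le_rpow ?_ h0)) 2
      have : 1 / 4 < |ξ| := by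
        by_contra hc
        exact hξ (abs_le.1 (not_lt.1 hc))
      nlinarith [Real.pi_gt_three]
  have h2 := integral_mono h.integrable_norm_realFourier_sq
    (((integrable_indicator_iff measurableSet_Icc).2 (integrableOn_const (by simp))).add
      (h.integrable_norm_weightedFourier_sq h0 h1)) hpt
  simp only [Pi.add_apply] at h2
  rw [integral_add ((integrable_indicator_iff measurableSet_Icc).2 (integrableOn_const (by simp)))
    (h.integrable_norm_weightedFourier_sq h0 h1), integral_indicator measurableSet_Icc,
    h.integral_norm_realFourier_sq] at h2
  simp only [integral_const, MeasurableSet.univ, measureReal_restrict_apply, univ_inter,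
    Real.volume_real_Icc, smul_eq_mul] at h2
  norm_num at h2
  linarith

end Estimates

end FracDiff

/-! ### The space $H_0^\mu(0,1)$ and its embedding in $L^\infty$. -/

namespace FracDiff

open Filter

section SupBound

variable {φ : ℝ → ℝ} {μ : ℝ}

theorem one_add_rpow_sq_le {t : ℝ} (ht : 0 ≤ t) (h0 : 0 ≤ μ) (h1 : μ ≤ 1) :
    ((1 + t) ^ μ) ^ 2 ≤ 4 * (1 + ((2 * Real.pi * t) ^ μ) ^ 2) := by
  have hs : 0 ≤ (2 * Real.pi * t) ^ μ := by positivity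
  have hπ := Real.pi_gt_three
  have h2 : (2 : ℝ) ^ μ ≤ 2 := by
    simpa using Real.rpow_le_rpow_of_exponent_le (one_le_two (α := ℝ)) h1
  have h3 : (1 + t) ^ μ ≤ 2 ∨ (1 + t) ^ μ ≤ 2 * (2 * Real.pi * t) ^ μ := by
    rcases le_total t 1 with h | h
    · exact Or.inl ((Real.rpow_le_rpow (by positivity) (by linarith) h0).trans h2)
    · refine Or.inr ((Real.rpow_le_rpow (by positivity) (show 1 + t ≤ 2 * t by linarith) h0).trans ?_)
      rw [Real.mul_rpow zero_le_two ht]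
      exact mul_le_mul h2 (Real.rpow_le_rpow ht (by nlinarith) h0) (by positivity) zero_le_two
  have h4 : 0 ≤ (1 + t) ^ μ := by positivity
  rcases h3 with h | h
  · nlinarith [sq_nonneg ((2 * Real.pi * t) ^ μ)]
  · nlinarith

/-- Inversion bounds $|\varphi|$ by $\int|\hat\varphi|$. Splitting the integrand with the weight
$(1+|\xi|)^{2\mu}$ by the arithmetic-geometric mean inequality leaves $(1+|\xi|)^{-2\mu}$,
integrable because $\mu>1/2$, and the squared norm. -/
theorem IsTestFunction.abs_le_of_norm_sq_le (h : IsTestFunction φ) (h0 : 1 / 2 < μ) (h1 : μ ≤ 1)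
    {N : ℝ} (hN : 0 < N) (hφ : (∫ x, φ x ^ 2) + ∫ ξ, ‖weightedFourier μ φ ξ‖ ^ 2 ≤ N ^ 2) (x : ℝ) :
    |φ x| ≤ ((∫ ξ : ℝ, (1 + ‖ξ‖) ^ (-(2 * μ))) + 4) / 2 * N := by
  have hi : Integrable fun ξ : ℝ => (1 + ‖ξ‖) ^ (-(2 * μ)) :=
    integrable_one_add_norm (by simpa using by linarith)
  have hi1 := h.integrable_norm_realFourier_sq
  have hi2 := h.integrable_norm_weightedFourier_sq (μ := μ) (by linarith) h1
  have e1 : |φ x| ≤ ∫ ξ, ‖realFourier φ ξ‖ := by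
    have e2 : ‖(φ x : ℂ)‖ = |φ x| := by rw [Complex.norm_real, Real.norm_eq_abs]
    rw [← e2, h.inversion]
    refine (norm_integral_le_integral_norm _).trans (le_of_eq ?_)
    refine integral_congr_ae (Eventually.of_forall fun ξ => ?_)
    simp only [norm_mul, Complex.norm_exp_ofReal_mul_I, one_mul]
  have hpt : ∀ ξ : ℝ, ‖realFourier φ ξ‖ ≤ N / 2 * (1 + ‖ξ‖) ^ (-(2 * μ)) +
      2 / N * (‖realFourier φ ξ‖ ^ 2 + ‖weightedFourier μ φ ξ‖ ^ 2) := by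
    intro ξ
    set a := (1 + ‖ξ‖) ^ μ with ha
    have ha0 : 0 < a := by positivity
    have e3 : (1 + ‖ξ‖) ^ (-(2 * μ)) = (a ^ 2)⁻¹ := by
      rw [Real.rpow_neg (by positivity), ha, mul_comm 2 μ, Real.rpow_mul (by positivity),
        Real.rpow_two]
    have e4 := one_add_rpow_sq_le (norm_nonneg ξ) (by linarith : 0 ≤ μ) h1
    rw [← ha] at e4
    rw [e3, norm_weightedFourier, ← Real.norm_eq_abs]
    set f := ‖realFourier φ ξ‖
    have hf : 0 ≤ f := norm_nonneg _
    have e5 : a ^ 2 * f ^ 2 ≤ 4 * (f ^ 2 + ((2 * Real.pi * ‖ξ‖) ^ μ * f) ^ 2) := by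
      nlinarith [mul_le_mul_of_nonneg_right e4 (sq_nonneg f)]
    have e6 : f ≤ N / 2 * (a ^ 2)⁻¹ + 1 / (2 * N) * (a ^ 2 * f ^ 2) := by
      have e7 : N / 2 * (a ^ 2)⁻¹ + 1 / (2 * N) * (a ^ 2 * f ^ 2) - f =
          (N / a - a * f) ^ 2 / (2 * N) := by
        field_simp
        ring
      have : 0 ≤ (N / a - a * f) ^ 2 / (2 * N) := by positivity
      linarith
    refine e6.trans (add_le_add le_rfl ?_)
    refine (mul_le_mul_of_nonneg_left e5 (by positivity)).trans (le_of_eq ?_)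
    field_simp
    ring
  have e8 := integral_mono h.integrable_realFourier.norm
    ((hi.const_mul (N / 2)).add ((hi1.add hi2).const_mul (2 / N))) hpt
  rw [integral_add' (hi.const_mul _) ((hi1.add hi2).const_mul _), integral_const_mul,
    integral_const_mul, integral_add' hi1 hi2, h.integral_norm_realFourier_sq] at e8
  refine e1.trans (e8.trans ?_)
  have e9 : 2 / N * ((∫ x, φ x ^ 2) + ∫ ξ, ‖weightedFourier μ φ ξ‖ ^ 2) ≤ 2 * N := by
    refine (mul_le_mul_of_nonneg_left hφ (by positivity)).trans (le_of_eq ?_)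
    field_simp
  nlinarith

end SupBound

section Space

variable {μ : ℝ}

/-- The real `L²` space over the line. -/
abbrev L2R : Type := Lp ℝ 2 (volume : Measure ℝ)

/-- The complex `L²` space over the line. -/
abbrev L2C : Type := Lp ℂ 2 (volume : Measure ℝ)

/-- The graph embedding of the test functions defining `H₀^μ(0,1)`. -/
noncomputable def testGraphFrac (h0 : 0 ≤ μ) (h1 : μ ≤ 1) :
    testSubmodule →ₗ[ℝ] WithLp 2 (L2R × L2C) :=
  (WithLp.linearEquiv 2 ℝ (L2R × L2C)).symm.toLinearMap ∘ₗ
    { toFun := fun φ => ((φ.2.memLp 2).toLp φ.1, (φ.2.memLp_weightedFourier h0 h1).toLp _)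
      map_add' := fun φ ψ => by
        refine Prod.ext (MemLp.toLp_add (φ.2.memLp 2) (ψ.2.memLp 2)) ?_
        refine Eq.trans ?_ (MemLp.toLp_add (φ.2.memLp_weightedFourier h0 h1)
          (ψ.2.memLp_weightedFourier h0 h1))
        refine MemLp.toLp_congr ((φ + ψ).2.memLp_weightedFourier h0 h1) _ (Eventually.of_forall fun ξ => ?_)
        simp only [weightedFourier, Pi.add_apply, Submodule.coe_add, realFourier_add φ.2 ψ.2,
          mul_add]
      map_smul' := fun c φ => by
        refine Prod.ext (MemLp.toLp_const_smul c (φ.2.memLp 2)) ?_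
        refine Eq.trans ?_ (MemLp.toLp_const_smul c (φ.2.memLp_weightedFourier h0 h1))
        refine MemLp.toLp_congr ((c • φ).2.memLp_weightedFourier h0 h1) _ (Eventually.of_forall fun ξ => ?_)
        simp only [weightedFourier, Pi.smul_apply, Submodule.coe_smul, realFourier_smul φ.2,
          mul_smul_comm] }

theorem H0_eq (h0 : 0 ≤ μ) (h1 : μ ≤ 1) :
    H0 μ = (LinearMap.range (testGraphFrac h0 h1)).topologicalClosure := by
  unfold H0
  congr 1
  refine le_antisymm (Submodule.span_le.2 ?_) ?_
  · rintro z ⟨φ, hφ, e1, e2⟩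
    refine ⟨⟨φ, hφ⟩, WithLp.ofLp_injective 2 (Prod.ext ?_ ?_)⟩
    · exact Lp.ext ((hφ.memLp 2).coeFn_toLp.trans e1.symm)
    · exact Lp.ext ((hφ.memLp_weightedFourier h0 h1).coeFn_toLp.trans e2.symm)
  · rintro _ ⟨φ, rfl⟩
    exact Submodule.subset_span ⟨φ.1, φ.2, (φ.2.memLp 2).coeFn_toLp,
      (φ.2.memLp_weightedFourier h0 h1).coeFn_toLp⟩

/-- The inclusion of the test functions in `H₀^μ(0,1)`. -/
noncomputable def testH0 (h0 : 0 ≤ μ) (h1 : μ ≤ 1) : testSubmodule →ₗ[ℝ] H0 μ :=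
  LinearMap.codRestrict (H0 μ) (testGraphFrac h0 h1) fun φ => by
    rw [H0_eq h0 h1]
    exact Submodule.le_topologicalClosure _ ⟨φ, rfl⟩

theorem denseRange_testH0 (h0 : 0 ≤ μ) (h1 : μ ≤ 1) : DenseRange (testH0 h0 h1) :=
  denseRange_codRestrict_closure _ _ (H0_eq h0 h1) _

instance : CompleteSpace (H0 μ) := by
  unfold H0
  infer_instance

/-- The embedding `H₀^μ(0,1) → L²(ℝ)`. -/
noncomputable def H0fst : H0 μ →L[ℝ] L2R := (WithLp.fstL 2 ℝ L2R L2C).comp (H0 μ).subtypeL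

/-- The map `u ↦ |ω|^μ û` on `H₀^μ(0,1)`. -/
noncomputable def H0snd : H0 μ →L[ℝ] L2C := (WithLp.sndL 2 ℝ L2R L2C).comp (H0 μ).subtypeL

theorem H0fn_eq (u : H0 μ) : H0fn u = H0fst u := rfl

theorem H0fst_testH0 (h0 : 0 ≤ μ) (h1 : μ ≤ 1) (φ : testSubmodule) :
    H0fst (testH0 h0 h1 φ) = (φ.2.memLp 2).toLp φ.1 := rfl

theorem H0snd_testH0 (h0 : 0 ≤ μ) (h1 : μ ≤ 1) (φ : testSubmodule) :
    H0snd (testH0 h0 h1 φ) = (φ.2.memLp_weightedFourier h0 h1).toLp _ := rfl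

theorem H0_norm_sq (u : H0 μ) : ‖u‖ ^ 2 = ‖H0fst u‖ ^ 2 + ‖H0snd u‖ ^ 2 :=
  WithLp.prod_norm_sq_eq_of_L2 u.1

theorem norm_H0snd_le (u : H0 μ) : ‖H0snd u‖ ≤ ‖u‖ := by
  have := H0_norm_sq u
  refine abs_le_of_sq_le_sq' (by nlinarith [norm_nonneg (H0fst u)]) (norm_nonneg _) |>.2

theorem norm_sq_toLp_volume {f : ℝ → ℝ} (hf : MemLp f 2) : ‖hf.toLp f‖ ^ 2 = ∫ x, f x ^ 2 := by
  rw [← real_inner_self_eq_norm_sq, L2.inner_def]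
  refine integral_congr_ae (hf.coeFn_toLp.mono fun x hx => ?_)
  simp only [hx, RCLike.inner_apply, conj_trivial, sq]

theorem norm_sq_toLp_complex {f : ℝ → ℂ} (hf : MemLp f 2) :
    ‖hf.toLp f‖ ^ 2 = ∫ x, ‖f x‖ ^ 2 := by
  rw [← real_inner_self_eq_norm_sq, L2.inner_def]
  refine integral_congr_ae (hf.coeFn_toLp.mono fun x hx => ?_)
  simp only [hx, real_inner_self_eq_norm_sq]

theorem norm_H0fst_sq_le (h0 : 0 ≤ μ) (h1 : μ ≤ 1) (u : H0 μ) :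
    ‖H0fst u‖ ^ 2 ≤ 2 * ‖H0snd u‖ ^ 2 := by
  refine (denseRange_testH0 h0 h1).induction_on u
    (isClosed_le (by fun_prop) (by fun_prop)) fun φ => ?_
  rw [H0fst_testH0, H0snd_testH0, norm_sq_toLp_volume, norm_sq_toLp_complex]
  exact φ.2.integral_sq_le h0 h1

theorem norm_H0_le (h0 : 0 ≤ μ) (h1 : μ ≤ 1) (u : H0 μ) : ‖u‖ ≤ 2 * ‖H0snd u‖ := by
  have e1 := H0_norm_sq u
  have e2 := norm_H0fst_sq_le h0 h1 u
  refine abs_le_of_sq_le_sq' ?_ (by positivity) |>.2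
  nlinarith [norm_nonneg (H0snd u)]

theorem exists_seq_testH0 (h0 : 0 ≤ μ) (h1 : μ ≤ 1) (u : H0 μ) :
    ∃ φ : ℕ → testSubmodule, Tendsto (fun n => testH0 h0 h1 (φ n)) atTop (nhds u) := by
  obtain ⟨x, hx, hx'⟩ := mem_closure_iff_seq_limit.1 (denseRange_testH0 h0 h1 u)
  choose φ hφ using hx
  exact ⟨φ, by simpa only [hφ] using hx'⟩

/-- Elements of `H₀^μ(0,1)`, `μ > 1/2`, are essentially bounded. -/
theorem exists_ae_bound_H0 (h0 : 1 / 2 < μ) (h1 : μ ≤ 1) :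
    ∃ C : ℝ, 0 ≤ C ∧ ∀ u : H0 μ, ∀ᵐ x, |H0fn u x| ≤ C * ‖u‖ := by
  have hμ : 0 ≤ μ := by linarith
  set C := ((∫ ξ : ℝ, (1 + ‖ξ‖) ^ (-(2 * μ))) + 4) / 2
  have hC : 0 ≤ C := by
    have : 0 ≤ ∫ ξ : ℝ, (1 + ‖ξ‖) ^ (-(2 * μ)) := integral_nonneg fun ξ => by positivity
    positivity
  have htest : ∀ (φ : testSubmodule) (x : ℝ), |φ.1 x| ≤ C * ‖testH0 hμ h1 φ‖ := by
    intro φ x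
    -- The supremum bound divides by $N$, while the norm may vanish; $\varepsilon/(C+1)$ is added
    -- and costs at most $\varepsilon$.
    refine le_of_forall_pos_le_add fun ε hε => ?_
    have e1 : 0 < ‖testH0 hμ h1 φ‖ + ε / (C + 1) := by positivity
    have e2 := φ.2.abs_le_of_norm_sq_le h0 h1 e1 (x := x) (by
      rw [← norm_sq_toLp_volume (φ.2.memLp 2),
        ← norm_sq_toLp_complex (φ.2.memLp_weightedFourier hμ h1)]
      refine (H0_norm_sq (testH0 hμ h1 φ)).symm.le.trans ?_
      exact pow_le_pow_left₀ (norm_nonneg _) (by linarith [show 0 < ε / (C + 1) by positivity]) 2)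
    change |φ.1 x| ≤ C * _ at e2
    refine e2.trans ?_
    rw [mul_add]
    have e3 : C * (ε / (C + 1)) ≤ ε := by
      rw [← mul_div_assoc, div_le_iff₀ (by positivity)]
      nlinarith
    linarith
  refine ⟨C, hC, fun u => ?_⟩
  obtain ⟨φ, hφ⟩ := exists_seq_testH0 hμ h1 u
  have e1 : Tendsto (fun n => H0fst (testH0 hμ h1 (φ n))) atTop (nhds (H0fst u)) :=
    (H0fst.continuous.tendsto u).comp hφ
  -- A subsequence converges almost everywhere, and the pointwise bound passes to the limit along
  -- it.
  obtain ⟨ns, hns, hae⟩ := (tendstoInMeasure_of_tendsto_Lp e1).exists_seq_tendsto_ae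
  have e2 : ∀ᵐ x, ∀ n, (H0fst (testH0 hμ h1 (φ n))) x = (φ n).1 x :=
    ae_all_iff.2 fun n => ((φ n).2.memLp 2).coeFn_toLp
  filter_upwards [hae, e2] with x hx hx2
  rw [H0fn_eq]
  refine le_of_tendsto_of_tendsto hx.abs
    (((continuous_norm.tendsto u).comp (hφ.comp hns.tendsto_atTop)).const_mul C)
    (Eventually.of_forall fun n => ?_)
  simp only [hx2]
  exact htest _ x

end Space

end FracDiff

/-! ### The operator $DI^\beta_\theta$ and its coercivity. -/

namespace FracDiff

open Filter

section FracDeriv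

variable {β : ℝ}

/-- Two derivatives contribute $|\omega|^2$ and the symbols $c|\omega|^{-2\beta}$, together
$c|\omega|^{2(1-\beta)}$. The constant is $1$ for equal sides and $\cos(\pi\beta)$ for opposite
sides. -/
theorem integral_lineInt_deriv (hβ : 0 < β) (hβ1 : β < 1 / 2) {σ τ : ℝ} (hσ : σ = 1 ∨ σ = -1)
    (hτ : τ = 1 ∨ τ = -1) {φ : ℝ → ℝ} (h : IsTestFunction φ) {c : ℝ}
    (hc : ∀ ξ ≠ 0, (starRingEnd ℂ (lineSymbol β σ ξ) * lineSymbol β τ ξ).re =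
      c * (2 * Real.pi * |ξ|) ^ (-(2 * β))) :
    ∫ x, lineInt β σ (deriv φ) x * lineInt β τ (deriv φ) x =
      c * ∫ ξ, ‖weightedFourier (1 - β) φ ξ‖ ^ 2 := by
  rw [integral_lineInt_mul hβ hβ1 hσ hτ h.deriv, ← integral_const_mul]
  refine integral_congr_ae ?_
  filter_upwards [Measure.ae_ne volume 0] with ξ hξ
  have hpos : 0 < 2 * Real.pi * |ξ| := by have := abs_pos.2 hξ; positivity
  have e1 : ‖((2 * Real.pi * ξ : ℝ) : ℂ) * Complex.I * realFourier φ ξ‖ =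
      2 * Real.pi * |ξ| * ‖realFourier φ ξ‖ := by
    rw [norm_mul, norm_mul, Complex.norm_I, mul_one, Complex.norm_real, norm_mul, norm_mul,
      Real.norm_of_nonneg Real.pi_nonneg]
    simp
  rw [hc ξ hξ, h.realFourier_deriv, e1, norm_weightedFourier]
  have e2 : (2 * Real.pi * |ξ|) ^ (1 - β) =
      2 * Real.pi * |ξ| * (2 * Real.pi * |ξ|) ^ (-β) := by
    rw [sub_eq_add_neg, Real.rpow_add hpos, Real.rpow_one]
  have e3 : (2 * Real.pi * |ξ|) ^ (-(2 * β)) = (2 * Real.pi * |ξ|) ^ (-β) * (2 * Real.pi * |ξ|) ^ (-β) := by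
    rw [← Real.rpow_add hpos]; congr 1; ring
  rw [e2, e3]
  ring

/-- The derivative of the one-sided fractional integral of a test function, as an element of
`L²(0,1)`. -/
noncomputable def fracTest (hβ : 0 < β) (hβ1 : β < 1 / 2) {σ : ℝ} (hσ : σ = 1 ∨ σ = -1) :
    testSubmodule →ₗ[ℝ] L2I where
  toFun φ := ((memLp_lineInt hβ hβ1 hσ φ.2.deriv).restrict _).toLp _
  map_add' φ ψ := by
    refine Eq.trans ?_ (MemLp.toLp_add ((memLp_lineInt hβ hβ1 hσ φ.2.deriv).restrict _)
      ((memLp_lineInt hβ hβ1 hσ ψ.2.deriv).restrict _))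
    refine MemLp.toLp_congr ((memLp_lineInt hβ hβ1 hσ (φ + ψ).2.deriv).restrict _) _
      (Eventually.of_forall fun x => ?_)
    rw [← lineInt_add hβ hσ φ.2.deriv ψ.2.deriv, ← deriv_add_test φ.2 ψ.2]
    rfl
  map_smul' c φ := by
    refine Eq.trans ?_ (MemLp.toLp_const_smul c
      ((memLp_lineInt hβ hβ1 hσ φ.2.deriv).restrict (Ioo 0 1)))
    refine MemLp.toLp_congr ((memLp_lineInt hβ hβ1 hσ (c • φ).2.deriv).restrict _) _
      (Eventually.of_forall fun x => ?_)
    rw [← lineInt_smul σ c, ← deriv_smul_test φ.2 c]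
    rfl

theorem coeFn_fracTest (hβ : 0 < β) (hβ1 : β < 1 / 2) {σ : ℝ} (hσ : σ = 1 ∨ σ = -1)
    (φ : testSubmodule) : fracTest hβ hβ1 hσ φ =ᵐ[vol01] lineInt β σ (deriv φ.1) :=
  ((memLp_lineInt hβ hβ1 hσ φ.2.deriv).restrict (Ioo 0 1)).coeFn_toLp

theorem inner_fracTest (hβ : 0 < β) (hβ1 : β < 1 / 2) {σ τ : ℝ} (hσ : σ = 1 ∨ σ = -1)
    (hτ : τ = 1 ∨ τ = -1) (φ : testSubmodule) :
    inner ℝ (fracTest hβ hβ1 hσ φ) (fracTest hβ hβ1 hτ φ) =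
      ∫ x, lineInt β σ (deriv φ.1) x * lineInt β τ (deriv φ.1) x ∂vol01 :=
  inner_toLp_toLp ((memLp_lineInt hβ hβ1 hσ φ.2.deriv).restrict _)
    ((memLp_lineInt hβ hβ1 hτ φ.2.deriv).restrict _)

/-- On the whole line this is an equality; restricting to $(0,1)$ can only lose mass. -/
theorem norm_fracTest_le (hβ : 0 < β) (hβ1 : β < 1 / 2) {σ : ℝ} (hσ : σ = 1 ∨ σ = -1)
    (h0 : 0 ≤ 1 - β) (h1 : 1 - β ≤ 1) (φ : testSubmodule) :
    ‖fracTest hβ hβ1 hσ φ‖ ≤ ‖H0snd (testH0 h0 h1 φ)‖ := by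
  have e1 := integral_lineInt_deriv hβ hβ1 hσ hσ φ.2 (c := 1) fun ξ _ => by
    rw [conj_lineSymbol_mul_self hσ, one_mul]
  have hm := memLp_lineInt hβ hβ1 hσ φ.2.deriv
  refine abs_le_of_sq_le_sq' ?_ (norm_nonneg _) |>.2
  rw [← real_inner_self_eq_norm_sq, inner_fracTest, H0snd_testH0, norm_sq_toLp_complex,
    ← one_mul (∫ ξ, _), ← e1, vol01]
  exact setIntegral_le_integral (hm.integrable_mul hm)
    (Eventually.of_forall fun x => mul_self_nonneg _)

/-- To the left of the interval the left integral vanishes and to the right the right one does. The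
product lives on $(0,1)$, so the Parseval identity on the line holds there without loss. -/
theorem inner_fracTest_left_right (hβ : 0 < β) (hβ1 : β < 1 / 2) (h0 : 0 ≤ 1 - β) (h1 : 1 - β ≤ 1)
    (φ : testSubmodule) :
    inner ℝ (fracTest hβ hβ1 (Or.inl rfl) φ) (fracTest hβ hβ1 (Or.inr rfl) φ) =
      Real.cos (Real.pi * β) * ‖H0snd (testH0 h0 h1 φ)‖ ^ 2 := by
  rw [inner_fracTest, H0snd_testH0, norm_sq_toLp_complex,
    ← integral_lineInt_deriv hβ hβ1 (Or.inl rfl) (Or.inr rfl) φ.2 fun ξ => conj_lineSymbol_mul_neg,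
    vol01, setIntegral_eq_integral_of_forall_compl_eq_zero fun x hx => ?_]
  by_cases hx0 : x ≤ 0
  · rw [φ.2.deriv.lineInt_one_eq_zero hx0, zero_mul]
  · rw [φ.2.deriv.lineInt_neg_one_eq_zero (not_lt.1 fun h => hx ⟨not_le.1 hx0, h⟩), mul_zero]

theorem one_sub_nonneg (hβ1 : β < 1 / 2) : 0 ≤ 1 - β := by linarith

theorem one_sub_le_one (hβ : 0 < β) : 1 - β ≤ 1 := by linarith

/-- The derivative `D I^β` of the one-sided fractional integrals on `H₀^{1-β}(0,1)`. -/
noncomputable def fracDeriv (hβ : 0 < β) (hβ1 : β < 1 / 2) {σ : ℝ} (hσ : σ = 1 ∨ σ = -1) :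
    H0 (1 - β) →L[ℝ] L2I :=
  (fracTest hβ hβ1 hσ).extendOfNorm (testH0 (one_sub_nonneg hβ1) (one_sub_le_one hβ))

theorem cos_pi_mul_pos (hβ : 0 < β) (hβ1 : β < 1 / 2) : 0 < Real.cos (Real.pi * β) := by
  refine Real.cos_pos_of_mem_Ioo ⟨?_, ?_⟩ <;> nlinarith [Real.pi_pos]

variable (hβ : 0 < β) (hβ1 : β < 1 / 2)

theorem fracDeriv_testH0 {σ : ℝ} (hσ : σ = 1 ∨ σ = -1) (φ : testSubmodule) :
    fracDeriv hβ hβ1 hσ (testH0 (one_sub_nonneg hβ1) (one_sub_le_one hβ) φ) =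
      fracTest hβ hβ1 hσ φ := by
  refine LinearMap.extendOfNorm_eq (denseRange_testH0 _ _) ⟨1, fun φ => ?_⟩ φ
  rw [one_mul]
  exact (norm_fracTest_le hβ hβ1 hσ _ _ φ).trans (norm_H0snd_le _)

theorem norm_fracDeriv_le {σ : ℝ} (hσ : σ = 1 ∨ σ = -1) (u : H0 (1 - β)) :
    ‖fracDeriv hβ hβ1 hσ u‖ ≤ ‖H0snd u‖ := by
  refine (denseRange_testH0 (one_sub_nonneg hβ1) (one_sub_le_one hβ)).induction_on u
    (isClosed_le (by fun_prop) (by fun_prop)) fun φ => ?_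
  rw [fracDeriv_testH0]
  exact norm_fracTest_le hβ hβ1 hσ _ _ φ

theorem inner_fracDeriv_left_right (u : H0 (1 - β)) :
    inner ℝ (fracDeriv hβ hβ1 (Or.inl rfl) u) (fracDeriv hβ hβ1 (Or.inr rfl) u) =
      Real.cos (Real.pi * β) * ‖H0snd u‖ ^ 2 := by
  refine (denseRange_testH0 (one_sub_nonneg hβ1) (one_sub_le_one hβ)).induction_on u
    (isClosed_eq (by fun_prop) (by fun_prop)) fun φ => ?_
  rw [fracDeriv_testH0, fracDeriv_testH0]
  exact inner_fracTest_left_right hβ hβ1 _ _ φ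

/-- The operator `D I^β_θ` on `H₀^{1-β}(0,1)`. -/
noncomputable def twoSidedDeriv (θ : ℝ) : H0 (1 - β) →L[ℝ] L2I :=
  θ • fracDeriv hβ hβ1 (Or.inl rfl) + (1 - θ) • fracDeriv hβ hβ1 (Or.inr rfl)

theorem twoSidedDeriv_apply (θ : ℝ) (u : H0 (1 - β)) :
    twoSidedDeriv hβ hβ1 θ u =
      θ • fracDeriv hβ hβ1 (Or.inl rfl) u + (1 - θ) • fracDeriv hβ hβ1 (Or.inr rfl) u := rfl

theorem norm_twoSidedDeriv_le {θ : ℝ} (h0 : 0 ≤ θ) (h1 : θ ≤ 1) (u : H0 (1 - β)) :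
    ‖twoSidedDeriv hβ hβ1 θ u‖ ≤ ‖u‖ := by
  rw [twoSidedDeriv_apply]
  refine (norm_add_le _ _).trans ?_
  rw [norm_smul, norm_smul, Real.norm_of_nonneg h0, Real.norm_of_nonneg (sub_nonneg.2 h1)]
  have e1 := (norm_fracDeriv_le hβ hβ1 (Or.inl rfl) u).trans (norm_H0snd_le u)
  have e2 := (norm_fracDeriv_le hβ hβ1 (Or.inr rfl) u).trans (norm_H0snd_le u)
  nlinarith

/-- Cauchy-Schwarz in `inner_fracDeriv_left_right`, with the right derivative bounded by the
seminorm. -/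
theorem cos_mul_le_norm_fracDeriv_left (u : H0 (1 - β)) :
    Real.cos (Real.pi * β) * ‖H0snd u‖ ≤ ‖fracDeriv hβ hβ1 (Or.inl rfl) u‖ := by
  have e1 := inner_fracDeriv_left_right hβ hβ1 u
  have e2 := real_inner_le_norm (fracDeriv hβ hβ1 (Or.inl rfl) u) (fracDeriv hβ hβ1 (Or.inr rfl) u)
  have e3 := norm_fracDeriv_le hβ hβ1 (Or.inr rfl) u
  rcases (norm_nonneg (H0snd u)).eq_or_lt with h | h
  · rw [← h, mul_zero]; exact norm_nonneg _
  · refine le_of_mul_le_mul_right ?_ h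
    nlinarith [norm_nonneg (fracDeriv hβ hβ1 (Or.inl rfl) u)]

/-- Coercivity of `D I^β_θ` tested with the left fractional derivative. -/
theorem inner_twoSidedDeriv_left_ge {θ : ℝ} (h0 : 0 ≤ θ) (h1 : θ ≤ 1) (u : H0 (1 - β)) :
    Real.cos (Real.pi * β) ^ 2 * ‖H0snd u‖ ^ 2 ≤
      inner ℝ (twoSidedDeriv hβ hβ1 θ u) (fracDeriv hβ hβ1 (Or.inl rfl) u) := by
  have hc := cos_pi_mul_pos hβ hβ1
  have hc1 := Real.cos_le_one (Real.pi * β)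
  have e1 := cos_mul_le_norm_fracDeriv_left hβ hβ1 u
  have e2 := inner_fracDeriv_left_right hβ hβ1 u
  rw [twoSidedDeriv_apply, inner_add_left, real_inner_smul_left, real_inner_smul_left,
    real_inner_self_eq_norm_sq, real_inner_comm, e2]
  set c := Real.cos (Real.pi * β)
  set s := ‖H0snd u‖
  have hs : 0 ≤ s := norm_nonneg _
  have e3 : c ^ 2 * s ^ 2 ≤ ‖fracDeriv hβ hβ1 (Or.inl rfl) u‖ ^ 2 := by
    rw [← mul_pow]; exact pow_le_pow_left₀ (by positivity) e1 2
  -- Both ends of the convex combination in $\theta$, $\|Lu\|^2\ge c^2s^2$ and $(Ru,Lu)=cs^2$, are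
  -- thus at least $c^2s^2$. The bound is uniform in $\theta$.
  have e4 : c ^ 2 * s ^ 2 ≤ c * s ^ 2 :=
    mul_le_mul_of_nonneg_right (by nlinarith) (by positivity)
  nlinarith [mul_le_mul_of_nonneg_left e3 h0, mul_le_mul_of_nonneg_left e4 (sub_nonneg.2 h1)]

/-- Cauchy-Schwarz in the coercivity estimate cancels one seminorm; the factor $1/2$ comes from
`norm_H0_le`. -/
theorem twoSidedDeriv_bounded_below {θ : ℝ} (h0 : 0 ≤ θ) (h1 : θ ≤ 1) (u : H0 (1 - β)) :
    Real.cos (Real.pi * β) ^ 2 / 2 * ‖u‖ ≤ ‖twoSidedDeriv hβ hβ1 θ u‖ := by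
  have e1 := inner_twoSidedDeriv_left_ge hβ hβ1 h0 h1 u
  have e2 := real_inner_le_norm (twoSidedDeriv hβ hβ1 θ u) (fracDeriv hβ hβ1 (Or.inl rfl) u)
  have e3 := norm_fracDeriv_le hβ hβ1 (Or.inl rfl) u
  have e4 := norm_H0_le (one_sub_nonneg hβ1) (one_sub_le_one hβ) u
  have hc := cos_pi_mul_pos hβ hβ1
  have e5 : Real.cos (Real.pi * β) ^ 2 * ‖H0snd u‖ ≤ ‖twoSidedDeriv hβ hβ1 θ u‖ := by
    rcases (norm_nonneg (H0snd u)).eq_or_lt with h | h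
    · rw [← h, mul_zero]; exact norm_nonneg _
    · refine le_of_mul_le_mul_right ?_ h
      nlinarith [norm_nonneg (twoSidedDeriv hβ hβ1 θ u)]
  nlinarith [sq_nonneg (Real.cos (Real.pi * β))]

end FracDeriv

end FracDiff

/-! ### Pointwise values of fractional integrals on $H_0^{1-\beta}(0,1)$. -/

namespace FracDiff

open Filter

section FractionalIntegrals

variable {β : ℝ}

theorem integrableOn_left_kernel (hβ : 0 < β) (x : ℝ) :
    IntegrableOn (fun s => 1 / (x - s) ^ (1 - β)) (Ioo 0 x) := by
  rcases le_or_gt x 0 with hx | hx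
  · rw [Ioo_eq_empty (not_lt.2 hx)]; exact integrableOn_empty
  have h := (intervalIntegral.intervalIntegrable_rpow' (r := β - 1) (by linarith) (a := 0)
    (b := x)).comp_sub_left x
  rw [sub_zero, sub_self] at h
  have h' := (intervalIntegrable_iff_integrableOn_Ioo_of_le hx.le).1 h.symm
  refine h'.congr_fun (fun s hs => ?_) measurableSet_Ioo
  have := rpow_sub_one_eq (β := β) (sub_nonneg.2 hs.2.le) 1
  simpa using this

theorem integrableOn_right_kernel (hβ : 0 < β) (x : ℝ) :
    IntegrableOn (fun s => 1 / (s - x) ^ (1 - β)) (Ioo x 1) := by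
  rcases le_or_gt 1 x with hx | hx
  · rw [Ioo_eq_empty (not_lt.2 hx)]; exact integrableOn_empty
  have h := (intervalIntegral.intervalIntegrable_rpow' (r := β - 1) (by linarith) (a := 0)
    (b := 1 - x)).comp_sub_right x
  rw [zero_add, sub_add_cancel] at h
  have h' := (intervalIntegrable_iff_integrableOn_Ioo_of_le hx.le).1 h
  refine h'.congr_fun (fun s hs => ?_) measurableSet_Ioo
  have := rpow_sub_one_eq (β := β) (sub_nonneg.2 hs.1.le) 1
  simpa using this

theorem integral_left_kernel_le (hβ : 0 < β) {x : ℝ} (h1 : x ≤ 1) :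
    ∫ s in Ioo 0 x, 1 / (x - s) ^ (1 - β) ≤ 1 / β := by
  rcases le_or_gt x 0 with hx | hx
  · rw [Ioo_eq_empty (not_lt.2 hx)]; simpa using hβ.le
  have e : ∫ s in Ioo 0 x, 1 / (x - s) ^ (1 - β) = ∫ s in (0 : ℝ)..x, (x - s) ^ (β - 1) := by
    rw [intervalIntegral.integral_of_le hx.le, integral_Ioc_eq_integral_Ioo]
    refine setIntegral_congr_fun measurableSet_Ioo fun s hs => ?_
    have := rpow_sub_one_eq (β := β) (sub_nonneg.2 hs.2.le) 1
    simpa using this.symm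
  rw [e, intervalIntegral.integral_comp_sub_left (fun y => y ^ (β - 1)), sub_zero, sub_self,
    integral_rpow (Or.inl (by linarith)), sub_add_cancel, Real.zero_rpow hβ.ne', sub_zero]
  exact div_le_div_of_nonneg_right (Real.rpow_le_one hx.le h1 hβ.le) hβ.le

theorem integral_right_kernel_le (hβ : 0 < β) {x : ℝ} (h0 : 0 ≤ x) :
    ∫ s in Ioo x 1, 1 / (s - x) ^ (1 - β) ≤ 1 / β := by
  rcases le_or_gt 1 x with hx | hx
  · rw [Ioo_eq_empty (not_lt.2 hx)]; simpa using hβ.le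
  have e : ∫ s in Ioo x 1, 1 / (s - x) ^ (1 - β) = ∫ s in x..1, (s - x) ^ (β - 1) := by
    rw [intervalIntegral.integral_of_le hx.le, integral_Ioc_eq_integral_Ioo]
    refine setIntegral_congr_fun measurableSet_Ioo fun s hs => ?_
    have := rpow_sub_one_eq (β := β) (sub_nonneg.2 hs.1.le) 1
    simpa using this.symm
  rw [e, intervalIntegral.integral_comp_sub_right (fun y => y ^ (β - 1)), sub_self,
    integral_rpow (Or.inl (by linarith)), sub_add_cancel, Real.zero_rpow hβ.ne', sub_zero]
  exact div_le_div_of_nonneg_right (Real.rpow_le_one (by linarith) (by linarith) hβ.le) hβ.le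

theorem abs_integral_kernel_sub_le {S : Set ℝ} (hS : MeasurableSet S) (hS1 : S ⊆ Ioo 0 1)
    {k w₁ w₂ : ℝ → ℝ} {B₁ B₂ δ I : ℝ} (hk : IntegrableOn (fun s => 1 / k s) S)
    (hk0 : ∀ s ∈ S, 0 ≤ k s) (hI : ∫ s in S, 1 / k s ≤ I)
    (hδ : 0 ≤ δ) (m₁ : AEStronglyMeasurable w₁ vol01) (m₂ : AEStronglyMeasurable w₂ vol01)
    (h₁ : ∀ᵐ s ∂vol01, |w₁ s| ≤ B₁) (h₂ : ∀ᵐ s ∂vol01, |w₂ s| ≤ B₂)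
    (h : ∀ᵐ s ∂vol01, |w₁ s - w₂ s| ≤ δ) :
    |(∫ s in S, w₁ s / k s) - ∫ s in S, w₂ s / k s| ≤ I * δ := by
  have hle : volume.restrict S ≤ vol01 := Measure.restrict_mono hS1 le_rfl
  have i₁ : IntegrableOn (fun s => w₁ s / k s) S := by
    have := Integrable.bdd_mul (c := B₁) hk (m₁.mono_measure hle) (ae_mono hle h₁)
    simp only [mul_one_div] at this
    exact this
  have i₂ : IntegrableOn (fun s => w₂ s / k s) S := by
    have := Integrable.bdd_mul (c := B₂) hk (m₂.mono_measure hle) (ae_mono hle h₂)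
    simp only [mul_one_div] at this
    exact this
  rw [← integral_sub i₁ i₂, ← Real.norm_eq_abs]
  refine (norm_integral_le_of_norm_le (hk.mul_const δ) ?_).trans ?_
  · filter_upwards [ae_mono hle h, ae_restrict_mem hS] with s h1 h2
    rw [← sub_div, Real.norm_eq_abs, abs_div, abs_of_nonneg (hk0 s h2), one_div_mul_eq_div]
    exact div_le_div_of_nonneg_right h1 (hk0 s h2)
  · rw [integral_mul_const]
    exact mul_le_mul_of_nonneg_right hI hδ

theorem abs_leftInt_sub_le (hβ : 0 < β) {x : ℝ} (hx1 : x ≤ 1) {w₁ w₂ : ℝ → ℝ} {B₁ B₂ δ : ℝ}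
    (hδ : 0 ≤ δ) (m₁ : AEStronglyMeasurable w₁ vol01) (m₂ : AEStronglyMeasurable w₂ vol01)
    (h₁ : ∀ᵐ s ∂vol01, |w₁ s| ≤ B₁) (h₂ : ∀ᵐ s ∂vol01, |w₂ s| ≤ B₂)
    (h : ∀ᵐ s ∂vol01, |w₁ s - w₂ s| ≤ δ) :
    |leftInt β w₁ x - leftInt β w₂ x| ≤ 1 / Real.Gamma β * (1 / β * δ) := by
  have hΓ := Real.Gamma_pos_of_pos hβ
  rw [leftInt, leftInt, ← mul_sub, abs_mul, abs_of_pos (by positivity : 0 < 1 / Real.Gamma β)]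
  refine mul_le_mul_of_nonneg_left ?_ (by positivity)
  exact abs_integral_kernel_sub_le measurableSet_Ioo (Ioo_subset_Ioo_right hx1)
    (integrableOn_left_kernel hβ x) (fun s hs => Real.rpow_nonneg (sub_nonneg.2 hs.2.le) _)
    (integral_left_kernel_le hβ hx1) hδ m₁ m₂ h₁ h₂ h

theorem abs_rightInt_sub_le (hβ : 0 < β) {x : ℝ} (hx0 : 0 ≤ x) {w₁ w₂ : ℝ → ℝ} {B₁ B₂ δ : ℝ}
    (hδ : 0 ≤ δ) (m₁ : AEStronglyMeasurable w₁ vol01) (m₂ : AEStronglyMeasurable w₂ vol01)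
    (h₁ : ∀ᵐ s ∂vol01, |w₁ s| ≤ B₁) (h₂ : ∀ᵐ s ∂vol01, |w₂ s| ≤ B₂)
    (h : ∀ᵐ s ∂vol01, |w₁ s - w₂ s| ≤ δ) :
    |rightInt β w₁ x - rightInt β w₂ x| ≤ 1 / Real.Gamma β * (1 / β * δ) := by
  have hΓ := Real.Gamma_pos_of_pos hβ
  rw [rightInt, rightInt, ← mul_sub, abs_mul, abs_of_pos (by positivity : 0 < 1 / Real.Gamma β)]
  refine mul_le_mul_of_nonneg_left ?_ (by positivity)
  exact abs_integral_kernel_sub_le measurableSet_Ioo (Ioo_subset_Ioo_left hx0)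
    (integrableOn_right_kernel hβ x) (fun s hs => Real.rpow_nonneg (sub_nonneg.2 hs.1.le) _)
    (integral_right_kernel_le hβ hx0) hδ m₁ m₂ h₁ h₂ h

theorem aestronglyMeasurable_H0fn {μ : ℝ} (u : H0 μ) : AEStronglyMeasurable (H0fn u) vol01 :=
  ((Lp.memLp (H0fst u)).1).mono_measure Measure.restrict_le_self

theorem H0fn_sub_ae {μ : ℝ} (u v : H0 μ) :
    H0fn (u - v) =ᵐ[volume] fun x => H0fn u x - H0fn v x := by
  simp only [H0fn_eq, map_sub]
  exact Lp.coeFn_sub _ _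

/-- Since $1-\beta>1/2$, elements are bounded by their norm, and the kernel has mass at most
$1/\beta$. So evaluation of the fractional integrals at a point is continuous in $u$, and pointwise
identities extend from test functions by density. -/
theorem exists_abs_fracInt_sub_le (hβ : 0 < β) (hβ1 : β < 1 / 2) : ∃ C : ℝ, 0 ≤ C ∧
    ∀ u v : H0 (1 - β), ∀ x ∈ Icc (0 : ℝ) 1,
      |leftInt β (H0fn u) x - leftInt β (H0fn v) x| ≤ C * ‖u - v‖ ∧
      |rightInt β (H0fn u) x - rightInt β (H0fn v) x| ≤ C * ‖u - v‖ := by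
  obtain ⟨C, hC, hb⟩ := exists_ae_bound_H0 (μ := 1 - β) (by linarith) (by linarith)
  have hΓ := Real.Gamma_pos_of_pos hβ
  refine ⟨1 / Real.Gamma β * (1 / β * C), by positivity, fun u v x hx => ?_⟩
  have hle : vol01 ≤ volume := Measure.restrict_le_self
  have e : ∀ᵐ s ∂vol01, |H0fn u s - H0fn v s| ≤ C * ‖u - v‖ := by
    filter_upwards [ae_mono hle (hb (u - v)), ae_mono hle (H0fn_sub_ae u v)] with s h1 h2
    rwa [← h2]
  have e' : 1 / Real.Gamma β * (1 / β * C) * ‖u - v‖ =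
      1 / Real.Gamma β * (1 / β * (C * ‖u - v‖)) := by ring
  rw [e']
  exact ⟨abs_leftInt_sub_le hβ hx.2 (by positivity) (aestronglyMeasurable_H0fn u)
      (aestronglyMeasurable_H0fn v) (ae_mono hle (hb u)) (ae_mono hle (hb v)) e,
    abs_rightInt_sub_le hβ hx.1 (by positivity) (aestronglyMeasurable_H0fn u)
      (aestronglyMeasurable_H0fn v) (ae_mono hle (hb u)) (ae_mono hle (hb v)) e⟩

theorem leftInt_congr {w₁ w₂ : ℝ → ℝ} (h : w₁ =ᵐ[volume] w₂) (x : ℝ) :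
    leftInt β w₁ x = leftInt β w₂ x := by
  refine congrArg _ (integral_congr_ae (ae_restrict_of_ae (h.mono fun s hs => ?_)))
  simp only [hs]

theorem rightInt_congr {w₁ w₂ : ℝ → ℝ} (h : w₁ =ᵐ[volume] w₂) (x : ℝ) :
    rightInt β w₁ x = rightInt β w₂ x := by
  refine congrArg _ (integral_congr_ae (ae_restrict_of_ae (h.mono fun s hs => ?_)))
  simp only [hs]

theorem prim_eq_setIntegral (f : ℝ → ℝ) {x : ℝ} (hx : x ∈ Icc (0 : ℝ) 1) :
    prim f x = ∫ t in Ioo 0 x, f t ∂vol01 := by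
  rw [prim, intervalIntegral.integral_of_le hx.1, integral_Ioc_eq_integral_Ioo, vol01,
    Measure.restrict_restrict measurableSet_Ioo,
    inter_eq_self_of_subset_left (Ioo_subset_Ioo_right hx.2)]

theorem prim_congr {f g : ℝ → ℝ} (h : f =ᵐ[vol01] g) {x : ℝ} (hx : x ∈ Icc (0 : ℝ) 1) :
    prim f x = prim g x := by
  rw [prim_eq_setIntegral f hx, prim_eq_setIntegral g hx]
  exact integral_congr_ae (ae_restrict_of_ae h)

theorem abs_prim_le {f : ℝ → ℝ} (hf : Integrable f vol01) {x : ℝ} (hx : x ∈ Icc (0 : ℝ) 1) :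
    |prim f x| ≤ ∫ t, |f t| ∂vol01 := by
  rw [prim_eq_setIntegral f hx]
  exact (norm_integral_le_integral_norm _).trans
    (setIntegral_le_integral hf.norm (Eventually.of_forall fun _ => norm_nonneg _))

theorem continuous_prim_L2I {x : ℝ} (hx : x ∈ Icc (0 : ℝ) 1) :
    Continuous fun f : L2I => prim f x := by
  have : LipschitzWith 1 fun f : L2I => prim f x := by
    refine LipschitzWith.of_dist_le_mul fun f g => ?_
    rw [Real.dist_eq, dist_eq_norm, NNReal.coe_one, one_mul]
    have hi : ∀ f : L2I, Integrable f vol01 := fun f => (Lp.memLp f).integrable one_le_two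
    have e : prim f x - prim g x = prim (f - g : L2I) x := by
      rw [prim_congr (Lp.coeFn_sub f g) hx, prim_eq_setIntegral _ hx, prim_eq_setIntegral _ hx,
        prim_eq_setIntegral _ hx]
      exact (integral_sub (hi f).integrableOn (hi g).integrableOn).symm
    rw [e]
    exact (abs_prim_le (hi _) hx).trans (integral_abs_le_norm _)
  exact this.continuous

variable (hβ : 0 < β) (hβ1 : β < 1 / 2)

theorem prim_fracTest {σ : ℝ} (hσ : σ = 1 ∨ σ = -1) (φ : testSubmodule) {x : ℝ}
    (hx : x ∈ Icc (0 : ℝ) 1) :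
    prim (fracTest hβ hβ1 hσ φ) x = lineInt β σ φ.1 x - lineInt β σ φ.1 0 := by
  rw [prim_congr (coeFn_fracTest hβ hβ1 hσ φ) hx, φ.2.lineInt_sub_eq hβ hσ hx.1 hx.2, prim]

theorem tendsto_of_abs_sub_le {C : ℝ} {E : Type*} [NormedAddCommGroup E] {F : E → ℝ}
    (h : ∀ u v, |F u - F v| ≤ C * ‖u - v‖) : Continuous F := by
  have : LipschitzWith (Real.toNNReal C) F := LipschitzWith.of_dist_le_mul fun u v => by
    rw [Real.dist_eq, dist_eq_norm]
    exact (h u v).trans (mul_le_mul_of_nonneg_right (Real.le_coe_toNNReal C) (norm_nonneg _))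
  exact this.continuous

theorem leftInt_H0fn_eq_prim (u : H0 (1 - β)) {x : ℝ} (hx : x ∈ Icc (0 : ℝ) 1) :
    leftInt β (H0fn u) x = prim (fracDeriv hβ hβ1 (Or.inl rfl) u) x := by
  obtain ⟨C, -, hC⟩ := exists_abs_fracInt_sub_le hβ hβ1
  refine (denseRange_testH0 (one_sub_nonneg hβ1) (one_sub_le_one hβ)).induction_on
    (p := fun u => leftInt β (H0fn u) x = prim (fracDeriv hβ hβ1 (Or.inl rfl) u) x) u
    (isClosed_eq (tendsto_of_abs_sub_le fun u v => (hC u v x hx).1)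
      ((continuous_prim_L2I hx).comp (fracDeriv hβ hβ1 (Or.inl rfl)).continuous)) fun φ => ?_
  rw [fracDeriv_testH0, prim_fracTest hβ hβ1 _ φ hx, φ.2.lineInt_one_eq_zero le_rfl, sub_zero,
    ← φ.2.leftInt_eq]
  exact leftInt_congr (φ.2.memLp 2).coeFn_toLp x

theorem rightInt_H0fn_sub_eq_prim (u : H0 (1 - β)) {x : ℝ} (hx : x ∈ Icc (0 : ℝ) 1) :
    rightInt β (H0fn u) x - rightInt β (H0fn u) 0 =
      prim (fracDeriv hβ hβ1 (Or.inr rfl) u) x := by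
  obtain ⟨C, -, hC⟩ := exists_abs_fracInt_sub_le hβ hβ1
  refine (denseRange_testH0 (one_sub_nonneg hβ1) (one_sub_le_one hβ)).induction_on
    (p := fun u => rightInt β (H0fn u) x - rightInt β (H0fn u) 0 =
      prim (fracDeriv hβ hβ1 (Or.inr rfl) u) x) u
    (isClosed_eq ((tendsto_of_abs_sub_le fun u v => (hC u v x hx).2).sub
      (tendsto_of_abs_sub_le fun u v => (hC u v 0 (by simp)).2))
      ((continuous_prim_L2I hx).comp (fracDeriv hβ hβ1 (Or.inr rfl)).continuous)) fun φ => ?_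
  rw [fracDeriv_testH0, prim_fracTest hβ hβ1 _ φ hx, ← φ.2.rightInt_eq, ← φ.2.rightInt_eq]
  have e := (φ.2.memLp 2).coeFn_toLp
  exact congrArg₂ (· - ·) (rightInt_congr e x) (rightInt_congr e 0)

theorem rightInt_one (w : ℝ → ℝ) : rightInt β w 1 = 0 := by simp [rightInt]

/-- At $0$ the left integral vanishes, so only the right one contributes an initial value.
Consequently `twoSidedDeriv` is the weak derivative occurring in `A`. -/
theorem twoSidedInt_H0fn_eq (θ : ℝ) (u : H0 (1 - β)) {x : ℝ} (hx : x ∈ Icc (0 : ℝ) 1) :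
    twoSidedInt β θ (H0fn u) x =
      (1 - θ) * rightInt β (H0fn u) 0 + prim (twoSidedDeriv hβ hβ1 θ u) x := by
  have e : prim (twoSidedDeriv hβ hβ1 θ u) x = θ * prim (fracDeriv hβ hβ1 (Or.inl rfl) u) x +
      (1 - θ) * prim (fracDeriv hβ hβ1 (Or.inr rfl) u) x := by
    have h1 : twoSidedDeriv hβ hβ1 θ u =ᵐ[vol01] fun t =>
        θ * fracDeriv hβ hβ1 (Or.inl rfl) u t + (1 - θ) * fracDeriv hβ hβ1 (Or.inr rfl) u t := by
      rw [twoSidedDeriv_apply]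
      filter_upwards [Lp.coeFn_add (θ • fracDeriv hβ hβ1 (Or.inl rfl) u)
        ((1 - θ) • fracDeriv hβ hβ1 (Or.inr rfl) u),
        Lp.coeFn_smul θ (fracDeriv hβ hβ1 (Or.inl rfl) u),
        Lp.coeFn_smul (1 - θ) (fracDeriv hβ hβ1 (Or.inr rfl) u)] with t h1 h2 h3
      rw [h1, Pi.add_apply, h2, h3]
      rfl
    have hi : ∀ f : L2I, IntegrableOn f (Ioo 0 x) vol01 := fun f =>
      ((Lp.memLp f).integrable one_le_two).integrableOn
    rw [prim_congr h1 hx, prim_eq_setIntegral _ hx, prim_eq_setIntegral _ hx,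
      prim_eq_setIntegral _ hx, integral_add ((hi _).const_mul _) ((hi _).const_mul _),
      integral_const_mul, integral_const_mul]
  rw [e, ← leftInt_H0fn_eq_prim hβ hβ1 u hx, ← rightInt_H0fn_sub_eq_prim hβ hβ1 u hx, twoSidedInt]
  ring

theorem twoSidedInt_H0fn_ae_eq (θ : ℝ) (u : H0 (1 - β)) :
    (fun x => (1 - θ) * rightInt β (H0fn u) 0 + prim (twoSidedDeriv hβ hβ1 θ u) x) =ᵐ[vol01]
      twoSidedInt β θ (H0fn u) :=
  ae_mem_Ioo.mono fun _ hx => (twoSidedInt_H0fn_eq hβ hβ1 θ u (Ioo_subset_Icc_self hx)).symm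

theorem hasWeakDeriv_twoSidedInt (θ : ℝ) (u : H0 (1 - β)) :
    HasWeakDeriv 1 (twoSidedInt β θ (H0fn u)) (twoSidedDeriv hβ hβ1 θ u) :=
  (hasWeakDeriv_prim_add ((Lp.memLp _).integrable one_le_two) _).congr
    (twoSidedInt_H0fn_ae_eq hβ hβ1 θ u) EventuallyEq.rfl

theorem weakDeriv_twoSidedInt (θ : ℝ) (u : H0 (1 - β)) :
    weakDeriv 1 (twoSidedInt β θ (H0fn u)) =ᵐ[vol01] twoSidedDeriv hβ hβ1 θ u :=
  (hasWeakDeriv_twoSidedInt hβ hβ1 θ u).weakDeriv_ae_eq (Lp.memLp _)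

theorem memLp_twoSidedInt (hβ : 0 < β) (hβ1 : β < 1 / 2) (θ : ℝ) (u : H0 (1 - β)) :
    MemLp (twoSidedInt β θ (H0fn u)) 2 vol01 :=
  (memLp_congr_ae (twoSidedInt_H0fn_ae_eq hβ hβ1 θ u)).1 (memLp_of_continuousOn
    (continuousOn_const.add (continuousOn_prim ((Lp.memLp _).integrable one_le_two))) 2)

theorem memH_one_twoSidedInt (hβ : 0 < β) (hβ1 : β < 1 / 2) (θ : ℝ) (u : H0 (1 - β)) :
    MemH 1 (twoSidedInt β θ (H0fn u)) := by
  have hm := memLp_twoSidedInt hβ hβ1 θ u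
  refine ⟨hm, fun k hk => ?_⟩
  rcases Nat.le_one_iff_eq_zero_or_eq_one.1 hk with rfl | rfl
  · exact ⟨_, hm, hasWeakDeriv_zero⟩
  · exact ⟨_, Lp.memLp _, hasWeakDeriv_twoSidedInt hβ hβ1 θ u⟩

theorem twoSidedInt_one (θ : ℝ) (w : ℝ → ℝ) : twoSidedInt β θ w 1 = θ * leftInt β w 1 := by
  rw [twoSidedInt, rightInt_one]; ring

end FractionalIntegrals

end FracDiff

/-! ### Adjointness of the one-sided fractional integrals. -/

namespace FracDiff

open Filter

section Kernel

variable {β σ : ℝ}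

/-- The kernel `t ↦ t₊ ^ (β - 1)` of the fractional integrals. -/
noncomputable def kern (β t : ℝ) : ℝ := (Ioi (0 : ℝ)).indicator (fun t => t ^ (β - 1)) t

theorem measurable_kern (β : ℝ) : Measurable (kern β) :=
  (by fun_prop : Measurable fun t : ℝ => t ^ (β - 1)).indicator measurableSet_Ioi

theorem kern_nonneg (β t : ℝ) : 0 ≤ kern β t :=
  indicator_nonneg (fun _ ht => Real.rpow_nonneg (le_of_lt ht) _) t

/-- The fractional integral to the left (`σ = 1`) or to the right (`σ = -1`) of a function on
`(0,1)`. -/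
noncomputable def kernInt (β σ : ℝ) (w : ℝ → ℝ) (x : ℝ) : ℝ :=
  1 / Real.Gamma β * ∫ s, kern β (σ * (x - s)) * w s ∂vol01

theorem setIntegral_left_eq (w : ℝ → ℝ) {x : ℝ} (hx : x ≤ 1) :
    ∫ s in Ioo 0 x, w s / (x - s) ^ (1 - β) = ∫ s, kern β (1 * (x - s)) * w s ∂vol01 := by
  rw [vol01, ← integral_indicator measurableSet_Ioo, ← integral_indicator measurableSet_Ioo]
  refine integral_congr_ae (Eventually.of_forall fun s => ?_)
  simp only [indicator_apply, mem_Ioo, kern, mem_Ioi, one_mul, sub_pos]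
  by_cases h0 : 0 < s
  · by_cases h1 : s < x
    · rw [if_pos ⟨h0, h1⟩, if_pos ⟨h0, h1.trans_le hx⟩, if_pos h1,
        rpow_sub_one_eq (sub_nonneg.2 h1.le)]
    · rw [if_neg fun h => h1 h.2, if_neg h1]; simp
  · rw [if_neg fun h => h0 h.1, if_neg fun h => h0 h.1]

theorem setIntegral_right_eq (w : ℝ → ℝ) {x : ℝ} (hx : 0 ≤ x) :
    ∫ s in Ioo x 1, w s / (s - x) ^ (1 - β) = ∫ s, kern β (-1 * (x - s)) * w s ∂vol01 := by
  rw [vol01, ← integral_indicator measurableSet_Ioo, ← integral_indicator measurableSet_Ioo]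
  refine integral_congr_ae (Eventually.of_forall fun s => ?_)
  simp only [indicator_apply, mem_Ioo, kern, mem_Ioi, neg_mul, one_mul, neg_sub, sub_pos]
  by_cases h0 : s < 1
  · by_cases h1 : x < s
    · rw [if_pos ⟨h1, h0⟩, if_pos ⟨hx.trans_lt h1, h0⟩, if_pos h1,
        rpow_sub_one_eq (sub_nonneg.2 h1.le)]
    · rw [if_neg fun h => h1 h.1, if_neg h1]; simp
  · rw [if_neg fun h => h0 h.2, if_neg fun h => h0 h.2]

theorem leftInt_eq_kernInt (w : ℝ → ℝ) {x : ℝ} (hx : x ≤ 1) :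
    leftInt β w x = kernInt β 1 w x := by
  rw [leftInt, kernInt, setIntegral_left_eq w hx]

theorem rightInt_eq_kernInt (w : ℝ → ℝ) {x : ℝ} (hx : 0 ≤ x) :
    rightInt β w x = kernInt β (-1) w x := by
  rw [rightInt, kernInt, setIntegral_right_eq w hx]

theorem IsTestFunction.lineInt_eq_kernInt {φ : ℝ → ℝ} (h : IsTestFunction φ)
    (hσ : σ = 1 ∨ σ = -1) {x : ℝ} (hx : x ∈ Icc (0 : ℝ) 1) :
    lineInt β σ φ x = kernInt β σ φ x := by
  rcases hσ with rfl | rfl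
  · rw [← h.leftInt_eq, leftInt_eq_kernInt _ hx.2]
  · rw [← h.rightInt_eq, rightInt_eq_kernInt _ hx.1]

theorem integrable_kern (hβ : 0 < β) (hσ : σ = 1 ∨ σ = -1) (x : ℝ) :
    Integrable (fun s => kern β (σ * (x - s))) vol01 := by
  have h1 : IntegrableOn (fun y : ℝ => y ^ (β - 1)) (Ioc 0 (|x| + 1)) := by
    have := intervalIntegral.intervalIntegrable_rpow' (r := β - 1) (by linarith) (a := 0)
      (b := |x| + 1)
    rwa [intervalIntegrable_iff_integrableOn_Ioc_of_le (by positivity)] at this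
  have h2 : Integrable (fun s => (Ioc 0 (|x| + 1)).indicator (fun y : ℝ => y ^ (β - 1))
      (σ * (x - s))) := by
    have h3 := (integrable_indicator_iff measurableSet_Ioc).2 h1
    rcases hσ with rfl | rfl
    · simpa using h3.comp_sub_left x
    · simpa using h3.comp_sub_right x
  refine (h2.integrableOn (s := Ioo 0 1)).congr_fun (fun s hs => ?_) measurableSet_Ioo
  simp only [kern, indicator_apply, mem_Ioc, mem_Ioi]
  have h3 : σ * (x - s) ≤ |x| + 1 := by
    have := abs_le.1 (le_refl |x|)
    rcases hσ with rfl | rfl <;> linarith [this.1, this.2, hs.1, hs.2]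
  by_cases h4 : 0 < σ * (x - s)
  · rw [if_pos ⟨h4, h3⟩, if_pos h4]
  · rw [if_neg fun h => h4 h.1, if_neg h4]

theorem integral_kern_le (hβ : 0 < β) (hσ : σ = 1 ∨ σ = -1) {x : ℝ} (hx : x ∈ Icc (0 : ℝ) 1) :
    ∫ s, kern β (σ * (x - s)) ∂vol01 ≤ 1 / β := by
  rcases hσ with rfl | rfl
  · have := setIntegral_left_eq (β := β) (fun _ => 1) hx.2
    simp only [mul_one] at this
    rw [← this]
    exact integral_left_kernel_le hβ hx.2
  · have := setIntegral_right_eq (β := β) (fun _ => 1) hx.1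
    simp only [mul_one] at this
    rw [← this]
    exact integral_right_kernel_le hβ hx.1

theorem integrable_kern_mul_fst (hβ : 0 < β) (hσ : σ = 1 ∨ σ = -1) {g : ℝ → ℝ}
    (hg : Integrable g vol01) :
    Integrable (fun z : ℝ × ℝ => kern β (σ * (z.1 - z.2)) * g z.1) (vol01.prod vol01) := by
  have hm : AEStronglyMeasurable (fun z : ℝ × ℝ => kern β (σ * (z.1 - z.2)) * g z.1)
      (vol01.prod vol01) :=
    ((measurable_kern β).comp (by fun_prop)).aestronglyMeasurable.mul hg.1.comp_fst
  refine (integrable_prod_iff hm).2 ⟨Eventually.of_forall fun x => ?_, ?_⟩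
  · exact (integrable_kern hβ hσ x).mul_const (g x)
  · refine (hg.norm.const_mul (1 / β)).mono' hm.norm.integral_prod_right' ?_
    filter_upwards [ae_mem_Ioo] with x hx
    have e : ∀ y, ‖kern β (σ * (x - y)) * g x‖ = kern β (σ * (x - y)) * ‖g x‖ := fun y => by
      rw [norm_mul, Real.norm_of_nonneg (kern_nonneg _ _)]
    rw [Real.norm_of_nonneg (integral_nonneg fun _ => norm_nonneg _)]
    simp only [e]
    rw [integral_mul_const]
    exact mul_le_mul_of_nonneg_right (integral_kern_le hβ hσ (Ioo_subset_Icc_self hx))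
      (norm_nonneg _)

theorem integrable_kern_mul_snd (hβ : 0 < β) (hσ : σ = 1 ∨ σ = -1) {g : ℝ → ℝ}
    (hg : Integrable g vol01) :
    Integrable (fun z : ℝ × ℝ => kern β (σ * (z.1 - z.2)) * g z.2) (vol01.prod vol01) := by
  have := (integrable_kern_mul_fst hβ (σ := -σ) (by rcases hσ with rfl | rfl <;> simp) hg).swap
  refine this.congr (Eventually.of_forall fun z => ?_)
  simp only [Function.comp, Prod.fst_swap, Prod.snd_swap]
  congr 2
  ring

/-- Since $|fg|\le f^2+g^2$, it suffices that the integral of the kernel in either variable is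
bounded. -/
theorem integrable_kern_mul_mul (hβ : 0 < β) (hσ : σ = 1 ∨ σ = -1) {f g : ℝ → ℝ}
    (hf : MemLp f 2 vol01) (hg : MemLp g 2 vol01) :
    Integrable (fun z : ℝ × ℝ => kern β (σ * (z.1 - z.2)) * f z.2 * g z.1) (vol01.prod vol01) := by
  refine ((integrable_kern_mul_snd hβ hσ hf.integrable_sq).add
    (integrable_kern_mul_fst hβ hσ hg.integrable_sq)).mono'
    ((((measurable_kern β).comp (by fun_prop)).aestronglyMeasurable.mul hf.1.comp_snd).mul
      hg.1.comp_fst) (Eventually.of_forall fun z => ?_)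
  rw [norm_mul, norm_mul, Real.norm_of_nonneg (kern_nonneg _ _), Pi.add_apply, ← mul_add, mul_assoc]
  refine mul_le_mul_of_nonneg_left ?_ (kern_nonneg _ _)
  rw [Real.norm_eq_abs, Real.norm_eq_abs, ← sq_abs (f z.2), ← sq_abs (g z.1)]
  nlinarith [sq_nonneg (|f z.2| - |g z.1|), sq_nonneg (|f z.2| + |g z.1|)]

theorem integral_kernInt_mul (hβ : 0 < β) (hσ : σ = 1 ∨ σ = -1) {f g : ℝ → ℝ}
    (hf : MemLp f 2 vol01) (hg : MemLp g 2 vol01) :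
    ∫ x, kernInt β σ f x * g x ∂vol01 =
      1 / Real.Gamma β * ∫ z : ℝ × ℝ, kern β (σ * (z.1 - z.2)) * f z.2 * g z.1 ∂vol01.prod vol01 := by
  rw [integral_prod _ (integrable_kern_mul_mul hβ hσ hf hg), ← integral_const_mul]
  refine integral_congr_ae (Eventually.of_forall fun x => ?_)
  simp only [kernInt]
  rw [integral_mul_const, mul_assoc]

/-- The left and right fractional integrals are adjoint to each other. -/
theorem integral_kernInt_mul_comm (hβ : 0 < β) (hσ : σ = 1 ∨ σ = -1) {f g : ℝ → ℝ}
    (hf : MemLp f 2 vol01) (hg : MemLp g 2 vol01) :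
    ∫ x, kernInt β σ f x * g x ∂vol01 = ∫ x, f x * kernInt β (-σ) g x ∂vol01 := by
  have e : ∫ x, f x * kernInt β (-σ) g x ∂vol01 = ∫ x, kernInt β (-σ) g x * f x ∂vol01 := by
    simp only [mul_comm]
  rw [e, integral_kernInt_mul hβ hσ hf hg,
    integral_kernInt_mul hβ (by rcases hσ with rfl | rfl <;> simp) hg hf, ← integral_prod_swap]
  congr 2
  ext z
  simp only [Prod.fst_swap, Prod.snd_swap]
  rw [show σ * (z.2 - z.1) = -σ * (z.1 - z.2) by ring]
  ring

theorem integrable_kernInt (hβ : 0 < β) (hσ : σ = 1 ∨ σ = -1) {f : ℝ → ℝ}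
    (hf : Integrable f vol01) : Integrable (kernInt β σ f) vol01 :=
  (integrable_kern_mul_snd hβ hσ hf).integral_prod_left.const_mul _

/-- The fractional integral is moved from $\varphi'$ to $w$, which makes orthogonality to the range
accessible to the du Bois-Reymond lemma. -/
theorem inner_fracTest_eq (hβ : 0 < β) (hβ1 : β < 1 / 2) (hσ : σ = 1 ∨ σ = -1)
    (φ : testSubmodule) {w : ℝ → ℝ} (hw : MemLp w 2 vol01) :
    inner ℝ (fracTest hβ hβ1 hσ φ) (hw.toLp w) = ∫ x, kernInt β (-σ) w x * deriv φ.1 x ∂vol01 := by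
  refine (inner_toLp_toLp ((memLp_lineInt hβ hβ1 hσ φ.2.deriv).restrict _) hw).trans ?_
  have e : ∫ x, lineInt β σ (deriv φ.1) x * w x ∂vol01 =
      ∫ x, kernInt β σ (deriv φ.1) x * w x ∂vol01 := by
    refine integral_congr_ae (ae_mem_Ioo.mono fun x hx => ?_)
    simp only
    rw [φ.2.deriv.lineInt_eq_kernInt hσ (Ioo_subset_Icc_self hx)]
  rw [e, integral_kernInt_mul_comm hβ hσ (φ.2.deriv.memLp_vol01 2) hw]
  simp only [mul_comm]

/-- The function `(1 - x) ^ (-β)`, whose right fractional integral is constant. -/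
noncomputable def edgeFn (β x : ℝ) : ℝ := (1 - x) ^ (-β)

theorem memLp_edgeFn (hβ1 : β < 1 / 2) : MemLp (edgeFn β) 2 vol01 := by
  have hm : Measurable (edgeFn β) := by unfold edgeFn; fun_prop
  rw [memLp_two_iff_integrable_sq hm.aestronglyMeasurable, integrable_vol01_iff]
  have h := (intervalIntegral.intervalIntegrable_rpow' (r := -(2 * β)) (by linarith) (a := 0)
    (b := 1)).comp_sub_left 1
  rw [sub_zero, sub_self] at h
  refine h.symm.congr fun x hx => ?_
  rw [uIoc_of_le zero_le_one] at hx
  simp only [edgeFn]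
  rw [← Real.rpow_natCast, ← Real.rpow_mul (by linarith [hx.2])]
  congr 1
  push_cast
  ring

/-- The substitution $y=s+(1-s)t$ extracts the powers $-\beta$, $\beta-1$ and $1$ of $1-s$, and
these exponents add up to zero. -/
theorem rightInt_edgeFn {s : ℝ} (hs : s ∈ Ioo (0 : ℝ) 1) :
    rightInt β (edgeFn β) s =
      1 / Real.Gamma β * ∫ t in (0 : ℝ)..1, (1 - t) ^ (-β) / t ^ (1 - β) := by
  have h1 : 0 < 1 - s := sub_pos.2 hs.2
  rw [rightInt]
  congr 1
  have e := intervalIntegral.integral_comp_mul_left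
    (fun y => (1 - s - y) ^ (-β) / y ^ (1 - β)) h1.ne' (a := 0) (b := 1)
  rw [mul_zero, mul_one] at e
  have e2 : ∫ y in Ioo s 1, edgeFn β y / (y - s) ^ (1 - β) =
      ∫ y in (0 : ℝ)..(1 - s), (1 - s - y) ^ (-β) / y ^ (1 - β) := by
    have e3 := intervalIntegral.integral_comp_sub_right
      (fun y => (1 - s - y) ^ (-β) / y ^ (1 - β)) s (a := s) (b := 1)
    rw [sub_self] at e3
    rw [← e3, intervalIntegral.integral_of_le hs.2.le, integral_Ioc_eq_integral_Ioo]
    refine integral_congr_ae (Eventually.of_forall fun y => ?_)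
    simp only [edgeFn]
    congr 2
    ring
  have e4 : (1 - s) • ∫ t in (0 : ℝ)..1, (1 - s - (1 - s) * t) ^ (-β) / ((1 - s) * t) ^ (1 - β) =
      ∫ t in (0 : ℝ)..1, (1 - t) ^ (-β) / t ^ (1 - β) := by
    rw [smul_eq_mul, ← intervalIntegral.integral_const_mul]
    refine intervalIntegral.integral_congr fun t ht => ?_
    rw [uIcc_of_le zero_le_one] at ht
    rw [show 1 - s - (1 - s) * t = (1 - s) * (1 - t) by ring,
      Real.mul_rpow h1.le (sub_nonneg.2 ht.2), Real.mul_rpow h1.le ht.1]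
    have e5 : (1 - s) ^ (1 - β) = (1 - s) * (1 - s) ^ (-β) := by
      rw [sub_eq_add_neg 1 β, Real.rpow_add h1, Real.rpow_one]
    rw [e5]
    have : 0 < (1 - s) ^ (-β) := Real.rpow_pos_of_pos h1 _
    field_simp
  rw [e2, ← e4, e, smul_smul, mul_inv_cancel₀ h1.ne', one_smul]

/-- By adjointness the pairing is that of a constant with $\varphi'$, which has mean zero. -/
theorem inner_fracDeriv_left_edgeFn (hβ : 0 < β) (hβ1 : β < 1 / 2) (u : H0 (1 - β)) :
    inner ℝ (fracDeriv hβ hβ1 (Or.inl rfl) u) ((memLp_edgeFn hβ1).toLp _) = 0 := by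
  refine (denseRange_testH0 (one_sub_nonneg hβ1) (one_sub_le_one hβ)).induction_on u
    (isClosed_eq (by fun_prop) continuous_const) fun φ => ?_
  rw [fracDeriv_testH0, inner_fracTest_eq]
  have e : ∫ x, kernInt β (-1) (edgeFn β) x * deriv φ.1 x ∂vol01 =
      ∫ x, (1 / Real.Gamma β * ∫ t in (0 : ℝ)..1, (1 - t) ^ (-β) / t ^ (1 - β)) *
        deriv φ.1 x ∂vol01 := by
    refine integral_congr_ae (ae_mem_Ioo.mono fun x hx => ?_)
    simp only
    rw [← rightInt_eq_kernInt _ hx.1.le, rightInt_edgeFn hx]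
  rw [e, integral_const_mul, φ.2.integral_deriv, mul_zero]

theorem toLp_edgeFn_ne_zero (hβ1 : β < 1 / 2) :
    (memLp_edgeFn hβ1).toLp _ ≠ 0 := by
  intro h
  have h1 := (memLp_edgeFn hβ1).coeFn_toLp
  rw [h] at h1
  have h2 : ∀ᵐ x ∂vol01, False := by
    filter_upwards [h1, Lp.coeFn_zero ℝ 2 vol01, ae_mem_Ioo] with x h3 h4 h5
    rw [h4, Pi.zero_apply, edgeFn] at h3
    exact (Real.rpow_pos_of_pos (sub_pos.2 h5.2) _).ne h3
  simp at h2
  exact (IsProbabilityMeasure.ne_zero vol01) h2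

end Kernel

end FracDiff

/-! ### Strict positivity of the Riesz energy. -/

namespace FracDiff

open Filter

section Positivity

/-- The Fourier transform of a function on `(0,1)`. -/
noncomputable def fourierI (w : ℝ → ℝ) (ξ : ℝ) : ℂ :=
  ∫ x, Complex.exp ((2 * Real.pi * ξ * x : ℝ) * Complex.I) * w x ∂vol01

theorem exp_neg_mul_sq_eq {r : ℝ} (hr : 0 < r) (t : ℝ) :
    Complex.exp (-(r * t ^ 2 : ℝ)) = ((Real.pi / r : ℝ) : ℂ) ^ (1 / 2 : ℂ) *
      ∫ ξ : ℝ, Complex.exp ((-2 * Real.pi * ξ * t : ℝ) * Complex.I) *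
        (Real.exp (-(Real.pi * (Real.pi / r)) * ξ ^ 2) : ℂ) := by
  have hb : 0 < Real.pi / r := div_pos Real.pi_pos hr
  have hb0 : ((Real.pi / r : ℝ) : ℂ) ≠ 0 := Complex.ofReal_ne_zero.2 hb.ne'
  have h := congrFun (fourier_gaussian_pi (b := ((Real.pi / r : ℝ) : ℂ)) (by simpa using hb)) t
  rw [Real.fourier_real_eq_integral_exp_smul] at h
  have e1 : ∫ ξ : ℝ, Complex.exp ((-2 * Real.pi * ξ * t : ℝ) * Complex.I) *
        (Real.exp (-(Real.pi * (Real.pi / r)) * ξ ^ 2) : ℂ) = 1 / ((Real.pi / r : ℝ) : ℂ) ^ (1 / 2 : ℂ) *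
        Complex.exp (-Real.pi / ((Real.pi / r : ℝ) : ℂ) * t ^ 2) := by
    rw [← h]
    refine integral_congr_ae (Eventually.of_forall fun ξ => ?_)
    simp only [smul_eq_mul]
    push_cast
    congr 2
    ring
  rw [e1, ← mul_assoc, mul_one_div_cancel, one_mul]
  · congr 1
    have : (r : ℂ) ≠ 0 := Complex.ofReal_ne_zero.2 hr.ne'
    have hπ : (Real.pi : ℂ) ≠ 0 := Complex.ofReal_ne_zero.2 Real.pi_ne_zero
    push_cast
    field_simp
  · rw [Ne, Complex.cpow_eq_zero_iff]
    exact fun h => hb0 h.1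

/-- Writing the Gaussian as a Fourier integral of a Gaussian separates the variables: $e^{-2\pi
i\xi(x-y)}$ splits into factors that integrate to $\overline{\hat w(\xi)}\,\hat w(\xi)$, with a
positive weight. -/
theorem gaussian_energy_eq {r : ℝ} (hr : 0 < r) {w : ℝ → ℝ} (hw : Integrable w vol01) :
    ((∫ z : ℝ × ℝ, Real.exp (-(r * (z.1 - z.2) ^ 2)) * (w z.1 * w z.2) ∂vol01.prod vol01 : ℝ) : ℂ) =
      ((Real.pi / r : ℝ) : ℂ) ^ (1 / 2 : ℂ) *
        ((∫ ξ : ℝ, Real.exp (-(Real.pi * (Real.pi / r)) * ξ ^ 2) * ‖fourierI w ξ‖ ^ 2 : ℝ) : ℂ) := by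
  set g : ℝ → ℝ := fun ξ => Real.exp (-(Real.pi * (Real.pi / r)) * ξ ^ 2)
  have hg : Integrable g := integrable_exp_neg_mul_sq (by positivity)
  have hww : Integrable (fun z : ℝ × ℝ => ((w z.1 * w z.2 : ℝ) : ℂ)) (vol01.prod vol01) :=
    (hw.mul_prod hw).ofReal
  have hH : Integrable (Function.uncurry fun (z : ℝ × ℝ) (ξ : ℝ) =>
      Complex.exp ((-2 * Real.pi * ξ * (z.1 - z.2) : ℝ) * Complex.I) *
        (((w z.1 * w z.2 : ℝ) : ℂ) * (g ξ : ℂ))) ((vol01.prod vol01).prod volume) :=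
    (hww.mul_prod hg.ofReal).bdd_mul (c := 1) (by fun_prop)
      (Eventually.of_forall fun z => by rw [Complex.norm_exp_ofReal_mul_I])
  rw [← integral_complex_ofReal, ← integral_complex_ofReal, ← integral_const_mul]
  calc _ = ∫ z : ℝ × ℝ, ((Real.pi / r : ℝ) : ℂ) ^ (1 / 2 : ℂ) * (∫ ξ : ℝ,
      Complex.exp ((-2 * Real.pi * ξ * (z.1 - z.2) : ℝ) * Complex.I) *
        (((w z.1 * w z.2 : ℝ) : ℂ) * (g ξ : ℂ))) ∂vol01.prod vol01 := by
        refine integral_congr_ae (Eventually.of_forall fun z => ?_)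
        simp only
        rw [Complex.ofReal_mul, Complex.ofReal_exp, Complex.ofReal_neg, exp_neg_mul_sq_eq hr,
          mul_assoc, ← integral_mul_const]
        congr 2
        ext ξ
        ring
    _ = ((Real.pi / r : ℝ) : ℂ) ^ (1 / 2 : ℂ) * ∫ ξ : ℝ, ∫ z : ℝ × ℝ,
      Complex.exp ((-2 * Real.pi * ξ * (z.1 - z.2) : ℝ) * Complex.I) *
        (((w z.1 * w z.2 : ℝ) : ℂ) * (g ξ : ℂ)) ∂vol01.prod vol01 := by
        rw [integral_const_mul, integral_integral_swap hH]
    _ = _ := by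
        rw [← integral_const_mul]
        refine integral_congr_ae (Eventually.of_forall fun ξ => ?_)
        simp only
        congr 1
        have e1 : ∀ z : ℝ × ℝ, Complex.exp ((-2 * Real.pi * ξ * (z.1 - z.2) : ℝ) * Complex.I) *
            (((w z.1 * w z.2 : ℝ) : ℂ) * (g ξ : ℂ)) =
            (g ξ : ℂ) * ((Complex.exp ((-(2 * Real.pi * ξ * z.1) : ℝ) * Complex.I) * w z.1) *
              (Complex.exp ((2 * Real.pi * ξ * z.2 : ℝ) * Complex.I) * w z.2)) := by
          intro z
          have e2 : Complex.exp ((-2 * Real.pi * ξ * (z.1 - z.2) : ℝ) * Complex.I) =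
              Complex.exp ((-(2 * Real.pi * ξ * z.1) : ℝ) * Complex.I) *
                Complex.exp ((2 * Real.pi * ξ * z.2 : ℝ) * Complex.I) := by
            rw [← Complex.exp_add]
            congr 1
            push_cast
            ring
          rw [e2]
          push_cast
          ring
        simp only [e1]
        rw [integral_const_mul, integral_prod_mul (μ := vol01) (ν := vol01)
          (fun x => Complex.exp ((-(2 * Real.pi * ξ * x) : ℝ) * Complex.I) * w x)
          (fun x => Complex.exp ((2 * Real.pi * ξ * x : ℝ) * Complex.I) * w x)]
        have e3 : ∫ x, Complex.exp ((-(2 * Real.pi * ξ * x) : ℝ) * Complex.I) * w x ∂vol01 =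
            starRingEnd ℂ (fourierI w ξ) := by
          rw [fourierI, ← integral_conj]
          refine integral_congr_ae (Eventually.of_forall fun x => ?_)
          simp only [map_mul, Complex.conj_ofReal, ← Complex.exp_conj, Complex.conj_I]
          push_cast
          ring_nf
        rw [e3]
        change (g ξ : ℂ) * (starRingEnd ℂ (fourierI w ξ) * fourierI w ξ) = _
        rw [mul_comm (starRingEnd ℂ _), Complex.mul_conj, Complex.normSq_eq_norm_sq]
        rw [← Complex.ofReal_mul]

theorem continuous_fourierI {w : ℝ → ℝ} (hw : Integrable w vol01) : Continuous (fourierI w) := by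
  refine continuous_of_dominated (bound := fun x => ‖w x‖) (fun ξ => ?_) (fun ξ => ?_) hw.norm
    (Eventually.of_forall fun x => by fun_prop)
  · exact AEStronglyMeasurable.mul (by fun_prop)
      (Complex.continuous_ofReal.comp_aestronglyMeasurable hw.1)
  · refine Eventually.of_forall fun x => ?_
    rw [norm_mul, Complex.norm_exp_ofReal_mul_I, one_mul, Complex.norm_real]

theorem norm_fourierI_le {w : ℝ → ℝ} (ξ : ℝ) : ‖fourierI w ξ‖ ≤ ∫ x, ‖w x‖ ∂vol01 := by
  refine (norm_integral_le_integral_norm _).trans (le_of_eq ?_)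
  refine integral_congr_ae (Eventually.of_forall fun x => ?_)
  simp only [norm_mul, Complex.norm_exp_ofReal_mul_I, one_mul, Complex.norm_real]

/-- Inserting Fourier inversion of a test function $\psi$ and exchanging integrals turns $\int
w\psi$ into an integral against the transform of $w$, which is zero. -/
theorem ae_eq_zero_of_fourierI {w : ℝ → ℝ} (hw : Integrable w vol01)
    (h : fourierI w =ᵐ[volume] 0) : w =ᵐ[vol01] 0 := by
  refine ae_eq_zero_of_forall_test hw fun ψ hψ => ?_
  have hH : Integrable (Function.uncurry fun (x ξ : ℝ) =>
      Complex.exp ((2 * Real.pi * ξ * x : ℝ) * Complex.I) * ((w x : ℂ) * realFourier ψ ξ))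
      (vol01.prod volume) :=
    (hw.ofReal.mul_prod hψ.integrable_realFourier).bdd_mul (c := 1) (by fun_prop)
      (Eventually.of_forall fun z => by rw [Complex.norm_exp_ofReal_mul_I])
  have e : ((∫ x, w x * ψ x ∂vol01 : ℝ) : ℂ) = ∫ ξ, realFourier ψ ξ * fourierI w ξ := by
    rw [← integral_complex_ofReal]
    calc _ = ∫ x, (∫ ξ : ℝ, Complex.exp ((2 * Real.pi * ξ * x : ℝ) * Complex.I) *
          ((w x : ℂ) * realFourier ψ ξ)) ∂vol01 := by
          refine integral_congr_ae (Eventually.of_forall fun x => ?_)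
          simp only
          rw [Complex.ofReal_mul, hψ.inversion, ← integral_const_mul]
          congr 1
          ext ξ
          ring
      _ = _ := by
          rw [integral_integral_swap hH]
          refine integral_congr_ae (Eventually.of_forall fun ξ => ?_)
          simp only [fourierI]
          rw [← integral_const_mul]
          congr 1
          ext x
          ring
  have e2 : ∫ ξ, realFourier ψ ξ * fourierI w ξ = 0 := by
    rw [← integral_zero ℝ ℂ (μ := volume)]
    refine integral_congr_ae (h.mono fun ξ hξ => ?_)
    simp only [hξ, Pi.zero_apply, mul_zero]
  rw [e2] at e
  exact_mod_cast e

theorem ae_prod_ne : ∀ᵐ z : ℝ × ℝ ∂vol01.prod vol01, z.1 ≠ z.2 := by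
  have hm : MeasurableSet {z : ℝ × ℝ | z.1 ≠ z.2} :=
    (measurableSet_eq_fun measurable_fst measurable_snd).compl
  rw [Measure.ae_prod_iff_ae_ae hm]
  refine Eventually.of_forall fun x => ?_
  have : ∀ᵐ y ∂(volume : Measure ℝ), y ≠ x := Measure.ae_ne volume x
  filter_upwards [ae_restrict_of_ae this] with y hy using fun h => hy h.symm

theorem kern_add_kern_neg {β t : ℝ} (ht : t ≠ 0) : kern β t + kern β (-t) = |t| ^ (β - 1) := by
  rcases lt_or_gt_of_ne ht with h | h
  · simp [kern, h, not_lt.2 h.le, abs_of_neg h]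
  · simp [kern, h, not_lt.2 h.le, abs_of_pos h]

/-- The real Gamma integral in $r$ with rate $t^2$. It exhibits the Riesz kernel as a superposition
of Gaussians with positive weights. -/
theorem integral_Ioi_rpow_mul_exp {β t : ℝ} (hβ1 : β < 1) (ht : t ≠ 0) :
    ∫ r in Ioi (0 : ℝ), r ^ ((1 - β) / 2 - 1) * Real.exp (-(r * t ^ 2)) =
      |t| ^ (β - 1) * Real.Gamma ((1 - β) / 2) := by
  have h := Real.integral_rpow_mul_exp_neg_mul_Ioi (a := (1 - β) / 2) (r := t ^ 2) (by linarith)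
    (by positivity)
  have e : (1 / t ^ 2) ^ ((1 - β) / 2) = |t| ^ (β - 1) := by
    rw [one_div, ← sq_abs, Real.inv_rpow (by positivity), ← Real.rpow_neg (by positivity),
      ← Real.rpow_natCast, ← Real.rpow_mul (abs_nonneg t)]
    congr 1
    push_cast
    ring
  rw [e] at h
  simpa only [mul_comm (t ^ 2)] using h

theorem integrableOn_Ioi_rpow_mul_exp {β t : ℝ} (hβ1 : β < 1) (ht : t ≠ 0) :
    IntegrableOn (fun r : ℝ => r ^ ((1 - β) / 2 - 1) * Real.exp (-(r * t ^ 2))) (Ioi 0) := by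
  have := integrableOn_rpow_mul_exp_neg_mul_rpow (s := (1 - β) / 2 - 1) (p := 1) (b := t ^ 2)
    (by linarith) one_pos (by positivity)
  simp only [Real.rpow_one, neg_mul] at this
  simpa only [mul_comm (t ^ 2)] using this

/-- Strict positivity of the Riesz energy on `(0,1)`. -/
theorem ae_eq_zero_of_integral_kernInt_mul_self {β : ℝ} (hβ : 0 < β) (hβ1 : β < 1) {w : ℝ → ℝ}
    (hw : MemLp w 2 vol01) (h : ∫ x, kernInt β 1 w x * w x ∂vol01 = 0) : w =ᵐ[vol01] 0 := by
  have hΓ := Real.Gamma_pos_of_pos hβ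
  have hi₁ := integrable_kern_mul_mul hβ (Or.inl rfl) hw hw
  have hi₂ := integrable_kern_mul_mul hβ (Or.inr rfl) hw hw
  have h₂ : ∫ x, kernInt β (-1) w x * w x ∂vol01 = 0 := by
    rw [integral_kernInt_mul_comm hβ (Or.inr rfl) hw hw, neg_neg, ← h]
    simp only [mul_comm]
  have hc : ∀ c : ℝ, 1 / Real.Gamma β * c = 0 → c = 0 := fun c hc =>
    (mul_eq_zero.1 hc).resolve_left (by positivity)
  rw [integral_kernInt_mul hβ (Or.inl rfl) hw hw] at h
  rw [integral_kernInt_mul hβ (Or.inr rfl) hw hw] at h₂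
  set a := (1 - β) / 2 - 1
  -- Integrated over $r$, this gives the sum of the left and right kernels times $w\otimes w$, whose
  -- total integral is zero; integrated over $z$, it gives nonnegative Gaussian energies. So almost
  -- all of these energies vanish.
  set F : ℝ × ℝ → ℝ → ℝ := fun z r =>
    r ^ a * Real.exp (-(r * (z.1 - z.2) ^ 2)) * (w z.1 * w z.2) with hFdef
  have hsum : ∀ᵐ z : ℝ × ℝ ∂vol01.prod vol01, ∫ r in Ioi (0 : ℝ), F z r =
      Real.Gamma ((1 - β) / 2) * (kern β (1 * (z.1 - z.2)) * w z.2 * w z.1 +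
        kern β (-1 * (z.1 - z.2)) * w z.2 * w z.1) := by
    filter_upwards [ae_prod_ne] with z hz
    simp only [F]
    rw [integral_mul_const, integral_Ioi_rpow_mul_exp hβ1 (sub_ne_zero.2 hz),
      ← kern_add_kern_neg (sub_ne_zero.2 hz), one_mul, neg_one_mul]
    ring
  have hsum' : ∀ᵐ z : ℝ × ℝ ∂vol01.prod vol01, ∫ r in Ioi (0 : ℝ), ‖F z r‖ =
      Real.Gamma ((1 - β) / 2) * (‖kern β (1 * (z.1 - z.2)) * w z.2 * w z.1‖ +
        ‖kern β (-1 * (z.1 - z.2)) * w z.2 * w z.1‖) := by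
    filter_upwards [ae_prod_ne] with z hz
    have e : ∫ r in Ioi (0 : ℝ), ‖F z r‖ = ∫ r in Ioi (0 : ℝ),
        r ^ a * Real.exp (-(r * (z.1 - z.2) ^ 2)) * ‖w z.1 * w z.2‖ := by
      refine setIntegral_congr_fun measurableSet_Ioi fun r hr => ?_
      simp only [F]
      rw [norm_mul, Real.norm_of_nonneg (mul_nonneg (Real.rpow_nonneg (le_of_lt hr) _)
        (Real.exp_nonneg _))]
    rw [e, integral_mul_const, integral_Ioi_rpow_mul_exp hβ1 (sub_ne_zero.2 hz),
      ← kern_add_kern_neg (sub_ne_zero.2 hz), one_mul, neg_one_mul]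
    simp only [norm_mul, Real.norm_of_nonneg (kern_nonneg _ _)]
    ring
  have hm : AEStronglyMeasurable (Function.uncurry F)
      ((vol01.prod vol01).prod (volume.restrict (Ioi 0))) := by
    have h1 : AEStronglyMeasurable (fun z : ℝ × ℝ => w z.1 * w z.2) (vol01.prod vol01) :=
      hw.1.comp_fst.mul hw.1.comp_snd
    exact (Measurable.aestronglyMeasurable (by fun_prop)).mul h1.comp_fst
  have hF : Integrable (Function.uncurry F)
      ((vol01.prod vol01).prod (volume.restrict (Ioi 0))) := by
    refine (integrable_prod_iff hm).2 ⟨?_, ?_⟩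
    · filter_upwards [ae_prod_ne] with z hz
      exact (integrableOn_Ioi_rpow_mul_exp hβ1 (sub_ne_zero.2 hz)).mul_const (w z.1 * w z.2)
    · exact ((hi₁.norm.add hi₂.norm).const_mul (Real.Gamma ((1 - β) / 2))).congr
        (hsum'.mono fun z hz => hz.symm)
  have h0 : ∫ r in Ioi (0 : ℝ), ∫ z, F z r ∂vol01.prod vol01 = 0 := by
    rw [← integral_integral_swap hF, integral_congr_ae hsum, integral_const_mul,
      integral_add hi₁ hi₂, hc _ h, hc _ h₂]
    simp
  have hww := hw.integrable one_le_two
  have hG : ∀ r ∈ Ioi (0 : ℝ), ∃ c : ℝ, 0 < c ∧ ∫ z, F z r ∂vol01.prod vol01 =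
      c * ∫ ξ : ℝ, Real.exp (-(Real.pi * (Real.pi / r)) * ξ ^ 2) * ‖fourierI w ξ‖ ^ 2 := by
    intro r hr
    have hr : 0 < r := hr
    have e1 := gaussian_energy_eq hr hww
    have e2 : ((Real.pi / r : ℝ) : ℂ) ^ (1 / 2 : ℂ) = (((Real.pi / r) ^ (1 / 2 : ℝ) : ℝ) : ℂ) := by
      rw [Complex.ofReal_cpow (by positivity)]
      norm_num
    rw [e2, ← Complex.ofReal_mul] at e1
    refine ⟨r ^ a * (Real.pi / r) ^ (1 / 2 : ℝ), by positivity, ?_⟩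
    rw [mul_assoc, ← Complex.ofReal_injective e1, ← integral_const_mul]
    congr 1
    ext z
    simp only [F]
    ring
  have hnn : ∀ r : ℝ, 0 ≤ ∫ ξ : ℝ,
      Real.exp (-(Real.pi * (Real.pi / r)) * ξ ^ 2) * ‖fourierI w ξ‖ ^ 2 := fun r =>
    integral_nonneg fun ξ => by positivity
  have hae := (integral_eq_zero_iff_of_nonneg_ae (μ := volume.restrict (Ioi (0 : ℝ)))
    (f := fun r => ∫ z, F z r ∂vol01.prod vol01)
    (by
      filter_upwards [ae_restrict_mem measurableSet_Ioi] with r hr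
      obtain ⟨c, hc, he⟩ := hG r hr
      rw [he]
      exact mul_nonneg hc.le (hnn r)) hF.integral_prod_right).1 h0
  have hne : NeBot (ae (volume.restrict (Ioi (0 : ℝ)))) := by
    rw [ae_neBot, Ne, Measure.restrict_eq_zero]
    simp
  -- One $r$ with zero energy suffices, because the Gaussian weight in $\xi$ is strictly positive.
  obtain ⟨r, hr0, hr⟩ := (hae.and (ae_restrict_mem measurableSet_Ioi)).exists
  have hr' : 0 < r := hr
  obtain ⟨c, hc, he⟩ := hG r hr
  have h3 : c * ∫ ξ : ℝ, Real.exp (-(Real.pi * (Real.pi / r)) * ξ ^ 2) * ‖fourierI w ξ‖ ^ 2 = 0 :=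
    he ▸ hr0
  have h4 := (mul_eq_zero.1 h3).resolve_left hc.ne'
  have hg : Integrable fun ξ : ℝ => Real.exp (-(Real.pi * (Real.pi / r)) * ξ ^ 2) :=
    integrable_exp_neg_mul_sq (by positivity)
  have hgi : Integrable fun ξ : ℝ =>
      Real.exp (-(Real.pi * (Real.pi / r)) * ξ ^ 2) * ‖fourierI w ξ‖ ^ 2 :=
    hg.mul_bdd (c := (∫ x, ‖w x‖ ∂vol01) ^ 2)
      ((continuous_fourierI hww).norm.pow 2).aestronglyMeasurable
      (Eventually.of_forall fun ξ => by
        rw [Real.norm_of_nonneg (by positivity)]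
        exact pow_le_pow_left₀ (norm_nonneg _) (norm_fourierI_le ξ) 2)
  have h5 := (integral_eq_zero_iff_of_nonneg (fun ξ => by positivity) hgi).1 h4
  refine ae_eq_zero_of_fourierI hww (h5.mono fun ξ hξ => ?_)
  have h6 := (mul_eq_zero.1 hξ).resolve_left (Real.exp_pos _).ne'
  simpa using h6

end Positivity

end FracDiff

/-! ### The range of $DI^\beta_\theta$ has codimension one. -/

namespace FracDiff

open Filter

section Range

theorem integrable_kernInt_mul {β σ : ℝ} (hβ : 0 < β) (hσ : σ = 1 ∨ σ = -1) {f g : ℝ → ℝ}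
    (hf : MemLp f 2 vol01) (hg : MemLp g 2 vol01) :
    Integrable (fun x => kernInt β σ f x * g x) vol01 := by
  refine ((integrable_kern_mul_mul hβ hσ hf hg).integral_prod_left.const_mul
    (1 / Real.Gamma β)).congr (Eventually.of_forall fun x => ?_)
  simp only [kernInt, integral_mul_const]
  rw [mul_assoc]

variable {β : ℝ} (hβ : 0 < β) (hβ1 : β < 1 / 2)

/-- The orthogonal complement of the range of `D I^β_θ` contains no nonzero function of mean
zero. -/
theorem eq_zero_of_orthogonal_of_mean_zero {θ : ℝ} {w : L2I}
    (h : ∀ u, inner ℝ (twoSidedDeriv hβ hβ1 θ u) w = 0) (hw : inner ℝ oneL2 w = (0 : ℝ)) :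
    w = 0 := by
  have hm : MemLp w 2 vol01 := Lp.memLp w
  have hwi := hm.integrable one_le_two
  -- $J$ is the adjoint of $I^\beta_\theta$ applied to $w$. Orthogonality to the range says that $J$
  -- annihilates derivatives of test functions, so $J$ is constant.
  set J : ℝ → ℝ := fun x => θ * kernInt β (-1) w x + (1 - θ) * kernInt β 1 w x with hJ
  have hJi : Integrable J vol01 :=
    ((integrable_kernInt hβ (Or.inr rfl) hwi).const_mul θ).add
      ((integrable_kernInt hβ (Or.inl rfl) hwi).const_mul (1 - θ))
  obtain ⟨c, hc⟩ := ae_eq_const_of_forall_deriv hJi fun φ hφ => by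
    have e := h (testH0 (one_sub_nonneg hβ1) (one_sub_le_one hβ) ⟨φ, hφ⟩)
    have e1 := inner_fracTest_eq hβ hβ1 (Or.inl rfl) ⟨φ, hφ⟩ hm
    have e2 := inner_fracTest_eq hβ hβ1 (Or.inr rfl) ⟨φ, hφ⟩ hm
    rw [Lp.toLp_coeFn] at e1 e2
    rw [neg_neg] at e2
    rw [twoSidedDeriv_apply, fracDeriv_testH0, fracDeriv_testH0, inner_add_left,
      real_inner_smul_left, real_inner_smul_left, e1, e2] at e
    have i1 := integrable_mul_test (integrable_kernInt hβ (Or.inr rfl) hwi) hφ.deriv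
    have i2 := integrable_mul_test (integrable_kernInt hβ (Or.inl rfl) hwi) hφ.deriv
    rw [← e, ← integral_const_mul, ← integral_const_mul,
      ← integral_add (i1.const_mul θ) (i2.const_mul (1 - θ))]
    congr 1
    ext x
    simp only [hJ]
    ring
  rw [inner_oneL2] at hw
  have e0 : ∫ x, J x * w x ∂vol01 = 0 := by
    rw [integral_congr_ae (hc.mono fun x hx => by rw [hx] : _ =ᵐ[vol01] fun x => c * w x),
      integral_const_mul, hw, mul_zero]
  have e1 : ∫ x, kernInt β (-1) w x * w x ∂vol01 = ∫ x, kernInt β 1 w x * w x ∂vol01 := by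
    rw [integral_kernInt_mul_comm hβ (Or.inr rfl) hm hm, neg_neg]
    simp only [mul_comm]
  -- The two one-sided energies coincide by adjointness, so $\theta$ drops out.
  have e2 : ∫ x, J x * w x ∂vol01 = ∫ x, kernInt β 1 w x * w x ∂vol01 := by
    have i1 := (integrable_kernInt_mul hβ (Or.inr rfl) hm hm).const_mul θ
    have i2 := (integrable_kernInt_mul hβ (Or.inl rfl) hm hm).const_mul (1 - θ)
    simp only [hJ, add_mul, mul_assoc]
    rw [integral_add i1 i2, integral_const_mul, integral_const_mul, e1]
    ring
  have := ae_eq_zero_of_integral_kernInt_mul_self hβ (by linarith) hm (e2 ▸ e0)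
  exact (Lp.eq_zero_iff_ae_eq_zero).2 this

/-- `D I^β_θ` is not onto. -/
theorem exists_notMem_range_twoSidedDeriv {θ : ℝ} (h0 : 0 ≤ θ) (h1 : θ ≤ 1) :
    ∃ g, ∀ u, twoSidedDeriv hβ hβ1 θ u ≠ g := by
  by_contra! hs
  set T := twoSidedDeriv hβ hβ1 θ
  set L := fracDeriv hβ hβ1 (Or.inl rfl)
  have hc := cos_pi_mul_pos hβ hβ1
  set B : H0 (1 - β) →L[ℝ] H0 (1 - β) →L[ℝ] ℝ :=
    (((innerSL ℝ).comp T).flip.comp L)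
  have hB : ∀ z u, B z u = inner ℝ (T u) (L z) := fun z u => rfl
  have hco : IsCoercive B := by
    refine ⟨Real.cos (Real.pi * β) ^ 2 / 4, by positivity, fun u => ?_⟩
    rw [hB]
    have e1 := inner_twoSidedDeriv_left_ge hβ hβ1 h0 h1 u
    have e2 := norm_H0_le (one_sub_nonneg hβ1) (one_sub_le_one hβ) u
    have e3 : ‖u‖ * ‖u‖ ≤ 4 * ‖H0snd u‖ ^ 2 := by nlinarith [norm_nonneg u]
    nlinarith [sq_pos_of_pos hc]
  set e : L2I := (memLp_edgeFn hβ1).toLp (edgeFn β)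
  -- Lax-Milgram gives $z$ with $Lz-e$ orthogonal to the range of $T$. If $T$ were onto, then
  -- $Lz=e$, although $e\ne0$ is orthogonal to the range of $L$.
  obtain ⟨z, hz⟩ := hco.continuousLinearEquivOfBilin.surjective
    ((InnerProductSpace.toDual ℝ _).symm (((innerSL ℝ).flip e).comp T))
  have hz' : ∀ u, inner ℝ (T u) (L z) = inner ℝ (T u) e := fun u => by
    have := hco.continuousLinearEquivOfBilin_apply z u
    rw [hz, InnerProductSpace.toDual_symm_apply, hB] at this
    exact this.symm
  obtain ⟨u, hu⟩ := hs (L z - e)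
  have e1 := hz' u
  rw [← sub_eq_zero, ← inner_sub_right, hu, inner_self_eq_zero, sub_eq_zero] at e1
  have e2 := inner_fracDeriv_left_edgeFn hβ hβ1 z
  change inner ℝ (L z) e = 0 at e2
  rw [e1] at e2
  exact toLp_edgeFn_ne_zero hβ1 (inner_self_eq_zero.1 e2)

theorem isClosed_range_twoSidedDeriv {θ : ℝ} (h0 : 0 ≤ θ) (h1 : θ ≤ 1) :
    IsClosed (LinearMap.range (twoSidedDeriv hβ hβ1 θ).toLinearMap : Set L2I) :=
  isClosed_range_of_bounded_below _ (by have := cos_pi_mul_pos hβ hβ1; positivity)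
    (twoSidedDeriv_bounded_below hβ hβ1 h0 h1)

/-- If $1$ were in the range, every vector orthogonal to the range would have mean zero and so
vanish. The closed range would then be all of $L^2(0,1)$. -/
theorem twoSidedDeriv_ne_oneL2 {θ : ℝ} (h0 : 0 ≤ θ) (h1 : θ ≤ 1) (u : H0 (1 - β)) :
    twoSidedDeriv hβ hβ1 θ u ≠ oneL2 := by
  intro hu
  obtain ⟨g, hg⟩ := exists_notMem_range_twoSidedDeriv hβ hβ1 h0 h1
  set S := LinearMap.range (twoSidedDeriv hβ hβ1 θ).toLinearMap
  have : CompleteSpace S := (isClosed_range_twoSidedDeriv hβ hβ1 h0 h1).completeSpace_coe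
  obtain ⟨y, ⟨v, hv⟩, z, hz, hyz⟩ := S.exists_add_mem_mem_orthogonal g
  have hz' : ∀ v, inner ℝ (twoSidedDeriv hβ hβ1 θ v) z = 0 := fun v =>
    (Submodule.mem_orthogonal _ _).1 hz _ ⟨v, rfl⟩
  have : z = 0 := eq_zero_of_orthogonal_of_mean_zero hβ hβ1 hz' (hu ▸ hz' u)
  exact hg v (by rw [hyz, this, add_zero]; exact hv)

theorem norm_twoSidedDeriv_sub_le (θ θ' : ℝ) (u : H0 (1 - β)) :
    ‖twoSidedDeriv hβ hβ1 θ u - twoSidedDeriv hβ hβ1 θ' u‖ ≤ 2 * |θ - θ'| * ‖u‖ := by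
  have e : twoSidedDeriv hβ hβ1 θ u - twoSidedDeriv hβ hβ1 θ' u =
      (θ - θ') • (fracDeriv hβ hβ1 (Or.inl rfl) u - fracDeriv hβ hβ1 (Or.inr rfl) u) := by
    rw [twoSidedDeriv_apply, twoSidedDeriv_apply]
    module
  have e1 := norm_sub_le (fracDeriv hβ hβ1 (Or.inl rfl) u) (fracDeriv hβ hβ1 (Or.inr rfl) u)
  have e2 := norm_fracDeriv_le hβ hβ1 (Or.inl rfl) u
  have e3 := norm_fracDeriv_le hβ hβ1 (Or.inr rfl) u
  have e4 := norm_H0snd_le u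
  rw [e, norm_smul, Real.norm_eq_abs]
  calc _ ≤ |θ - θ'| * (2 * ‖u‖) := by gcongr; linarith
    _ = _ := by ring

/-- The constant function `1` stays away from the range of `D I^β_θ`, uniformly in `θ`. -/
theorem exists_le_norm_oneL2_sub :
    ∃ d : ℝ, 0 < d ∧ ∀ θ ∈ Icc (0 : ℝ) 1, ∀ u, d ≤ ‖oneL2 - twoSidedDeriv hβ hβ1 θ u‖ := by
  -- By compactness of the parameter interval a bound near each $\theta_0$ is enough.
  have key := isCompact_Icc.induction_on (s := Icc (0 : ℝ) 1) (p := fun S => ∃ d : ℝ, 0 < d ∧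
    ∀ θ ∈ S ∩ Icc (0 : ℝ) 1, ∀ u, d ≤ ‖oneL2 - twoSidedDeriv hβ hβ1 θ u‖)
    ⟨1, one_pos, by simp⟩
    (fun S S' hS ⟨d, hd, h⟩ => ⟨d, hd, fun θ hθ => h θ ⟨hS hθ.1, hθ.2⟩⟩)
    (fun S S' ⟨d, hd, h⟩ ⟨d', hd', h'⟩ => ⟨min d d', lt_min hd hd', fun θ hθ u => by
      rcases hθ.1 with hS | hS
      · exact (min_le_left _ _).trans (h θ ⟨hS, hθ.2⟩ u)
      · exact (min_le_right _ _).trans (h' θ ⟨hS, hθ.2⟩ u)⟩) ?_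
  · obtain ⟨d, hd, h⟩ := key
    exact ⟨d, hd, fun θ hθ => h θ ⟨hθ, hθ⟩⟩
  intro θ₀ hθ₀
  set S := LinearMap.range (twoSidedDeriv hβ hβ1 θ₀).toLinearMap
  have hS : IsClosed (S : Set L2I) := isClosed_range_twoSidedDeriv hβ hβ1 hθ₀.1 hθ₀.2
  have hpos : 0 < Metric.infDist oneL2 (S : Set L2I) := by
    refine (hS.notMem_iff_infDist_pos ⟨0, S.zero_mem⟩).1 ?_
    rintro ⟨u, hu⟩
    exact twoSidedDeriv_ne_oneL2 hβ hβ1 hθ₀.1 hθ₀.2 u hu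
  set d := Metric.infDist oneL2 (S : Set L2I)
  have hd : ∀ u, d ≤ ‖oneL2 - twoSidedDeriv hβ hβ1 θ₀ u‖ := fun u => by
    rw [← dist_eq_norm]
    exact Metric.infDist_le_dist_of_mem ⟨u, rfl⟩
  set c := Real.cos (Real.pi * β) ^ 2 / 2
  have hc : 0 < c := by have := cos_pi_mul_pos hβ hβ1; positivity
  -- If $\|1-T_\theta u\|<d/2$, then $\|u\|\le(1+d)/c$, and replacing $\theta$ by $\theta_0$ costs
  -- at most $2\delta(1+d)/c=d/2$. That contradicts the distance $d$ at $\theta_0$.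
  set δ := c * d / (4 * (1 + d))
  have hδ : 0 < δ := by positivity
  refine ⟨Metric.ball θ₀ δ, mem_nhdsWithin_of_mem_nhds (Metric.ball_mem_nhds _ hδ), d / 2,
    by positivity, fun θ hθ u => ?_⟩
  by_contra! hlt
  have e1 : c * ‖u‖ ≤ _ := twoSidedDeriv_bounded_below hβ hβ1 hθ.2.1 hθ.2.2 u
  have e2 : ‖twoSidedDeriv hβ hβ1 θ u‖ ≤ 1 + d / 2 := by
    have := norm_sub_le oneL2 (oneL2 - twoSidedDeriv hβ hβ1 θ u)
    rw [sub_sub_cancel, norm_oneL2] at this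
    linarith
  have e3 : ‖u‖ ≤ (1 + d) / c := by
    rw [le_div_iff₀ hc]
    linarith
  have e4 := norm_twoSidedDeriv_sub_le hβ hβ1 θ θ₀ u
  have e5 : 2 * |θ - θ₀| * ‖u‖ ≤ 2 * δ * ((1 + d) / c) := by
    have := (Metric.mem_ball.1 hθ.1).le
    rw [Real.dist_eq] at this
    gcongr
  have e6 : 2 * δ * ((1 + d) / c) = d / 2 := by
    simp only [δ]
    field_simp
    ring
  have e7 := norm_add_le (oneL2 - twoSidedDeriv hβ hβ1 θ u)
    (twoSidedDeriv hβ hβ1 θ u - twoSidedDeriv hβ hβ1 θ₀ u)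
  rw [sub_add_sub_cancel] at e7
  linarith [hd u]

/-- The range of `D I^β_θ` is the orthogonal complement of a function of mean one, whose norm is
bounded uniformly in `θ`. -/
theorem exists_range_twoSidedDeriv_eq :
    ∃ C : ℝ, 0 < C ∧ ∀ θ ∈ Icc (0 : ℝ) 1, ∃ p : L2I, inner ℝ oneL2 p = (1 : ℝ) ∧ ‖p‖ ≤ C ∧
      ∀ g, (∃ u, twoSidedDeriv hβ hβ1 θ u = g) ↔ inner ℝ p g = (0 : ℝ) := by
  obtain ⟨d, hd, h⟩ := exists_le_norm_oneL2_sub hβ hβ1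
  refine ⟨1 / d, by positivity, fun θ hθ => ?_⟩
  set T := twoSidedDeriv hβ hβ1 θ
  set S := LinearMap.range T.toLinearMap
  have : CompleteSpace S := (isClosed_range_twoSidedDeriv hβ hβ1 hθ.1 hθ.2).completeSpace_coe
  -- The vector $r$ is the component of $1$ orthogonal to the range. Its norm is at least $d$, and
  -- $p=r/\|r\|^2$ has mean one and norm $1/\|r\|\le1/d$.
  obtain ⟨y, ⟨v, hv⟩, r, hr, hyr⟩ := S.exists_add_mem_mem_orthogonal oneL2
  have horth : ∀ w ∈ Sᗮ, ∀ u, inner ℝ (T u) w = 0 := fun w hw u =>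
    (Submodule.mem_orthogonal _ _).1 hw _ ⟨u, rfl⟩
  have hdr : d ≤ ‖r‖ := by
    have := h θ hθ v
    rwa [show twoSidedDeriv hβ hβ1 θ v = y from hv, hyr, add_sub_cancel_left] at this
  have hr0 : 0 < ‖r‖ := hd.trans_le hdr
  have h1r : inner ℝ oneL2 r = ‖r‖ ^ 2 := by
    rw [hyr, inner_add_left, ← hv, real_inner_self_eq_norm_sq]
    change inner ℝ (T v) r + _ = _
    rw [horth r hr v, zero_add]
  refine ⟨(‖r‖ ^ 2)⁻¹ • r, ?_, ?_, fun g => ⟨?_, fun hg => ?_⟩⟩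
  · rw [real_inner_smul_right, h1r, inv_mul_cancel₀ (by positivity)]
  · rw [norm_smul, norm_inv, norm_pow, norm_norm, sq, mul_inv, mul_assoc,
      inv_mul_cancel₀ hr0.ne', mul_one, one_div]
    gcongr
  · rintro ⟨u, rfl⟩
    rw [real_inner_smul_left, real_inner_comm, horth r hr u, mul_zero]
  · have hmem : g ∈ Sᗮᗮ := by
      refine (Submodule.mem_orthogonal _ _).2 fun w hw => ?_
      -- Subtracting the mean of $w$ times $p$ leaves a mean-zero vector orthogonal to the range,
      -- which is zero. So the orthogonal complement is the line spanned by $p$.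
      have hw' : w - (inner ℝ oneL2 w) • ((‖r‖ ^ 2)⁻¹ • r) = 0 := by
        refine eq_zero_of_orthogonal_of_mean_zero hβ hβ1 (θ := θ) (fun u => ?_) ?_
        · exact horth _ (Sᗮ.sub_mem hw (Sᗮ.smul_mem _ (Sᗮ.smul_mem _ hr))) u
        · rw [inner_sub_right, real_inner_smul_right, real_inner_smul_right, h1r,
            inv_mul_cancel₀ (by positivity), mul_one, sub_self]
      rw [sub_eq_zero.1 hw', real_inner_smul_left, hg, mul_zero]
    rw [Submodule.orthogonal_orthogonal] at hmem
    exact hmem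

end Range

end FracDiff

/-! ### Variable coefficient: solvability and the inf-sup condition. -/

namespace FracDiff

open Filter

section Multiplication

theorem memLp_mul_of_bound {b : ℝ → ℝ} (hb : AEStronglyMeasurable b vol01) {C : ℝ}
    (hC : ∀ᵐ x ∂vol01, |b x| ≤ C) {g : ℝ → ℝ} (hg : MemLp g 2 vol01) :
    MemLp (fun x => b x * g x) 2 vol01 :=
  hg.of_le_mul (hb.mul hg.1) (hC.mono fun x hx => by
    rw [norm_mul]
    exact mul_le_mul_of_nonneg_right hx (norm_nonneg _))

/-- Multiplication by a bounded function, as an operator on `L²(0,1)`. -/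
theorem exists_mul_clm {b : ℝ → ℝ} (hb : AEStronglyMeasurable b vol01) {C : ℝ}
    (hC : ∀ᵐ x ∂vol01, |b x| ≤ C) :
    ∃ M : L2I →L[ℝ] L2I, (∀ g, M g =ᵐ[vol01] fun x => b x * g x) ∧ ∀ g, ‖M g‖ ≤ C * ‖g‖ := by
  have hm : ∀ g : L2I, MemLp (fun x => b x * g x) 2 vol01 := fun g =>
    memLp_mul_of_bound hb hC (Lp.memLp g)
  let M₀ : L2I →ₗ[ℝ] L2I :=
    { toFun := fun g => (hm g).toLp _
      map_add' := fun f g => by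
        rw [← MemLp.toLp_add]
        refine MemLp.toLp_congr _ _ ((Lp.coeFn_add f g).mono fun x hx => ?_)
        simp only [hx, Pi.add_apply, mul_add]
      map_smul' := fun c g => by
        rw [RingHom.id_apply, ← MemLp.toLp_const_smul]
        refine MemLp.toLp_congr _ _ ((Lp.coeFn_smul c g).mono fun x hx => ?_)
        simp only [hx, Pi.smul_apply, smul_eq_mul]
        ring }
  have hn : ∀ g, ‖M₀ g‖ ≤ C * ‖g‖ := fun g =>
    Lp.norm_le_mul_norm_of_ae_le_mul (by
      filter_upwards [(hm g).coeFn_toLp, hC] with x hx hx'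
      change ‖((hm g).toLp _ : L2I) x‖ ≤ _
      rw [hx, norm_mul]
      exact mul_le_mul_of_nonneg_right hx' (norm_nonneg _))
  exact ⟨M₀.mkContinuous C hn, fun g => (hm g).coeFn_toLp, hn⟩

/-- `M` and `N` are the operators of multiplication by `K` and `K⁻¹`. -/
structure IsMulPair (Km KM : ℝ) (K : ℝ → ℝ) (M N : L2I →L[ℝ] L2I) : Prop where
  coe_mul : ∀ g, M g =ᵐ[vol01] fun x => K x * g x
  coe_inv : ∀ g, N g =ᵐ[vol01] fun x => 1 / K x * g x
  mul_inv : ∀ g, M (N g) = g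
  inv_mul : ∀ g, N (M g) = g
  norm_mul : ∀ g, ‖M g‖ ≤ KM * ‖g‖
  norm_inv : ∀ g, ‖N g‖ ≤ 1 / Km * ‖g‖
  mean : 1 / KM ≤ inner ℝ oneL2 (N oneL2)

theorem IsDiffusivity.exists_isMulPair {Km KM : ℝ} {K : ℝ → ℝ} (hK : IsDiffusivity Km KM K) :
    ∃ M N, IsMulPair Km KM K M N := by
  have hpos := hK.pos
  obtain ⟨M, hM, hMn⟩ := exists_mul_clm hK.meas.aestronglyMeasurable (C := KM)
    (hK.bounds.mono fun x hx => by rw [abs_of_pos (hpos.trans_le hx.1)]; exact hx.2)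
  obtain ⟨N, hN, hNn⟩ := exists_mul_clm (b := fun x => 1 / K x) (C := 1 / Km)
    (hK.meas.const_div 1).aestronglyMeasurable
    (hK.bounds.mono fun x hx => by
      rw [abs_of_pos (one_div_pos.2 (hpos.trans_le hx.1))]
      exact one_div_le_one_div_of_le hpos hx.1)
  refine ⟨M, N, hM, hN, fun g => ?_, fun g => ?_, hMn, hNn, ?_⟩
  · refine Lp.ext ?_
    filter_upwards [hM (N g), hN g, hK.bounds] with x h1 h2 h3
    have := (hpos.trans_le h3.1).ne'
    rw [h1, h2]
    field_simp
  · refine Lp.ext ?_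
    filter_upwards [hN (M g), hM g, hK.bounds] with x h1 h2 h3
    have := (hpos.trans_le h3.1).ne'
    rw [h1, h2]
    field_simp
  · rw [inner_oneL2]
    have e : ∫ _, (1 / KM : ℝ) ∂vol01 ≤ ∫ x, N oneL2 x ∂vol01 := by
      refine integral_mono_ae (integrable_const _) ((Lp.memLp _).integrable one_le_two) ?_
      filter_upwards [hN oneL2, coeFn_oneL2, hK.bounds] with x h1 h2 h3
      rw [h1, h2, mul_one]
      exact one_div_le_one_div_of_le (hpos.trans_le h3.1) h3.2
    simpa using e

end Multiplication

section WeakFormulation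

/-- `p` has mean one and spans the orthogonal complement of the range of `D I^β_θ`. -/
structure IsRangeNormal {β : ℝ} (hβ : 0 < β) (hβ1 : β < 1 / 2) (θ : ℝ) (p : L2I) : Prop where
  mean : inner ℝ oneL2 p = (1 : ℝ)
  range : ∀ g, (∃ u, twoSidedDeriv hβ hβ1 θ u = g) ↔ inner ℝ p g = (0 : ℝ)

variable {β : ℝ} {hβ : 0 < β} {hβ1 : β < 1 / 2} {θ Km KM : ℝ} {K : ℝ → ℝ} {M N : L2I →L[ℝ] L2I}
  {p : L2I}

theorem IsMulPair.A_eq (h : IsMulPair Km KM K M N) (u : H0 (1 - β)) (v : H01) :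
    A β θ K u v = inner ℝ (M (twoSidedDeriv hβ hβ1 θ u)) (H01DL v) := by
  rw [L2I_inner_eq, A]
  refine integral_congr_ae ?_
  filter_upwards [weakDeriv_twoSidedInt hβ hβ1 θ u, h.coe_mul (twoSidedDeriv hβ hβ1 θ u)]
    with x h1 h2
  rw [h1, h2, H01D_eq]

/-- The normalised reciprocal $m^{-1}K^{-1}$ equals $1+d$ with $\|d\|\le1/(2C)$. Pairing with $p$
gives at least $1-C\cdot\frac1{2C}=\frac12$. This is the only use of the smallness of the
perturbation. -/
theorem IsMulPair.half_mean_le_inner (h : IsMulPair Km KM K M N) (hKM : 0 < KM)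
    (hp1 : inner ℝ oneL2 p = (1 : ℝ)) {C : ℝ} (hC : 0 < C) (hpC : ‖p‖ ≤ C)
    (hpert : perturbation K < ENNReal.ofReal (1 / (2 * C))) :
    1 / 2 * inner ℝ oneL2 (N oneL2) ≤ inner ℝ p (N oneL2) := by
  set m := inner ℝ oneL2 (N oneL2) with hm
  have hm0 : 0 < m := (one_div_pos.2 hKM).trans_le h.mean
  have hN : N oneL2 =ᵐ[vol01] fun x => 1 / K x := by
    filter_upwards [h.coe_inv oneL2, coeFn_oneL2] with x h1 h2
    rw [h1, h2, mul_one]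
  have hmK : ∫ x, 1 / K x ∂vol01 = m := by rw [hm, inner_oneL2, integral_congr_ae hN]
  set d : L2I := m⁻¹ • N oneL2 - oneL2
  have hd : ‖d‖ ≤ 1 / (2 * C) := by
    have e : eLpNorm d 2 vol01 = perturbation K := by
      rw [perturbation, hmK]
      refine eLpNorm_congr_ae ?_
      filter_upwards [Lp.coeFn_sub (m⁻¹ • N oneL2) oneL2, Lp.coeFn_smul m⁻¹ (N oneL2), hN,
        coeFn_oneL2] with x h1 h2 h3 h4
      rw [h1, Pi.sub_apply, h2, Pi.smul_apply, h3, h4, smul_eq_mul]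
    rw [Lp.norm_def, e]
    exact ENNReal.toReal_le_of_le_ofReal (by positivity) hpert.le
  have e1 : inner ℝ p d = m⁻¹ * inner ℝ p (N oneL2) - 1 := by
    rw [inner_sub_right, real_inner_smul_right, real_inner_comm oneL2 p, hp1]
  have e2 := (abs_le.1 (abs_real_inner_le_norm p d)).1
  have e3 : ‖p‖ * ‖d‖ ≤ 1 / 2 := by
    calc ‖p‖ * ‖d‖ ≤ C * (1 / (2 * C)) := by gcongr
      _ = 1 / 2 := by field_simp
  have e4 : 1 / 2 ≤ m⁻¹ * inner ℝ p (N oneL2) := by linarith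
  rw [inv_mul_eq_div, le_div_iff₀ hm0] at e4
  exact e4

/-- The constant $c$ is chosen to make $K^{-1}(g+c)$ orthogonal to $p$, which is possible because
$(p,K^{-1})\ne0$. -/
theorem IsRangeNormal.exists_mul_eq (hp : IsRangeNormal hβ hβ1 θ p) (h : IsMulPair Km KM K M N)
    (hn : 0 < inner ℝ p (N oneL2)) (g : L2I) :
    ∃ (u : H0 (1 - β)) (c : ℝ), M (twoSidedDeriv hβ hβ1 θ u) = g + c • oneL2 := by
  set c := -(inner ℝ p (N g) / inner ℝ p (N oneL2))
  obtain ⟨u, hu⟩ := (hp.range (N (g + c • oneL2))).2 (by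
    rw [map_add, map_smul, inner_add_right, real_inner_smul_right, neg_mul,
      div_mul_cancel₀ _ hn.ne', add_neg_cancel])
  exact ⟨u, c, by rw [hu, h.mul_inv]⟩

theorem inner_add_const_H01DL (g : L2I) (c : ℝ) (v : H01) :
    inner ℝ (g + c • oneL2) (H01DL v) = inner ℝ g (H01DL v) := by
  rw [inner_add_left, real_inner_smul_left, inner_oneL2_H01DL, mul_zero, add_zero]

theorem IsRangeNormal.exists_A_eq (hp : IsRangeNormal hβ hβ1 θ p) (h : IsMulPair Km KM K M N)
    (hn : 0 < inner ℝ p (N oneL2)) (g : L2I) :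
    ∃ u : H0 (1 - β), ∀ v, A β θ K u v = inner ℝ g (H01DL v) := by
  obtain ⟨u, c, hu⟩ := hp.exists_mul_eq h hn g
  exact ⟨u, fun v => by rw [h.A_eq (hβ := hβ) (hβ1 := hβ1), hu, inner_add_const_H01DL]⟩

/-- The inf-sup constant of the Petrov-Galerkin form. -/
noncomputable def infSup (β C Km KM : ℝ) : ℝ :=
  Real.cos (Real.pi * β) ^ 2 / 4 * Km / (1 + 2 * KM * C / Km)

theorem infSup_pos (hβ : 0 < β) (hβ1 : β < 1 / 2) {C : ℝ} (hC : 0 < C) (hKm : 0 < Km)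
    (hKM : 0 < KM) : 0 < infSup β C Km KM := by
  have := cos_pi_mul_pos hβ hβ1
  unfold infSup
  positivity

/-- The optimal test function has as derivative the mean-free part $f$ of the flux $g=KTu$. It
controls $u$ because the mean $c$ of $g$ is controlled by $f$: as $Tu=K^{-1}f+cK^{-1}$ is orthogonal
to $p$, one has $c\,(p,K^{-1})=-(p,K^{-1}f)$. The factor $2$ pays for $\|v\|\le2\|Dv\|$ later. -/
theorem IsRangeNormal.exists_test (hp : IsRangeNormal hβ hβ1 θ p) (h : IsMulPair Km KM K M N)
    (h0 : 0 ≤ θ) (h1 : θ ≤ 1) (hKm : 0 < Km) (hKM : 0 < KM) {C : ℝ} (hC : 0 < C) (hpC : ‖p‖ ≤ C)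
    (hn : 1 / 2 * inner ℝ oneL2 (N oneL2) ≤ inner ℝ p (N oneL2)) (u : H0 (1 - β)) :
    ∃ v : H01, 2 * infSup β C Km KM * ‖u‖ ≤ ‖H01DL v‖ ∧ A β θ K u v = ‖H01DL v‖ ^ 2 := by
  set g := M (twoSidedDeriv hβ hβ1 θ u)
  set c := inner ℝ oneL2 g
  set f := g - c • oneL2
  have hf : inner ℝ oneL2 f = (0 : ℝ) := by
    rw [inner_sub_right, real_inner_smul_right, inner_oneL2_oneL2, mul_one, sub_self]
  have hg : g = f + c • oneL2 := (sub_add_cancel _ _).symm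
  have hT : twoSidedDeriv hβ hβ1 θ u = N f + c • N oneL2 := by
    rw [← h.inv_mul (twoSidedDeriv hβ hβ1 θ u)]
    change N g = _
    rw [hg, map_add, map_smul]
  obtain ⟨v, hv⟩ := exists_H01DL_eq hf
  refine ⟨v, ?_, ?_⟩
  · rw [hv]
    have e0 := (hp.range _).1 ⟨u, rfl⟩
    rw [hT, inner_add_right, real_inner_smul_right] at e0
    have hm := h.mean
    have hpN : 1 / (2 * KM) ≤ inner ℝ p (N oneL2) := by
      refine le_trans ?_ hn
      calc 1 / (2 * KM) = 1 / 2 * (1 / KM) := by field_simp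
        _ ≤ _ := by gcongr
    have e1 : |c| * (1 / (2 * KM)) ≤ C * (1 / Km * ‖f‖) := by
      calc |c| * (1 / (2 * KM)) ≤ |c| * |inner ℝ p (N oneL2)| := by
            gcongr
            exact hpN.trans (le_abs_self _)
        _ = |inner ℝ p (N f)| := by
            rw [← abs_mul, show c * inner ℝ p (N oneL2) = -inner ℝ p (N f) by linarith, abs_neg]
        _ ≤ ‖p‖ * ‖N f‖ := abs_real_inner_le_norm _ _
        _ ≤ _ := by
            gcongr
            exact h.norm_inv f
    have e2 : |c| ≤ 2 * KM * C / Km * ‖f‖ := by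
      rw [mul_one_div, div_le_iff₀ (by positivity)] at e1
      calc |c| ≤ _ := e1
        _ = _ := by field_simp
    have e3 : ‖twoSidedDeriv hβ hβ1 θ u‖ ≤ 1 / Km * ((1 + 2 * KM * C / Km) * ‖f‖) := by
      rw [← h.inv_mul (twoSidedDeriv hβ hβ1 θ u)]
      refine (h.norm_inv _).trans ?_
      gcongr
      change ‖g‖ ≤ _
      rw [hg]
      refine (norm_add_le _ _).trans ?_
      rw [norm_smul, norm_oneL2, mul_one, Real.norm_eq_abs]
      linarith
    have e4 := (twoSidedDeriv_bounded_below hβ hβ1 h0 h1 u).trans e3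
    have hD : 0 < 1 + 2 * KM * C / Km := by positivity
    have e5 : 2 * infSup β C Km KM * ‖u‖ =
        Km / (1 + 2 * KM * C / Km) * (Real.cos (Real.pi * β) ^ 2 / 2 * ‖u‖) := by
      rw [infSup]; ring
    rw [e5]
    calc _ ≤ Km / (1 + 2 * KM * C / Km) * (1 / Km * ((1 + 2 * KM * C / Km) * ‖f‖)) := by gcongr
      _ = ‖f‖ := by field_simp
  · rw [h.A_eq (hβ := hβ) (hβ1 := hβ1)]
    change inner ℝ g _ = _
    rw [hg, inner_add_const_H01DL, hv, real_inner_self_eq_norm_sq]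

/-- Lax-Milgram for the Dirichlet form, which is coercive by the Poincaré inequality but is not the
inner product of `H01`. Every functional is thereby tested as a function against $Dv$. -/
theorem exists_inner_H01DL_eq (F : Hneg1) : ∃ z : H01, ∀ v, inner ℝ (H01DL z) (H01DL v) = F v := by
  set B : H01 →L[ℝ] H01 →L[ℝ] ℝ := (((innerSL ℝ).comp H01DL).flip.comp H01DL).flip
  have hB : ∀ z u, B z u = inner ℝ (H01DL z) (H01DL u) := fun z u => rfl
  have hco : IsCoercive B := by
    refine ⟨1 / 4, by norm_num, fun u => ?_⟩
    rw [hB, real_inner_self_eq_norm_sq]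
    nlinarith [norm_H01_le u, norm_nonneg u]
  obtain ⟨z, hz⟩ := hco.continuousLinearEquivOfBilin.surjective
    ((InnerProductSpace.toDual ℝ _).symm F)
  refine ⟨z, fun v => ?_⟩
  have := hco.continuousLinearEquivOfBilin_apply z v
  rw [hz, InnerProductSpace.toDual_symm_apply, hB] at this
  exact this.symm

theorem IsMulPair.boundedForm (h : IsMulPair Km KM K M N) (hβ : 0 < β) (hβ1 : β < 1 / 2)
    (hKM : 0 < KM) (h0 : 0 ≤ θ) (h1 : θ ≤ 1) : BoundedForm β θ K KM := by
  refine ⟨memH_one_twoSidedInt hβ hβ1 θ, fun w v => ?_⟩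
  rw [h.A_eq (hβ := hβ) (hβ1 := hβ1)]
  refine (abs_real_inner_le_norm _ _).trans ?_
  gcongr
  · refine (h.norm_mul _).trans ?_
    gcongr
    exact norm_twoSidedDeriv_le hβ hβ1 h0 h1 w
  · exact norm_H01DL_le v

theorem H01DL_ne_zero {v : H01} (hv : v ≠ 0) : 0 < ‖H01DL v‖ := by
  have := norm_H01_le v
  have := norm_pos_iff.2 hv
  linarith

theorem weaklyCoercive_of_exists {κ : ℝ} (hκ : 0 < κ)
    (h : ∀ u : H0 (1 - β), ∃ v : H01, 2 * κ * ‖u‖ ≤ ‖H01DL v‖ ∧ A β θ K u v = ‖H01DL v‖ ^ 2)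
    (h' : ∀ g, ∃ u : H0 (1 - β), ∀ v, A β θ K u v = inner ℝ g (H01DL v)) :
    WeaklyCoercive β θ K κ := by
  refine ⟨le_iInf fun ⟨w, hw⟩ => ?_, fun v hv => ?_⟩
  · obtain ⟨v, h1, h2⟩ := h w
    have hw' := norm_pos_iff.2 hw
    have hD : 0 < ‖H01DL v‖ := lt_of_lt_of_le (by positivity) h1
    have hv : v ≠ 0 := fun h0 => by rw [h0, map_zero, norm_zero] at hD; exact lt_irrefl _ hD
    have hv' := norm_pos_iff.2 hv
    refine le_iSup_of_le ⟨v, hv⟩ (EReal.coe_le_coe_iff.2 ?_)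
    rw [h2, le_div_iff₀ (by positivity)]
    calc κ * (‖w‖ * ‖v‖) ≤ κ * (‖w‖ * (2 * ‖H01DL v‖)) := by gcongr; exact norm_H01_le v
      _ = 2 * κ * ‖w‖ * ‖H01DL v‖ := by ring
      _ ≤ ‖H01DL v‖ * ‖H01DL v‖ := by gcongr
      _ = _ := (sq _).symm
  · obtain ⟨u, hu⟩ := h' (H01DL v)
    refine lt_of_lt_of_le ?_ (le_iSup _ u)
    rw [hu, real_inner_self_eq_norm_sq]
    exact EReal.coe_pos.2 (pow_pos (H01DL_ne_zero hv) 2)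

theorem norm_le_of_isWeakSolution {κ : ℝ} (hκ : 0 < κ)
    (h : ∀ u : H0 (1 - β), ∃ v : H01, 2 * κ * ‖u‖ ≤ ‖H01DL v‖ ∧ A β θ K u v = ‖H01DL v‖ ^ 2)
    {F : Hneg1} {u : H0 (1 - β)} (hu : IsWeakSolution β θ K F u) : ‖u‖ ≤ 1 / κ * ‖F‖ := by
  obtain ⟨v, h1, h2⟩ := h u
  rw [hu v] at h2
  have e1 := (le_abs_self _).trans (F.le_opNorm v)
  have e2 := norm_H01_le v
  have e3 : ‖H01DL v‖ ≤ 2 * ‖F‖ := by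
    by_contra! hlt
    have : ‖F‖ * ‖v‖ ≤ ‖F‖ * (2 * ‖H01DL v‖) := by gcongr
    nlinarith [norm_nonneg F]
  rw [one_div, inv_mul_eq_div, le_div_iff₀ hκ]
  linarith

theorem IsMulPair.A_sub (h : IsMulPair Km KM K M N) (hβ : 0 < β) (hβ1 : β < 1 / 2)
    (u u' : H0 (1 - β)) (v : H01) : A β θ K (u - u') v = A β θ K u v - A β θ K u' v := by
  simp only [h.A_eq (hβ := hβ) (hβ1 := hβ1), map_sub, inner_sub_left]

theorem existsUnique_isWeakSolution (hp : IsMulPair Km KM K M N) (hβ : 0 < β) (hβ1 : β < 1 / 2)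
    {κ : ℝ} (hκ : 0 < κ)
    (h : ∀ u : H0 (1 - β), ∃ v : H01, 2 * κ * ‖u‖ ≤ ‖H01DL v‖ ∧ A β θ K u v = ‖H01DL v‖ ^ 2)
    (h' : ∀ g, ∃ u : H0 (1 - β), ∀ v, A β θ K u v = inner ℝ g (H01DL v)) (F : Hneg1) :
    ∃! u : H0 (1 - β), IsWeakSolution β θ K F u := by
  obtain ⟨z, hz⟩ := exists_inner_H01DL_eq F
  obtain ⟨u, hu⟩ := h' (H01DL z)
  refine ⟨u, fun v => (hu v).trans (hz v), fun u' hu' => ?_⟩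
  have h0 : IsWeakSolution β θ K (0 : Hneg1) (u' - u) := fun v => by
    rw [hp.A_sub hβ hβ1, hu' v, hu v, hz v, sub_self]
    rfl
  have := (norm_le_of_isWeakSolution hκ h h0).trans_eq (mul_eq_zero_of_right _ (norm_zero (E := Hneg1)))
  exact sub_eq_zero.1 (norm_le_zero_iff.1 this)

end WeakFormulation

end FracDiff

/-! ### The function $u_l$ and the solvability condition. -/

namespace FracDiff

open Filter

section Solvability

theorem eqOn_Icc_of_ae_eq {f g : ℝ → ℝ} (hf : ContinuousOn f (Icc 0 1))
    (hg : ContinuousOn g (Icc 0 1)) (h : f =ᵐ[vol01] g) : EqOn f g (Icc 0 1) := by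
  refine Measure.eqOn_Icc_of_ae_eq volume zero_ne_one ?_ hf hg
  rwa [← Measure.restrict_congr_set Ioo_ae_eq_Icc]

theorem ae_eq_of_prim_ae_eq {f g : ℝ → ℝ} (hf : Integrable f vol01) (hg : Integrable g vol01)
    (h : prim f =ᵐ[vol01] prim g) : f =ᵐ[vol01] g := by
  have h1 := hasWeakDeriv_prim_add hf 0
  have h2 := hasWeakDeriv_prim_add hg 0
  simp only [zero_add] at h1 h2
  exact HasWeakDeriv.ae_unique hf hg (h1.congr h EventuallyEq.rfl) h2

theorem integrable_L2I (f : L2I) : Integrable f vol01 := (Lp.memLp f).integrable one_le_two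

theorem ae_eq_of_prim_ae_eq_L2I {f g : L2I} (h : prim f =ᵐ[vol01] prim g) : f = g :=
  Lp.ext (ae_eq_of_prim_ae_eq (integrable_L2I f) (integrable_L2I g) h)

theorem prim_oneL2 {x : ℝ} (hx : x ∈ Icc (0 : ℝ) 1) : prim oneL2 x = x := by
  rw [prim_congr coeFn_oneL2 hx, prim]
  simp

theorem intervalIntegrable_L2I (f : L2I) {x : ℝ} (hx : x ∈ Icc (0 : ℝ) 1) :
    IntervalIntegrable f volume 0 x :=
  (integrable_vol01_iff.1 (integrable_L2I f)).mono_set (by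
    rw [uIcc_of_le hx.1, uIcc_of_le zero_le_one]; exact Icc_subset_Icc_right hx.2)

theorem prim_L2I_sub (f g : L2I) {x : ℝ} (hx : x ∈ Icc (0 : ℝ) 1) :
    prim (f - g : L2I) x = prim f x - prim g x := by
  rw [prim_congr (Lp.coeFn_sub f g) hx]
  exact intervalIntegral.integral_sub (intervalIntegrable_L2I f hx) (intervalIntegrable_L2I g hx)

theorem prim_L2I_smul (c : ℝ) (f : L2I) {x : ℝ} (hx : x ∈ Icc (0 : ℝ) 1) :
    prim (c • f : L2I) x = c * prim f x := by
  rw [prim_congr (Lp.coeFn_smul c f) hx]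
  exact intervalIntegral.integral_const_mul _ _

theorem prim_L2I_one (f : L2I) : prim f 1 = inner ℝ oneL2 f := by
  rw [inner_oneL2, prim_one]

variable {β : ℝ} {hβ : 0 < β} {hβ1 : β < 1 / 2} {θ Km KM : ℝ} {K : ℝ → ℝ} {M N : L2I →L[ℝ] L2I}
  {p : L2I}

/-- An element of `L²(0,1)` orthogonal to all derivatives of functions in `H₀¹(0,1)` is
constant. -/
theorem exists_eq_smul_oneL2 {g : L2I} (h : ∀ v : H01, inner ℝ g (H01DL v) = (0 : ℝ)) :
    g = (inner ℝ oneL2 g : ℝ) • oneL2 := by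
  set c := inner ℝ oneL2 g
  have h0 : inner ℝ oneL2 (g - c • oneL2) = (0 : ℝ) := by
    rw [inner_sub_right, real_inner_smul_right, inner_oneL2_oneL2, mul_one, sub_self]
  obtain ⟨v, hv⟩ := exists_H01DL_eq h0
  have h1 := h v
  rw [← inner_add_const_H01DL g (-c), hv, neg_smul, ← sub_eq_add_neg, inner_self_eq_zero] at h1
  exact sub_eq_zero.1 h1

/-- The profile `K⁻¹ / ∫₀¹ K⁻¹`, where `N` is multiplication by `K⁻¹`. -/
noncomputable def profile (N : L2I →L[ℝ] L2I) : L2I := (inner ℝ oneL2 (N oneL2) : ℝ)⁻¹ • N oneL2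

theorem mean_profile (hm : 0 < inner ℝ oneL2 (N oneL2)) : inner ℝ oneL2 (profile N) = (1 : ℝ) := by
  rw [profile, real_inner_smul_right, inv_mul_cancel₀ hm.ne']

theorem memH_one_of_hasWeakDeriv {w h : ℝ → ℝ} (hw : MemLp w 2 vol01) (hh : MemLp h 2 vol01)
    (H : HasWeakDeriv 1 w h) : MemH 1 w := by
  refine ⟨hw, fun k hk => ?_⟩
  rcases Nat.le_one_iff_eq_zero_or_eq_one.1 hk with rfl | rfl
  · exact ⟨_, hw, hasWeakDeriv_zero⟩
  · exact ⟨h, hh, H⟩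

theorem IsMulPair.integral_weakDeriv_eq (h : IsMulPair Km KM K M N) {w : ℝ → ℝ} {g : L2I}
    (H : HasWeakDeriv 1 w g) (v : H01) :
    ∫ x, K x * weakDeriv 1 w x * H01D v x ∂vol01 = inner ℝ (M g) (H01DL v) := by
  rw [L2I_inner_eq]
  refine integral_congr_ae ?_
  filter_upwards [H.weakDeriv_ae_eq (Lp.memLp g), h.coe_mul g] with x h1 h2
  rw [h1, h2, H01D_eq]

/-- The flux $K\,Dw$ is constant, and the normalisation of `profile` makes the total drop equal to
one. -/
theorem IsMulPair.isWl_profile (h : IsMulPair Km KM K M N) (hm : 0 < inner ℝ oneL2 (N oneL2)) :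
    IsWl K fun x => 1 + prim (-profile N : L2I) x := by
  have H := hasWeakDeriv_prim_add (integrable_L2I (-profile N)) 1
  have hc : ContinuousOn (fun x => 1 + prim (-profile N : L2I) x) (Icc 0 1) :=
    continuousOn_const.add (continuousOn_prim (integrable_L2I _))
  refine ⟨hc, memH_one_of_hasWeakDeriv (memLp_of_continuousOn hc 2) (Lp.memLp _) H, ?_, ?_,
    fun v => ?_⟩
  · rw [prim_zero, add_zero]
  · rw [prim_L2I_one, inner_neg_right, mean_profile hm, add_neg_cancel]
  · rw [h.integral_weakDeriv_eq H, profile, map_neg, map_smul, h.mul_inv, inner_neg_left,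
      real_inner_smul_left, inner_oneL2_H01DL, mul_zero, neg_zero]

/-- The flux is orthogonal to all $Dv$, hence constant, and the two boundary values fix that
constant and the additive one. -/
theorem IsMulPair.ae_eq_of_isWl (h : IsMulPair Km KM K M N) (hm : 0 < inner ℝ oneL2 (N oneL2))
    {w : ℝ → ℝ} (hw : IsWl K w) : w =ᵐ[vol01] fun x => 1 + prim (-profile N : L2I) x := by
  obtain ⟨g, hg, H⟩ := hw.mem.2 1 le_rfl
  set G : L2I := hg.toLp g
  have hG : HasWeakDeriv 1 w G := H.congr EventuallyEq.rfl hg.coeFn_toLp.symm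
  obtain ⟨a, ha⟩ := hG.ae_eq_prim (hw.mem.1.integrable one_le_two) (integrable_L2I G)
  have hE := eqOn_Icc_of_ae_eq hw.cont
    (continuousOn_const.add (continuousOn_prim (integrable_L2I G))) ha
  have h0 := hE (left_mem_Icc.2 zero_le_one)
  have h1 := hE (right_mem_Icc.2 zero_le_one)
  simp only [hw.left, hw.right, Pi.add_apply, prim_zero, add_zero, prim_L2I_one] at h0 h1
  have hMG := exists_eq_smul_oneL2 (g := M G) fun v => by
    rw [← h.integral_weakDeriv_eq hG, hw.weak v]
  set c := inner ℝ oneL2 (M G)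
  have hGN : G = c • N oneL2 := by rw [← h.inv_mul G, hMG, map_smul]
  have hGp : G = -profile N := by
    have : c * inner ℝ oneL2 (N oneL2) = -1 := by
      rw [← real_inner_smul_right, ← hGN]; linarith
    rw [hGN, profile, ← neg_smul, ← neg_one_mul, ← this, mul_inv_cancel_right₀ hm.ne']
  rw [← hGp, h0]
  exact ha

theorem one_add_mean_eq (hβ : 0 < β) (hβ1 : β < 1 / 2) (θ : ℝ) (u : H0 (1 - β)) :
    θ * leftInt β (H0fn u) 1 = (1 - θ) * rightInt β (H0fn u) 0 +
      inner ℝ oneL2 (twoSidedDeriv hβ hβ1 θ u) := by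
  rw [← twoSidedInt_one, twoSidedInt_H0fn_eq hβ hβ1 θ u (right_mem_Icc.2 zero_le_one),
    prim_L2I_one]

/-- By `one_add_mean_eq` the boundary terms turn the left side of the defining equation into
$\int_0^x(Tu-m)$, with $m$ the mean of $Tu$. The right side is $\int_0^x(1-q)$ with $q$ the profile,
so comparing derivatives gives $Tu=(1+m)1-q$. -/
theorem IsMulPair.isUl_iff (h : IsMulPair Km KM K M N) (hm : 0 < inner ℝ oneL2 (N oneL2))
    (u : H0 (1 - β)) : IsUl β θ K u ↔ twoSidedDeriv hβ hβ1 θ u =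
      (1 + inner ℝ oneL2 (twoSidedDeriv hβ hβ1 θ u) : ℝ) • oneL2 - profile N := by
  set T := twoSidedDeriv hβ hβ1 θ u
  set m : ℝ := inner ℝ oneL2 T
  have e1 : ∀ x ∈ Icc (0 : ℝ) 1, twoSidedInt β θ (H0fn u) x
      - (1 - θ) * rightInt β (H0fn u) 0 * (1 - x) - θ * leftInt β (H0fn u) 1 * x =
      prim T x - m * x := fun x hx => by
    rw [twoSidedInt_H0fn_eq hβ hβ1 θ u hx, one_add_mean_eq hβ hβ1]
    ring
  have e2 : ∀ x ∈ Icc (0 : ℝ) 1, prim ((1 + m) • oneL2 - profile N : L2I) x =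
      (1 + m) * x + prim (-profile N : L2I) x := fun x hx => by
    rw [prim_L2I_sub _ _ hx, prim_L2I_smul _ _ hx, prim_oneL2 hx, ← neg_one_smul ℝ (profile N),
      prim_L2I_smul _ _ hx]
    ring
  constructor
  · rintro ⟨w, hw, hwu⟩
    refine ae_eq_of_prim_ae_eq_L2I ?_
    filter_upwards [hwu, h.ae_eq_of_isWl hm hw, ae_mem_Ioo] with x h1 h2 h3
    have h3 := Ioo_subset_Icc_self h3
    rw [e1 x h3, h2] at h1
    rw [e2 x h3]
    linarith
  · intro hT
    refine ⟨_, h.isWl_profile hm, ae_mem_Ioo.mono fun x hx => ?_⟩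
    have hx := Ioo_subset_Icc_self hx
    rw [e1 x hx, hT, e2 x hx]
    ring

/-- Membership of $(1+m)1-q$ in the range forces $1+m=(p,q)$. That number is both the coefficient
determining $u_l$ and the quantity required to be nonzero. -/
theorem IsRangeNormal.solvabilityCondition (hp : IsRangeNormal hβ hβ1 θ p)
    (h : IsMulPair Km KM K M N) (h0 : 0 ≤ θ) (h1 : θ ≤ 1) (hm : 0 < inner ℝ oneL2 (N oneL2))
    (hn : 0 < inner ℝ p (N oneL2)) : SolvabilityCondition β θ K := by
  set s : ℝ := inner ℝ p (profile N) with hs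
  have hs0 : 0 < s := by
    rw [hs, profile, real_inner_smul_right]
    positivity
  have hpo : inner ℝ p oneL2 = (1 : ℝ) := by rw [real_inner_comm, hp.mean]
  obtain ⟨u, hu⟩ := (hp.range (s • oneL2 - profile N)).2 (by
    rw [inner_sub_right, real_inner_smul_right, hpo, mul_one, sub_self])
  have hmu : 1 + inner ℝ oneL2 (twoSidedDeriv hβ hβ1 θ u) = s := by
    rw [hu, inner_sub_right, real_inner_smul_right, inner_oneL2_oneL2, mean_profile hm]
    ring
  refine ⟨u, (h.isUl_iff (hβ := hβ) (hβ1 := hβ1) hm u).2 (by rw [hmu, hu]), fun u' hu' => ?_, ?_⟩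
  · have e := (h.isUl_iff (hβ := hβ) (hβ1 := hβ1) hm u').1 hu'
    have e0 := (hp.range _).1 ⟨u', rfl⟩
    rw [e, inner_sub_right, real_inner_smul_right, hpo, mul_one, sub_eq_zero] at e0
    rw [e0, ← hu] at e
    have hb := twoSidedDeriv_bounded_below hβ hβ1 h0 h1 (u' - u)
    have hc := cos_pi_mul_pos hβ hβ1
    rw [map_sub, e, sub_self, norm_zero] at hb
    have hc' : 0 < Real.cos (Real.pi * β) ^ 2 / 2 := by positivity
    exact sub_eq_zero.1 (norm_le_zero_iff.1 (nonpos_of_mul_nonpos_right hb hc'))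
  · have := one_add_mean_eq hβ hβ1 θ u
    have : 1 + θ * leftInt β (H0fn u) 1 - (1 - θ) * rightInt β (H0fn u) 0 = s := by linarith
    rw [this]
    exact hs0.ne'

end Solvability

end FracDiff

/-! ### Sobolev norms, products and quotients. -/

namespace FracDiff

open Filter

section SobolevNorm

theorem HasWeakDeriv.succ_iff {g h : ℝ → ℝ} (H : HasWeakDeriv 1 g h) (j : ℕ) (h' : ℝ → ℝ) :
    HasWeakDeriv (j + 1) g h' ↔ HasWeakDeriv j h h' := by
  refine forall₂_congr fun φ hφ => ?_
  have e := hasWeakDeriv_one_iff.1 H _ (hφ.iteratedDeriv j)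
  rw [← iteratedDeriv_succ] at e
  rw [e, pow_succ, mul_neg_one, neg_mul, neg_inj]

/-- Equality holds everywhere and not merely almost everywhere: the two predicates coincide, so the
same representative is chosen. -/
theorem HasWeakDeriv.weakDeriv_succ {g h : ℝ → ℝ} (H : HasWeakDeriv 1 g h) (j : ℕ) :
    weakDeriv (j + 1) g = weakDeriv j h := by
  have e : HasWeakDeriv (j + 1) g = HasWeakDeriv j h := funext fun h' => propext (H.succ_iff j h')
  unfold weakDeriv
  generalize HasWeakDeriv (j + 1) g = P at e
  subst e
  rfl

theorem HasWeakDeriv.memH_succ_iff {g h : ℝ → ℝ} (hg : MemLp g 2 vol01) (hh : MemLp h 2 vol01)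
    (H : HasWeakDeriv 1 g h) (k : ℕ) : MemH (k + 1) g ↔ MemH k h := by
  refine ⟨fun h' => ⟨hh, fun j hj => ?_⟩, fun h' => ⟨hg, fun j hj => ?_⟩⟩
  · obtain ⟨f, hf, Hf⟩ := h'.2 (j + 1) (by omega)
    exact ⟨f, hf, (H.succ_iff j f).1 Hf⟩
  · cases j with
    | zero => exact ⟨g, hg, hasWeakDeriv_zero⟩
    | succ j =>
      obtain ⟨f, hf, Hf⟩ := h'.2 j (by omega)
      exact ⟨f, hf, (H.succ_iff j f).2 Hf⟩

theorem integral_weakDeriv_zero_sq {g : ℝ → ℝ} (hg : MemLp g 2 vol01) :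
    ∫ x, weakDeriv 0 g x ^ 2 ∂vol01 = ‖hg.toLp g‖ ^ 2 := by
  rw [← real_inner_self_eq_norm_sq, inner_toLp_toLp]
  refine integral_congr_ae ((hasWeakDeriv_zero.weakDeriv_ae_eq hg).mono fun x hx => ?_)
  simp only [hx, sq]

theorem hNorm_sq (k : ℕ) (g : ℝ → ℝ) :
    hNorm k g ^ 2 = ∑ j ∈ Finset.range (k + 1), ∫ x, weakDeriv j g x ^ 2 ∂vol01 :=
  Real.sq_sqrt (Finset.sum_nonneg fun _ _ => integral_nonneg fun _ => sq_nonneg _)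

theorem hNorm_nonneg (k : ℕ) (g : ℝ → ℝ) : 0 ≤ hNorm k g := Real.sqrt_nonneg _

theorem hNorm_zero_eq {g : ℝ → ℝ} (hg : MemLp g 2 vol01) : hNorm 0 g = ‖hg.toLp g‖ := by
  rw [hNorm, zero_add, Finset.sum_range_one, integral_weakDeriv_zero_sq hg,
    Real.sqrt_sq (norm_nonneg _)]

theorem HasWeakDeriv.hNorm_succ_sq {g h : ℝ → ℝ} (hg : MemLp g 2 vol01) (H : HasWeakDeriv 1 g h)
    (k : ℕ) : hNorm (k + 1) g ^ 2 = ‖hg.toLp g‖ ^ 2 + hNorm k h ^ 2 := by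
  rw [hNorm_sq, hNorm_sq, Finset.sum_range_succ', integral_weakDeriv_zero_sq hg, add_comm]
  simp only [H.weakDeriv_succ]

/-- `g` and its weak derivatives of order at most `k` have `L²(0,1)` norm at most `B`. -/
def SobolevBound : ℕ → (ℝ → ℝ) → ℝ → Prop
  | 0, g, B => ∃ hg : MemLp g 2 vol01, ‖hg.toLp g‖ ≤ B
  | k + 1, g, B => (∃ hg : MemLp g 2 vol01, ‖hg.toLp g‖ ≤ B) ∧
      ∃ h, HasWeakDeriv 1 g h ∧ SobolevBound k h B

theorem SobolevBound.zero_le {k : ℕ} {g : ℝ → ℝ} {B : ℝ} (h : SobolevBound k g B) :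
    ∃ hg : MemLp g 2 vol01, ‖hg.toLp g‖ ≤ B := by
  cases k with
  | zero => exact h
  | succ k => exact h.1

theorem SobolevBound.nonneg {k : ℕ} {g : ℝ → ℝ} {B : ℝ} (h : SobolevBound k g B) : 0 ≤ B := by
  obtain ⟨_, hB⟩ := h.zero_le
  exact (norm_nonneg _).trans hB

theorem MemH.sobolevBound {k : ℕ} {g : ℝ → ℝ} {B : ℝ} (hg : MemH k g) (hB : hNorm k g ≤ B) :
    SobolevBound k g B := by
  induction k generalizing g B with
  | zero => exact ⟨hg.1, (hNorm_zero_eq hg.1) ▸ hB⟩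
  | succ k ih =>
    obtain ⟨h, hh, H⟩ := hg.2 1 (by omega)
    have e := H.hNorm_succ_sq hg.1 k
    have h0 := hNorm_nonneg (k + 1) g
    refine ⟨⟨hg.1, le_trans ?_ hB⟩, h, H, ih ((H.memH_succ_iff hg.1 hh k).1 hg) (le_trans ?_ hB)⟩
    · exact abs_le_of_sq_le_sq' (by nlinarith [sq_nonneg (hNorm k h)]) h0 |>.2
    · exact abs_le_of_sq_le_sq' (by nlinarith [norm_nonneg (hg.1.toLp g)]) h0 |>.2

/-- Each of the $k+1$ orders contributes at most $B$. With `MemH.sobolevBound` this allows inductive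
estimates without the representatives chosen in `weakDeriv`. -/
theorem SobolevBound.memH {k : ℕ} {g : ℝ → ℝ} {B : ℝ} (h : SobolevBound k g B) :
    MemH k g ∧ hNorm k g ≤ (k + 1) * B := by
  induction k generalizing g B with
  | zero =>
    obtain ⟨hg, hB⟩ := h
    refine ⟨⟨hg, fun j hj => ?_⟩, ?_⟩
    · obtain rfl : j = 0 := by omega
      exact ⟨g, hg, hasWeakDeriv_zero⟩
    · rw [hNorm_zero_eq hg]
      simpa using hB
  | succ k ih =>
    have hB0 := h.nonneg
    obtain ⟨⟨hg, hB⟩, g', H, h'⟩ := h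
    obtain ⟨i1, i2⟩ := ih h'
    refine ⟨(H.memH_succ_iff hg i1.1 k).2 i1, ?_⟩
    have e := H.hNorm_succ_sq hg k
    have h1 := hNorm_nonneg k g'
    have h2 := norm_nonneg (hg.toLp g)
    have e1 : hNorm (k + 1) g ≤ ‖hg.toLp g‖ + hNorm k g' :=
      abs_le_of_sq_le_sq' (by nlinarith) (by positivity) |>.2
    push_cast
    linarith

theorem SobolevBound.mono {k : ℕ} {g : ℝ → ℝ} {B B' : ℝ} (h : SobolevBound k g B) (hB : B ≤ B') :
    SobolevBound k g B' := by
  induction k generalizing g with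
  | zero => exact ⟨h.choose, h.choose_spec.trans hB⟩
  | succ k ih =>
    obtain ⟨⟨hg, hB1⟩, g', H, h'⟩ := h
    exact ⟨⟨hg, hB1.trans hB⟩, g', H, ih h'⟩

theorem SobolevBound.of_succ {k : ℕ} {g : ℝ → ℝ} {B : ℝ} (h : SobolevBound (k + 1) g B) :
    SobolevBound k g B := by
  induction k generalizing g with
  | zero => exact h.1
  | succ k ih =>
    obtain ⟨hg, g', H, h'⟩ := h
    exact ⟨hg, g', H, ih h'⟩

theorem SobolevBound.congr {k : ℕ} {g g' : ℝ → ℝ} {B : ℝ} (h : SobolevBound k g B)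
    (hg : g =ᵐ[vol01] g') : SobolevBound k g' B := by
  have key : (∃ hg : MemLp g 2 vol01, ‖hg.toLp g‖ ≤ B) → ∃ hg : MemLp g' 2 vol01, ‖hg.toLp g'‖ ≤ B :=
    fun ⟨h1, h2⟩ => ⟨(memLp_congr_ae hg).1 h1, by rwa [MemLp.toLp_congr _ h1 hg.symm]⟩
  cases k with
  | zero => exact key h
  | succ k =>
    obtain ⟨h1, d, H, h'⟩ := h
    exact ⟨key h1, d, H.congr hg EventuallyEq.rfl, h'⟩

theorem HasWeakDeriv.add_smul {g g' h h' : ℝ → ℝ} (hg : Integrable g vol01)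
    (hg' : Integrable g' vol01) (hh : Integrable h vol01) (hh' : Integrable h' vol01)
    (H : HasWeakDeriv 1 g h) (H' : HasWeakDeriv 1 g' h') (c : ℝ) :
    HasWeakDeriv 1 (fun x => g x + c * g' x) fun x => h x + c * h' x := by
  refine hasWeakDeriv_one_iff.2 fun φ hφ => ?_
  have e : ∀ {a b ψ : ℝ → ℝ}, Integrable a vol01 → Integrable b vol01 → IsTestFunction ψ →
      ∫ x, (a x + c * b x) * ψ x ∂vol01 = ∫ x, a x * ψ x ∂vol01 + c * ∫ x, b x * ψ x ∂vol01 := by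
    intro a b ψ ha hb hψ
    rw [← integral_const_mul, ← integral_add (integrable_mul_test ha hψ)
      ((integrable_mul_test hb hψ).const_mul c)]
    refine integral_congr_ae (Eventually.of_forall fun x => ?_)
    ring
  rw [e hg hg' hφ.deriv, e hh hh' hφ, hasWeakDeriv_one_iff.1 H φ hφ, hasWeakDeriv_one_iff.1 H' φ hφ]
  ring

theorem SobolevBound.add_smul {k : ℕ} {g g' : ℝ → ℝ} {B B' : ℝ} (h : SobolevBound k g B)
    (h' : SobolevBound k g' B') (c : ℝ) :
    SobolevBound k (fun x => g x + c * g' x) (B + |c| * B') := by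
  have key : ∀ {g g' : ℝ → ℝ}, (∃ hg : MemLp g 2 vol01, ‖hg.toLp g‖ ≤ B) →
      (∃ hg : MemLp g' 2 vol01, ‖hg.toLp g'‖ ≤ B') →
      ∃ hg : MemLp (fun x => g x + c * g' x) 2 vol01, ‖hg.toLp _‖ ≤ B + |c| * B' := by
    rintro g g' ⟨hg, h1⟩ ⟨hg', h2⟩
    refine ⟨hg.add (hg'.const_mul c), ?_⟩
    have e : (hg.add (hg'.const_mul c)).toLp _ = hg.toLp g + c • hg'.toLp g' := by
      rw [← MemLp.toLp_const_smul, ← MemLp.toLp_add]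
      rfl
    refine (congrArg norm e).trans_le ((norm_add_le _ _).trans ?_)
    rw [norm_smul, Real.norm_eq_abs]
    gcongr
  induction k generalizing g g' with
  | zero => exact key h h'
  | succ k ih =>
    obtain ⟨h1, d, H, hd⟩ := h
    obtain ⟨h1', d', H', hd'⟩ := h'
    refine ⟨key h1 h1', _, ?_, ih hd hd'⟩
    exact HasWeakDeriv.add_smul (h1.choose.integrable one_le_two) (h1'.choose.integrable one_le_two)
      (hd.zero_le.choose.integrable one_le_two) (hd'.zero_le.choose.integrable one_le_two) H H' c

theorem memLp_mul_of_bound_norm {b g : ℝ → ℝ} {D B : ℝ} (hb : AEStronglyMeasurable b vol01)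
    (hD : ∀ᵐ x ∂vol01, |b x| ≤ D) (hD0 : 0 ≤ D) (hg : ∃ hg : MemLp g 2 vol01, ‖hg.toLp g‖ ≤ B) :
    ∃ hg : MemLp (fun x => b x * g x) 2 vol01, ‖hg.toLp _‖ ≤ D * B := by
  obtain ⟨hg, hB⟩ := hg
  refine ⟨memLp_mul_of_bound hb hD hg, ?_⟩
  refine (Lp.norm_le_mul_norm_of_ae_le_mul (g := hg.toLp g) (c := D) ?_).trans
    (mul_le_mul_of_nonneg_left hB hD0)
  filter_upwards [(memLp_mul_of_bound hb hD hg).coeFn_toLp, hg.coeFn_toLp, hD] with x h1 h2 h3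
  rw [h1, h2, norm_mul]
  exact mul_le_mul_of_nonneg_right h3 (norm_nonneg _)

/-- `b ∈ Cᵏ[0,1]` with derivatives of order at most `k` bounded by `D`. -/
structure SmoothBound (k : ℕ) (b : ℝ → ℝ) (D : ℝ) : Prop where
  contDiffOn : ContDiffOn ℝ (k : ℕ∞ω) b (Icc 0 1)
  bound : ∀ j ≤ k, ∀ x ∈ Icc (0 : ℝ) 1, |iteratedDerivWithin j b (Icc 0 1) x| ≤ D

theorem uniqueDiffOn_unitInterval : UniqueDiffOn ℝ (Icc (0 : ℝ) 1) := uniqueDiffOn_Icc zero_lt_one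

theorem SmoothBound.of_succ {k : ℕ} {b : ℝ → ℝ} {D : ℝ} (h : SmoothBound (k + 1) b D) :
    SmoothBound k b D :=
  ⟨h.1.of_le (by exact_mod_cast Nat.le_succ k), fun j hj => h.2 j (by omega)⟩

theorem SmoothBound.derivWithin {k : ℕ} {b : ℝ → ℝ} {D : ℝ} (h : SmoothBound (k + 1) b D) :
    SmoothBound k (_root_.derivWithin b (Icc 0 1)) D :=
  ⟨h.1.derivWithin uniqueDiffOn_unitInterval (by push_cast; exact le_rfl), fun j hj x hx => by
    rw [← iteratedDerivWithin_succ']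
    exact h.2 (j + 1) (by omega) x hx⟩

theorem SmoothBound.nonneg {k : ℕ} {b : ℝ → ℝ} {D : ℝ} (h : SmoothBound k b D) : 0 ≤ D :=
  (abs_nonneg _).trans (h.2 0 (Nat.zero_le _) 0 (left_mem_Icc.2 zero_le_one))

theorem SmoothBound.ae_le {k : ℕ} {b : ℝ → ℝ} {D : ℝ} (h : SmoothBound k b D) :
    ∀ᵐ x ∂vol01, |b x| ≤ D :=
  ae_mem_Ioo.mono fun x hx => by
    simpa using h.2 0 (Nat.zero_le _) x (Ioo_subset_Icc_self hx)

theorem SmoothBound.aestronglyMeasurable {k : ℕ} {b : ℝ → ℝ} {D : ℝ} (h : SmoothBound k b D) :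
    AEStronglyMeasurable b vol01 :=
  (h.1.continuousOn.mono Ioo_subset_Icc_self).aestronglyMeasurable measurableSet_Ioo

theorem absolutelyContinuous_of_contDiffOn {b : ℝ → ℝ} (hb : ContDiffOn ℝ 1 b (Icc 0 1)) :
    AbsolutelyContinuousOnInterval b 0 1 := by
  rw [← uIcc_of_le zero_le_one] at hb
  exact hb.absolutelyContinuousOnInterval

theorem hasDerivAt_of_contDiffOn {b : ℝ → ℝ} (hb : ContDiffOn ℝ 1 b (Icc 0 1)) {x : ℝ}
    (hx : x ∈ Ioo (0 : ℝ) 1) : HasDerivAt b (_root_.derivWithin b (Icc 0 1) x) x :=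
  ((hb.differentiableOn one_ne_zero x (Ioo_subset_Icc_self hx)).hasDerivWithinAt).hasDerivAt
    (Icc_mem_nhds hx.1 hx.2)

/-- The product rule for a continuously differentiable and a weakly differentiable function. -/
theorem HasWeakDeriv.mul_contDiffOn {b g h : ℝ → ℝ} (hb : ContDiffOn ℝ 1 b (Icc 0 1))
    (hg : Integrable g vol01) (hh : Integrable h vol01) (H : HasWeakDeriv 1 g h) :
    HasWeakDeriv 1 (fun x => b x * g x)
      fun x => b x * h x + _root_.derivWithin b (Icc 0 1) x * g x := by
  obtain ⟨c, hc⟩ := H.ae_eq_prim hg hh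
  have hac : AbsolutelyContinuousOnInterval (fun x => b x * (c + prim h x)) 0 1 :=
    (absolutelyContinuous_of_contDiffOn hb).mul
      ((contDiff_const (c := c)).contDiffOn.absolutelyContinuousOnInterval.add
        (absolutelyContinuous_prim hh))
  refine (hasWeakDeriv_of_ac (f' := fun x => _root_.derivWithin b (Icc 0 1) x * (c + prim h x) +
    b x * h x) hac ?_).congr ?_ ?_
  · filter_upwards [deriv_prim_ae hh, ae_mem_Ioo] with x h1 h2
    exact (hasDerivAt_of_contDiffOn hb h2).mul (h1.const_add c)
  · exact hc.mono fun x hx => by simp only [hx]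
  · exact hc.mono fun x hx => by simp only [hx]; ring

/-- Each use of the product rule doubles the number of terms, which gives the power of two. -/
theorem SmoothBound.mul {k : ℕ} {b g : ℝ → ℝ} {D B : ℝ} (hb : SmoothBound k b D)
    (hg : SobolevBound k g B) : SobolevBound k (fun x => b x * g x) (2 ^ k * D * B) := by
  induction k generalizing b g with
  | zero =>
    rw [pow_zero, one_mul]
    exact memLp_mul_of_bound_norm hb.aestronglyMeasurable hb.ae_le hb.nonneg hg
  | succ k ih =>
    have hD := hb.nonneg
    have hB := hg.nonneg
    obtain ⟨h1, h2⟩ := memLp_mul_of_bound_norm hb.aestronglyMeasurable hb.ae_le hD hg.zero_le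
    have e1 := ih hb.derivWithin hg.of_succ
    obtain ⟨⟨i1, i2⟩, h, H, hh⟩ := hg
    have e2 := (ih hb.of_succ hh).add_smul e1 1
    simp only [one_mul, abs_one] at e2
    refine ⟨⟨h1, h2.trans ?_⟩, _, H.mul_contDiffOn (hb.1.of_le ?_) (i1.integrable one_le_two)
      (hh.zero_le.choose.integrable one_le_two), e2.mono (le_of_eq ?_)⟩
    · have : (1 : ℝ) ≤ 2 ^ (k + 1) := one_le_pow₀ one_le_two
      calc D * B = 1 * (D * B) := (one_mul _).symm
        _ ≤ 2 ^ (k + 1) * (D * B) := by gcongr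
        _ = _ := by ring
    · push_cast
      exact le_add_self
    · ring

/-- Division by a smooth coefficient bounded from below preserves Sobolev regularity. -/
theorem exists_sobolevBound_of_mul {Km D : ℝ} (hKm : 0 < Km) (hD : 0 ≤ D) (k : ℕ) :
    ∃ C : ℝ, 0 ≤ C ∧ ∀ (K G h : ℝ → ℝ) (B : ℝ), SmoothBound k K D →
      (∀ x ∈ Icc (0 : ℝ) 1, Km ≤ K x) → SobolevBound k G B →
      (∀ᵐ x ∂vol01, K x * h x = G x) → SobolevBound k h (C * B) := by
  have hinv : ∀ {k : ℕ} {K G h : ℝ → ℝ}, SmoothBound k K D → (∀ x ∈ Icc (0 : ℝ) 1, Km ≤ K x) →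
      (∀ᵐ x ∂vol01, K x * h x = G x) → (fun x => (K x)⁻¹ * G x) =ᵐ[vol01] h := by
    intro k K G h hK hKm' hG
    filter_upwards [hG, ae_mem_Ioo] with x h1 h2
    have := (hKm.trans_le (hKm' x (Ioo_subset_Icc_self h2))).ne'
    rw [← h1]
    field_simp
  have hzero : ∀ {k : ℕ} {K G h : ℝ → ℝ} {B : ℝ}, SmoothBound k K D →
      (∀ x ∈ Icc (0 : ℝ) 1, Km ≤ K x) → SobolevBound 0 G B →
      (∀ᵐ x ∂vol01, K x * h x = G x) → SobolevBound 0 h (Km⁻¹ * B) := by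
    intro k K G h B hK hKm' hG hKh
    refine SobolevBound.congr (k := 0) ?_ (hinv hK hKm' hKh)
    refine memLp_mul_of_bound_norm hK.aestronglyMeasurable.aemeasurable.inv.aestronglyMeasurable
      (ae_mem_Ioo.mono fun x hx => ?_) (by positivity) hG
    have := hKm' x (Ioo_subset_Icc_self hx)
    rw [abs_of_pos (inv_pos.2 (hKm.trans_le this))]
    exact inv_anti₀ hKm this
  induction k with
  | zero => exact ⟨Km⁻¹, by positivity, fun K G h B hK hKm' hG hKh => hzero hK hKm' hG hKh⟩
  | succ k ih =>
    obtain ⟨C, hC, ih⟩ := ih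
    refine ⟨C * (1 + 2 ^ k * D * C), by positivity, fun K G h B hK hKm' hG hKh => ?_⟩
    have hB := hG.nonneg
    have h1 := ih K G h B hK.of_succ hKm' hG.of_succ hKh
    have hle : C * B ≤ C * (1 + 2 ^ k * D * C) * B := by
      have : 1 ≤ 1 + 2 ^ k * D * C := le_add_of_nonneg_right (by positivity)
      calc C * B = C * 1 * B := by ring
        _ ≤ _ := by gcongr
    have h2 := (h1.mono hle).zero_le
    obtain ⟨hG0, G', HG, hG'⟩ := hG
    have hK1 : ContDiffOn ℝ 1 K (Icc 0 1) := hK.1.of_le (by push_cast; exact le_add_self)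
    have hne : ∀ x ∈ Icc (0 : ℝ) 1, K x ≠ 0 := fun x hx => (hKm.trans_le (hKm' x hx)).ne'
    have hprod := hG'.add_smul (hK.derivWithin.mul h1) (-1)
    simp only [abs_neg, abs_one, one_mul, neg_one_mul, ← sub_eq_add_neg] at hprod
    -- Differentiating $Kh=G$ gives $Kh'=G'-K'h$, so $h'$ solves a problem of the same kind one
    -- order lower. Its data are bounded by $B+2^kDCB$, whence the recursion for the constant.
    set G'' : ℝ → ℝ := fun x => G' x - _root_.derivWithin K (Icc 0 1) x * h x
    have hKG : ∀ᵐ x ∂vol01, K x * ((K x)⁻¹ * G'' x) = G'' x := ae_mem_Ioo.mono fun x hx => by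
      rw [mul_inv_cancel_left₀ (hne x (Ioo_subset_Icc_self hx))]
    have h3 := ih K G'' (fun x => (K x)⁻¹ * G'' x) _ hK.of_succ hKm' hprod hKG
    refine ⟨h2, _, ?_, h3.mono (le_of_eq ?_)⟩
    · refine (HasWeakDeriv.mul_contDiffOn (hK1.inv hne) (hG0.choose.integrable one_le_two)
        (hG'.zero_le.choose.integrable one_le_two) HG).congr (hinv hK hKm' hKh) ?_
      filter_upwards [hKh, ae_mem_Ioo] with x e1 e2
      have hx := Ioo_subset_Icc_self e2
      have hKx := hne x hx
      have hd : _root_.derivWithin K⁻¹ (Icc 0 1) x =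
          -_root_.derivWithin K (Icc 0 1) x / K x ^ 2 :=
        ((hK1.differentiableOn one_ne_zero x hx).hasDerivWithinAt.inv hKx).derivWithin
          (uniqueDiffOn_unitInterval x hx)
      simp only [G'', Pi.inv_apply]
      rw [hd, ← e1]
      field_simp
      ring
    · ring

end SobolevNorm

end FracDiff

/-! ### Regularity of the weak solution. -/

namespace FracDiff

open Filter

section Regularity

theorem abs_iteratedDerivWithin_le_cNorm {n : ℕ} {K : ℝ → ℝ}
    (hK : ContDiffOn ℝ (n : ℕ∞ω) K (Icc 0 1)) {j : ℕ} (hj : j ≤ n) {x : ℝ}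
    (hx : x ∈ Icc (0 : ℝ) 1) : |iteratedDerivWithin j K (Icc 0 1) x| ≤ cNorm n K := by
  have hb : BddAbove ((fun x => |iteratedDerivWithin j K (Icc (0 : ℝ) 1) x|) '' Icc (0 : ℝ) 1) :=
    isCompact_Icc.bddAbove_image (hK.continuousOn_iteratedDerivWithin (by exact_mod_cast hj)
      uniqueDiffOn_unitInterval).abs
  refine (le_csSup hb ⟨x, hx, rfl⟩).trans ?_
  refine Finset.single_le_sum (f := fun k => sSup ((fun x =>
    |iteratedDerivWithin k K (Icc (0 : ℝ) 1) x|) '' Icc (0 : ℝ) 1)) (fun k _ => ?_)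
    (Finset.mem_range.2 (by omega))
  refine Real.sSup_nonneg ?_
  rintro _ ⟨y, -, rfl⟩
  exact abs_nonneg _

theorem le_of_ae_le {K : ℝ → ℝ} {c : ℝ} (hK : ContinuousOn K (Icc 0 1))
    (h : ∀ᵐ x ∂vol01, c ≤ K x) : ∀ x ∈ Icc (0 : ℝ) 1, c ≤ K x := fun x hx => by
  rw [eqOn_Icc_of_ae_eq hK (hK.sup continuousOn_const)
    (h.mono fun y hy => (sup_of_le_left hy).symm) hx]
  exact le_sup_right

theorem norm_toLp_le_of_ae_bound {f : ℝ → ℝ} (hf : MemLp f 2 vol01) {C : ℝ} (hC : 0 ≤ C)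
    (h : ∀ᵐ x ∂vol01, |f x| ≤ C) : ‖hf.toLp f‖ ≤ C :=
  norm_le_of_ae_bound hC (by filter_upwards [hf.coeFn_toLp, h] with x h1 h2; rwa [h1])

variable {β : ℝ} {hβ : 0 < β} {hβ1 : β < 1 / 2} {θ Km KM : ℝ} {K : ℝ → ℝ} {M N : L2I →L[ℝ] L2I}

theorem exists_abs_rightInt_zero_le (hβ : 0 < β) (hβ1 : β < 1 / 2) : ∃ C : ℝ, 0 ≤ C ∧
    ∀ u : H0 (1 - β), |rightInt β (H0fn u) 0| ≤ C * ‖u‖ := by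
  obtain ⟨C, hC, h⟩ := exists_abs_fracInt_sub_le hβ hβ1
  refine ⟨C, hC, fun u => ?_⟩
  have h1 := (h u 0 0 (left_mem_Icc.2 zero_le_one)).2
  have h2 : H0fn (0 : H0 (1 - β)) =ᵐ[volume] fun _ => 0 := by
    have := H0fn_sub_ae (0 : H0 (1 - β)) 0
    simpa only [sub_self] using this
  rw [rightInt_congr h2, sub_zero] at h1
  simpa [rightInt] using h1

/-- Integrating $f$ by parts shows that $KTu+\int_0^xf$ is orthogonal to all $Dv$, hence a constant,
which is bounded by the norm of that function. -/
theorem IsMulPair.flux_eq (h : IsMulPair Km KM K M N) (h0 : 0 ≤ θ) (h1 : θ ≤ 1) (hKM : 0 ≤ KM)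
    {f : ℝ → ℝ} (hf : MemLp f 2 vol01) {u : H0 (1 - β)}
    (hu : IsWeakSolution β θ K (fun v => ∫ x, f x * H01fn v x ∂vol01) u) :
    ∃ c : ℝ, |c| ≤ KM * ‖u‖ + ‖hf.toLp f‖ ∧
      ∀ᵐ x ∂vol01, K x * twoSidedDeriv hβ hβ1 θ u x = c - prim f x := by
  have hfi := hf.integrable one_le_two
  have hF : MemLp (prim f) 2 vol01 := memLp_of_continuousOn (continuousOn_prim hfi) 2
  have H := hasWeakDeriv_prim_add hfi 0
  simp only [zero_add] at H
  set T := twoSidedDeriv hβ hβ1 θ u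
  have hg := exists_eq_smul_oneL2 (g := M T + hF.toLp _) fun v => by
    rw [inner_add_left, ← h.A_eq (hβ := hβ) (hβ1 := hβ1), hu v]
    have := inner_H01V_of_hasWeakDeriv hF hf H v
    rw [inner_toLp_left] at this
    change ∫ x, f x * H01V v x ∂vol01 + _ = 0
    rw [this, neg_add_cancel]
  set c : ℝ := inner ℝ oneL2 (M T + hF.toLp _)
  refine ⟨c, ?_, ?_⟩
  · have e1 : ‖hF.toLp _‖ ≤ ‖hf.toLp f‖ :=
      norm_toLp_le_of_ae_bound hF (norm_nonneg _) (ae_mem_Ioo.mono fun x hx =>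
        (abs_prim_le hfi (Ioo_subset_Icc_self hx)).trans (integral_abs_le_norm_toLp hf))
    have e2 := abs_real_inner_le_norm oneL2 (M T + hF.toLp _)
    rw [norm_oneL2, one_mul] at e2
    have e3 : ‖M T‖ ≤ KM * ‖u‖ := (h.norm_mul T).trans
      (mul_le_mul_of_nonneg_left (norm_twoSidedDeriv_le hβ hβ1 h0 h1 u) hKM)
    exact e2.trans ((norm_add_le _ _).trans (add_le_add e3 e1))
  · filter_upwards [h.coe_mul T, hF.coeFn_toLp, Lp.coeFn_add (M T) (hF.toLp _),
      Lp.coeFn_smul c oneL2, coeFn_oneL2] with x e1 e2 e3 e4 e5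
    rw [← hg, e3, Pi.add_apply, e1, e2, Pi.smul_apply, e5, smul_eq_mul, mul_one] at e4
    linarith

theorem sobolevBound_const_sub_prim {m : ℕ} {f : ℝ → ℝ} {B c B' : ℝ} (hf : SobolevBound m f B)
    (hB : 3 * B ≤ B') (hc : |c| + B ≤ B') : SobolevBound (m + 1) (fun x => c - prim f x) B' := by
  obtain ⟨hf2, hfB⟩ := hf.zero_le
  have hfi := hf2.integrable one_le_two
  have hcont : ContinuousOn (fun x => c - prim f x) (Icc 0 1) :=
    continuousOn_const.sub (continuousOn_prim hfi)
  -- The derivative $-f$ is written as $f-2f$ so that `SobolevBound.add_smul` applies; its bound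
  -- $B+2B$ explains the hypothesis with $3B$.
  refine ⟨⟨memLp_of_continuousOn hcont 2, ?_⟩, fun x => f x + -2 * f x, ?_,
    (hf.add_smul hf (-2)).mono ?_⟩
  · refine norm_toLp_le_of_ae_bound _ (by linarith [abs_nonneg c, hf.nonneg])
      (ae_mem_Ioo.mono fun x hx => ?_)
    have := (abs_prim_le hfi (Ioo_subset_Icc_self hx)).trans (integral_abs_le_norm_toLp hf2)
    exact (abs_sub _ _).trans (by linarith)
  · refine (hasWeakDeriv_prim_add (hfi.add (hfi.const_mul (-2))) c).congr ?_ EventuallyEq.rfl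
    refine Eventually.of_forall fun x => ?_
    have : (fun x => f x + -2 * f x) = fun x => -f x := by ext x; ring
    change c + prim (fun x => f x + -2 * f x) x = _
    rw [this, prim, intervalIntegral.integral_neg, ← sub_eq_add_neg]
    rfl
  · rw [abs_neg, abs_two]
    linarith

/-- Dividing the flux, which is one order smoother than $f$, by $K$ gives $Tu\in H^{m+1}$, and
$I^\beta_\theta u$ gains one more order. The coefficient enters the constant through $\Lambda$; the
estimate found is by $f$ alone, and adding the norm of $K$ only weakens it. -/
theorem exists_regularity_bound (hβ : 0 < β) (hβ1 : β < 1 / 2) {κ : ℝ} (hκ : 0 < κ)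
    (hKm : 0 < Km) (hKM : 0 ≤ KM) (m : ℕ) (Λ : ℝ) : ∃ C : ℝ, ∀ (θ : ℝ) (K : ℝ → ℝ), 0 ≤ θ → θ ≤ 1 →
      IsDiffusivity Km KM K →
      (∀ (F : Hneg1) (u : H0 (1 - β)), IsWeakSolution β θ K F u → ‖u‖ ≤ 1 / κ * ‖F‖) →
      ∀ (f : ℝ → ℝ) (u : H0 (1 - β)), ContDiffOn ℝ ((m + 1 : ℕ) : ℕ∞ω) K (Icc 0 1) →
        cNorm (m + 1) K ≤ Λ → MemH m f →
        IsWeakSolution β θ K (fun v => ∫ x, f x * H01fn v x ∂vol01) u →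
        MemH (m + 2) (twoSidedInt β θ (H0fn u)) ∧
          hNorm (m + 2) (twoSidedInt β θ (H0fn u)) ≤ C * (cNorm (m + 1) K + hNorm m f) := by
  -- The constant must be supplied for every real $\Lambda$, negative ones included, hence the
  -- absolute value.
  obtain ⟨C₁, hC₁, hdiv⟩ := exists_sobolevBound_of_mul hKm (abs_nonneg Λ) (m + 1)
  obtain ⟨C₂, hC₂, hright⟩ := exists_abs_rightInt_zero_le hβ hβ1
  set C₃ := C₁ * (KM / κ + 3) + (C₂ + 1) / κ
  have hC₃ : 0 ≤ C₃ := by positivity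
  refine ⟨(m + 3) * C₃, fun θ K h0 h1 hK hstab f u hKc hΛ hf hu => ?_⟩
  obtain ⟨M, N, h⟩ := hK.exists_isMulPair
  set B := hNorm m f
  have hSf : SobolevBound m f B := hf.sobolevBound le_rfl
  obtain ⟨hf2, hfB⟩ := hSf.zero_le
  have hB := hSf.nonneg
  have huB : ‖u‖ ≤ 1 / κ * B := by
    refine (hstab ((innerSL ℝ (hf2.toLp f)).comp H01V) u fun v => ?_).trans ?_
    · rw [hu v]
      exact (inner_toLp_left hf2 (H01V v)).symm
    · gcongr
      refine (ContinuousLinearMap.opNorm_le_bound _ (norm_nonneg _) fun v => ?_).trans hfB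
      exact (norm_inner_le_norm _ _).trans
        (mul_le_mul_of_nonneg_left (norm_H01V_le v) (norm_nonneg _))
  obtain ⟨c, hc, hflux⟩ := h.flux_eq (hβ := hβ) (hβ1 := hβ1) h0 h1 hKM hf2 hu
  have hcB : |c| + B ≤ (KM / κ + 3) * B := by
    have : KM * ‖u‖ ≤ KM * (1 / κ * B) := by gcongr
    calc |c| + B ≤ KM * (1 / κ * B) + B + B := by linarith
      _ = (KM / κ + 2) * B := by ring
      _ ≤ _ := by gcongr; norm_num
  have h3B : 3 * B ≤ (KM / κ + 3) * B := by
    gcongr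
    exact le_add_of_nonneg_left (by positivity)
  have hsmooth : SmoothBound (m + 1) K |Λ| := ⟨hKc, fun j hj x hx =>
    (abs_iteratedDerivWithin_le_cNorm hKc hj hx).trans (hΛ.trans (le_abs_self _))⟩
  have hT := hdiv K _ _ _ hsmooth
    (le_of_ae_le hKc.continuousOn (hK.bounds.mono fun x hx => hx.1))
    (sobolevBound_const_sub_prim hSf h3B hcB) hflux
  have hI : SobolevBound (m + 2) (twoSidedInt β θ (H0fn u)) (C₃ * B) := by
    refine ⟨⟨memLp_twoSidedInt hβ hβ1 θ u, ?_⟩, _, hasWeakDeriv_twoSidedInt hβ hβ1 θ u,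
      hT.mono ?_⟩
    · refine norm_toLp_le_of_ae_bound _ (by positivity) (ae_mem_Ioo.mono fun x hx => ?_)
      have hx := Ioo_subset_Icc_self hx
      rw [twoSidedInt_H0fn_eq hβ hβ1 θ u hx]
      have e1 : |(1 - θ) * rightInt β (H0fn u) 0| ≤ C₂ * ‖u‖ := by
        rw [abs_mul, abs_of_nonneg (sub_nonneg.2 h1)]
        exact (mul_le_of_le_one_left (abs_nonneg _) (by linarith)).trans (hright u)
      have e2 : |prim (twoSidedDeriv hβ hβ1 θ u) x| ≤ ‖u‖ :=
        (abs_prim_le (integrable_L2I _) hx).trans ((integral_abs_le_norm _).trans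
          (norm_twoSidedDeriv_le hβ hβ1 h0 h1 u))
      calc _ ≤ C₂ * ‖u‖ + ‖u‖ := (abs_add_le _ _).trans (add_le_add e1 e2)
        _ = (C₂ + 1) * ‖u‖ := by ring
        _ ≤ (C₂ + 1) * (1 / κ * B) := by gcongr
        _ = 0 * B + (C₂ + 1) / κ * B := by ring
        _ ≤ C₁ * (KM / κ + 3) * B + (C₂ + 1) / κ * B := by gcongr; positivity
        _ = _ := by ring
    · calc _ = C₁ * (KM / κ + 3) * B + 0 * B := by ring
        _ ≤ C₁ * (KM / κ + 3) * B + (C₂ + 1) / κ * B := by gcongr; positivity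
        _ = _ := by ring
  obtain ⟨r1, r2⟩ := hI.memH
  refine ⟨r1, r2.trans ?_⟩
  have hcN : 0 ≤ cNorm (m + 1) K := (abs_nonneg _).trans
    (abs_iteratedDerivWithin_le_cNorm hKc (Nat.zero_le _) (left_mem_Icc.2 zero_le_one))
  calc _ = (m + 3) * C₃ * (0 + B) := by push_cast; ring
    _ ≤ _ := by gcongr

end Regularity

end FracDiff

theorem theorem7p2 (β : ℝ) (hβ0 : 0 < β) (hβ1 : β < 1 / 2) :
    ∃ ε₀ : ℝ, 0 < ε₀ ∧ ∀ Km KM : ℝ, 0 < Km → Km ≤ KM →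
      ∃ κ M : ℝ, ∃ C : ℕ → ℝ → ℝ, 0 < κ ∧
        ∀ (θ : ℝ) (K : ℝ → ℝ), 0 ≤ θ → θ ≤ 1 → IsDiffusivity Km KM K →
          perturbation K < ENNReal.ofReal ε₀ →
            -- the solvability condition holds
            SolvabilityCondition β θ K ∧
            -- existence and uniqueness of the weak solution
            (∀ f : Hneg1, ∃! u : H0 (1 - β), IsWeakSolution β θ K f u) ∧
            -- boundedness, weak coercivity and the stability estimate
            BoundedForm β θ K M ∧
            WeaklyCoercive β θ K κ ∧
            (∀ (f : Hneg1) (u : H0 (1 - β)), IsWeakSolution β θ K f u → ‖u‖ ≤ 1 / κ * ‖f‖) ∧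
            -- regularity
            (∀ (m : ℕ) (Λ : ℝ) (f : ℝ → ℝ) (u : H0 (1 - β)),
              ContDiffOn ℝ ((m + 1 : ℕ) : WithTop ℕ∞) K (Set.Icc 0 1) → cNorm (m + 1) K ≤ Λ →
              MemH m f →
              IsWeakSolution β θ K (fun v => ∫ x, f x * H01fn v x ∂vol01) u →
                MemH (m + 2) (twoSidedInt β θ (H0fn u)) ∧
                hNorm (m + 2) (twoSidedInt β θ (H0fn u)) ≤ C m Λ * (cNorm (m + 1) K + hNorm m f)) := by
  obtain ⟨C₀, hC₀, hrange⟩ := exists_range_twoSidedDeriv_eq hβ0 hβ1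
  -- $C_0$ bounds the normals $p$ for all $\theta$ at once and depends on $\beta$ alone, and so does
  -- the threshold.
  refine ⟨1 / (2 * C₀), by positivity, fun Km KM hKm hle => ?_⟩
  have hKM : 0 < KM := hKm.trans_le hle
  have hκ : 0 < infSup β C₀ Km KM := infSup_pos hβ0 hβ1 hC₀ hKm hKM
  choose C hC using exists_regularity_bound (Km := Km) hβ0 hβ1 hκ hKm hKM.le
  refine ⟨infSup β C₀ Km KM, KM, C, hκ, fun θ K h0 h1 hK hpert => ?_⟩
  obtain ⟨p, hp1, hpC, hpr⟩ := hrange θ ⟨h0, h1⟩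
  have hp : IsRangeNormal hβ0 hβ1 θ p := ⟨hp1, hpr⟩
  obtain ⟨M, N, h⟩ := hK.exists_isMulPair
  have hm : 0 < inner ℝ oneL2 (N oneL2) := (one_div_pos.2 hKM).trans_le h.mean
  have hn := h.half_mean_le_inner hKM hp1 hC₀ hpC hpert
  have hn0 : 0 < inner ℝ p (N oneL2) := lt_of_lt_of_le (by positivity) hn
  have htest := hp.exists_test h h0 h1 hKm hKM hC₀ hpC hn
  have hsolve := hp.exists_A_eq h hn0
  have hstab : ∀ (F : Hneg1) (u : H0 (1 - β)), IsWeakSolution β θ K F u →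
      ‖u‖ ≤ 1 / infSup β C₀ Km KM * ‖F‖ := fun F u hu => norm_le_of_isWeakSolution hκ htest hu
  exact ⟨hp.solvabilityCondition h h0 h1 hm hn0,
    existsUnique_isWeakSolution h hβ0 hβ1 hκ htest hsolve,
    h.boundedForm hβ0 hβ1 hKM h0 h1, weaklyCoercive_of_exists hκ htest hsolve, hstab,
    fun m Λ f u => hC m Λ θ K h0 h1 hK hstab f u⟩
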